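/- **Data.** Let the vocabulary be $[V]$ with $V\ge 2$ and let $T\ge 2$. A trigger $q$ and an output token $o$ are drawn uniformly and independently from $[V]$; $z_1$ is uniform; $z_{i+1}$ is uniform if $z_i\ne q$ and $z_{i+1}=o$ if $z_i=q$. Condition this law on the event that $z_T=q$ and that $q$ occurs exactly twice in $z_{1:T}$. Let $t_q$ be the position of the first occurrence of $q$ and let the label be $y=z_{T+1}=o$. (All tokens can be triggers, so $Q=[V]$.) **Model.** Frozen parameters: vectors $w_E(v),w_U(v)\in\mathbb R^d$ ($v\in[V]$), relative encodings $r_{-i}\in\mathbb R^d$, matrices $W_O^1,W_V^1,W_V^2\in\mathbb R^{d\times d}$, $\Phi_1=W_O^1W_V^1$, and $W_Q^1=W_Q^2=I$. With $\sigma$ the softmax over the positions $s\le t$, the two-layer attention-only transformer with relative positional encoding computes $x^{(1)}_t=x^{(1,0)}_t+x^{(1,1)}_t$, where $$x^{(1,0)}_t=\sum_{s\le t}\sigma\big((W_K^1(w_E(z_s)+r_{s-t}))^\top W_Q^1 w_E(z_t)\big)_s\,\Phi_1w_E(z_s),\qquad x^{(1,1)}_t=w_E(z_t),$$ $$x^{(2)}_t=W_O^2W_V^2\sum_{s\le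 t}\sigma\big((W_K^2k_s)^\top W_Q^2h_t\big)_s\,h_s+x^{(1)}_t ,$$ and the logits $w_U(k)^\top x^{(2)}_T$. In the *full* architecture $k_s=h_s=x_s^{(1)}$; in the *simplified* architecture the second-layer keys are $k_s=x_s^{(1,0)}$ and the second-layer queries and values are taken from $h_s=x_s^{(1,1)}$. **Training.** Starting from $W_O^2=W_K^2=W_K^1=0$, the matrices $W_O^2$, then $W_K^2$, then $W_K^1$ each receive one gradient step of size $\eta>0$ on the expected cross-entropy loss of predicting $y$, each step using the matrices already trained. **Embeddings.** For $\varepsilon>0$ the embeddings are called $\varepsilon$-near-orthonormal if in the family of all $w_E(v)$, $\Phi_1w_E(v)$, $w_U(v)$, $W_V^2w_E(v)$, $W_V^2\Phi_1w_E(v)$ ($v\in[V]$) and $r_{-i}$ ($0\le i<T$) every squared norm is within $\varepsilon$ of $1$ and every inner product of two different members is within $\varepsilon$ of $0$. An *association* is a matrix $ab^\top$ with $a,b$ in this family. **Theorem.** For every $H>0$ there are $C,c>0$ and $V_0$ such that for all $V\ge2$, $T\ge2$, $0<\eta\le H$ and each of the two architectures there are real numbers $\alpha,\alpha',\beta$ (which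 do not depend on the tokens, on the positions, on the dimension $d$ or on the embeddings) with the following properties. 1. For every $\delta>0$ there is $\varepsilon>0$ such that for every $d$ and all $\varepsilon$-near-orthonormal embeddings the trained matrices are $$W_O^2=\sum_{v}\omega(v)\,w_U(v)(W_V^2w_E(v))^\top+(W_O^2)',\quad W_K^2=\sum_{k\in Q}\psi(k)\,w_E(k)(\Phi_1w_E(k))^\top+(W_K^2)',\quad W_K^1=\sum_{k\in Q}\chi(k)\,w_E(k)r_{-1}^\top+(W_K^1)',$$ where each of $(W_O^2)',(W_K^2)',(W_K^1)'$ is a linear combination of associations other than those in the corresponding displayed sum, and for all $v,k\in[V]$ $$|\omega(v)-\alpha|\le\delta,\qquad|\psi(k)-\alpha'|\le\delta,\qquad|\chi(k)-\beta|\le\delta;$$ moreover, $w_U(v)^\top W_O^2W_V^2w_E(v)$, $w_E(k)^\top W_K^2\Phi_1w_E(k)$ and $w_E(v)^\top W_K^1r_{-1}$ are within $\delta$ of $\alpha$, $\alpha'$ and $\beta$, respectively. (So for exactly orthonormal embeddings these scores are equal to $\alpha,\alpha',\beta$.) 2. $\big|\alpha-\frac{\eta}{VT}\big|\le C\,\frac{\eta}{VT}\big(\frac1V+\frac1T+\frac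 T{V^2}\big)$. 3. In the simplified architecture, $\alpha'\ge c\,\frac{\alpha\eta}{VT}\cdot\frac1T$ whenever $V\ge V_0$ and $3\le T\le V$. 4. In the simplified architecture, $$\Big|\beta-\frac{\eta\alpha\alpha'}{VT}\sum_{t=1}^{T}\frac{P(t_q=t-1)}{t}\Big(1-\frac1t\Big)\Big|\le C\,\frac{|\eta\alpha\alpha'|}{VT}\Big(\frac1V+\frac1T\Big)\sum_{t=1}^{T}\frac{P(t_q=t-1)}{t}.$$ -/

import Mathlib

open scoped Matrix

noncomputable section

namespace RPETransformer

/-! Tokens are elements of `Fin V`. A sequence of length `T = n + 1` is a function on `Fin (n + 1)`;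
the index `i : Fin (n + 1)` is the position `i + 1 ∈ {1, …, T}`, so that `Fin.last n` is `T`. -/

abbrev TokenSeq (V n : ℕ) := Fin (n + 1) → Fin V

abbrev Mat (d : ℕ) := Matrix (Fin d) (Fin d) ℝ

/-! ### The bigram model with one trigger token -/

/-- Probability that token `j` follows token `i` when the trigger is `q` and its output is `o`. -/
def transProb (V : ℕ) (q o i j : Fin V) : ℝ :=
  if i = q then (if j = o then 1 else 0) else 1 / V

/-- Probability of drawing the trigger `q`, the output `o` and the sequence `z`: the trigger, the
output and `z₁` are uniform, and then one follows the bigram transitions. -/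
def genProb (V n : ℕ) (q o : Fin V) (z : TokenSeq V n) : ℝ :=
  (1 / V) * (1 / V) * ((1 / V) * ∏ i : Fin n, transProb V q o (z i.castSucc) (z i.succ))

/-- The sequence ends with the trigger, at its second occurrence. -/
def IsTrainingSeq {V n : ℕ} (q : Fin V) (z : TokenSeq V n) : Prop :=
  z (Fin.last n) = q ∧ (Finset.univ.filter (fun t => z t = q)).card = 2

instance {V n : ℕ} (q : Fin V) (z : TokenSeq V n) : Decidable (IsTrainingSeq q z) := by
  unfold IsTrainingSeq; infer_instance

/-- Unnormalised weight of `(q, o, z)` among the training sequences. -/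
def trainWeight (V n : ℕ) (q o : Fin V) (z : TokenSeq V n) : ℝ :=
  if IsTrainingSeq q z then genProb V n q o z else 0

/-- Expectation under the generating law conditioned on the event that `z` is a training sequence.
As `z_T = q`, the next token is `z_{T+1} = o`, so that `o` is the label `y`. -/
def expect (V n : ℕ) (f : Fin V → Fin V → TokenSeq V n → ℝ) : ℝ :=
  (∑ q, ∑ o, ∑ z, trainWeight V n q o z * f q o z) / ∑ q, ∑ o, ∑ z, trainWeight V n q o z

open Classical in
/-- `P(t_q = s)`, where `t_q ∈ {1, …, T}` is the position of the first trigger. -/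
def probFirstTrigger (V n s : ℕ) : ℝ :=
  expect V n fun q _ z =>
    if ∃ t : Fin (n + 1), (t : ℕ) + 1 = s ∧ z t = q ∧ ∀ t' < t, z t' ≠ q then 1 else 0

/-! ### The two-layer attention-only transformer with relative positional encoding -/

/-- The parameters that are frozen during training; `r i` is the relative encoding `r_{-i}`. -/
structure Frozen (V d : ℕ) where
  wE : Fin V → Fin d → ℝ
  wU : Fin V → Fin d → ℝ
  r : ℕ → Fin d → ℝ
  WQ1 : Mat d
  WV1 : Mat d
  WO1 : Mat d
  WQ2 : Mat d
  WV2 : Mat d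

/-- The matrices that are trained. -/
structure Weights (d : ℕ) where
  WK1 : Mat d
  WK2 : Mat d
  WO2 : Mat d

/-- `full`: queries, keys and values of the second layer are the whole output
`x⁽¹⁾ = x⁽¹'⁰⁾ + x⁽¹'¹⁾` of the first layer (attention output plus residual token embedding).
`streams`: the keys are the attention output `x⁽¹'⁰⁾` and the queries and values are the residual
token embedding `x⁽¹'¹⁾`. -/
inductive Arch
  | full
  | streams

variable {V d n : ℕ}

def Frozen.Phi1 (P : Frozen V d) : Mat d := P.WO1 * P.WV1

/-- Softmax of the scores `u s`, `s ≤ t`. -/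
def causalSoftmax (u : Fin (n + 1) → ℝ) (t s : Fin (n + 1)) : ℝ :=
  Real.exp (u s) / ∑ s' ∈ Finset.Iic t, Real.exp (u s')

/-- First-layer score at query position `t` of the key at position `s ≤ t`. -/
def score1 (P : Frozen V d) (W : Weights d) (z : TokenSeq V n) (t s : Fin (n + 1)) : ℝ :=
  (W.WK1 *ᵥ (P.wE (z s) + P.r ((t : ℕ) - (s : ℕ)))) ⬝ᵥ (P.WQ1 *ᵥ P.wE (z t))

/-- Output of the first attention. -/
def x10 (P : Frozen V d) (W : Weights d) (z : TokenSeq V n) (t : Fin (n + 1)) : Fin d → ℝ :=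
  ∑ s ∈ Finset.Iic t, causalSoftmax (score1 P W z t) t s • (P.Phi1 *ᵥ P.wE (z s))

/-- Residual stream of the first layer. -/
def x11 (P : Frozen V d) (z : TokenSeq V n) (t : Fin (n + 1)) : Fin d → ℝ := P.wE (z t)

def x1 (P : Frozen V d) (W : Weights d) (z : TokenSeq V n) (t : Fin (n + 1)) : Fin d → ℝ :=
  x10 P W z t + x11 P z t

def key2 (A : Arch) (P : Frozen V d) (W : Weights d) (z : TokenSeq V n) (t : Fin (n + 1)) :
    Fin d → ℝ :=
  match A with
  | .full => x1 P W z t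
  | .streams => x10 P W z t

/-- Input of the queries and of the values of the second layer. -/
def queryValue2 (A : Arch) (P : Frozen V d) (W : Weights d) (z : TokenSeq V n) (t : Fin (n + 1)) :
    Fin d → ℝ :=
  match A with
  | .full => x1 P W z t
  | .streams => x11 P z t

def score2 (A : Arch) (P : Frozen V d) (W : Weights d) (z : TokenSeq V n) (t s : Fin (n + 1)) : ℝ :=
  (W.WK2 *ᵥ key2 A P W z s) ⬝ᵥ (P.WQ2 *ᵥ queryValue2 A P W z t)

def x2 (A : Arch) (P : Frozen V d) (W : Weights d) (z : TokenSeq V n) (t : Fin (n + 1)) :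
    Fin d → ℝ :=
  W.WO2 *ᵥ (P.WV2 *ᵥ
    ∑ s ∈ Finset.Iic t, causalSoftmax (score2 A P W z t) t s • queryValue2 A P W z s) + x1 P W z t

/-- Logit of the token `k` as the successor of the last token. -/
def logit (A : Arch) (P : Frozen V d) (W : Weights d) (z : TokenSeq V n) (k : Fin V) : ℝ :=
  P.wU k ⬝ᵥ x2 A P W z (Fin.last n)

/-- Expected cross-entropy loss. -/
def loss (n : ℕ) (A : Arch) (P : Frozen V d) (W : Weights d) : ℝ :=
  expect V n fun _ y z => Real.log (∑ k, Real.exp (logit A P W z k)) - logit A P W z y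

/-! ### One gradient step for each trained matrix, from the top to the bottom -/

/-- The matrix of partial derivatives. -/
def grad (L : Mat d → ℝ) (W : Mat d) : Mat d :=
  Matrix.of fun i j => deriv (fun x : ℝ => L (W + x • Matrix.single i j (1 : ℝ))) 0

def gradStep (η : ℝ) (L : Mat d → ℝ) (W : Mat d) : Mat d := W - η • grad L W

def trainedWO2 (n : ℕ) (A : Arch) (P : Frozen V d) (η : ℝ) : Mat d :=
  gradStep η (fun W => loss n A P ⟨0, 0, W⟩) 0

def trainedWK2 (n : ℕ) (A : Arch) (P : Frozen V d) (η : ℝ) : Mat d :=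
  gradStep η (fun W => loss n A P ⟨0, W, trainedWO2 n A P η⟩) 0

def trainedWK1 (n : ℕ) (A : Arch) (P : Frozen V d) (η : ℝ) : Mat d :=
  gradStep η (fun W => loss n A P ⟨W, trainedWK2 n A P η, trainedWO2 n A P η⟩) 0

/-! ### Embeddings and associations -/

/-- Names of the embeddings and of their images under the frozen matrices. -/
inductive Feature (V n : ℕ)
  | tok (v : Fin V)
  | prevTok (v : Fin V)
  | out (v : Fin V)
  | rel (i : Fin (n + 1))
  | val (v : Fin V)
  | prevVal (v : Fin V)

/-- The vectors `w_E(v)`, `Φ₁ w_E(v)`, `w_U(v)`, `r_{-i}`, `W_V² w_E(v)` and `W_V² Φ₁ w_E(v)`. -/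
def Frozen.vec (P : Frozen V d) : Feature V n → Fin d → ℝ
  | .tok v => P.wE v
  | .prevTok v => P.Phi1 *ᵥ P.wE v
  | .out v => P.wU v
  | .rel i => P.r i
  | .val v => P.WV2 *ᵥ P.wE v
  | .prevVal v => P.WV2 *ᵥ (P.Phi1 *ᵥ P.wE v)

/-- All these vectors have squared norm within `ε` of `1`, and the inner product of two of them is
within `ε` of `0`. -/
def NearOrthonormal (n : ℕ) (ε : ℝ) (P : Frozen V d) : Prop :=
  (∀ a : Feature V n, |P.vec a ⬝ᵥ P.vec a - 1| ≤ ε) ∧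
    ∀ a b : Feature V n, a ≠ b → |P.vec a ⬝ᵥ P.vec b| ≤ ε

/-- Linear combinations of the associations `u_a u_bᵀ` of pairs `(a, b)` outside `S`. -/
def otherAssociations (P : Frozen V d) (S : Set (Feature V n × Feature V n)) :
    Submodule ℝ (Mat d) :=
  Submodule.span ℝ
    {W | ∃ a b : Feature V n, (a, b) ∉ S ∧ W = Matrix.vecMulVec (P.vec a) (P.vec b)}

/-- The pairs `(w_U(v), W_V² w_E(v))`. -/
def pairsWO2 (V n : ℕ) : Set (Feature V n × Feature V n) := {p | ∃ v, p = (.out v, .val v)}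

/-- The pairs `(w_E(k), Φ₁ w_E(k))`. -/
def pairsWK2 (V n : ℕ) : Set (Feature V n × Feature V n) := {p | ∃ k, p = (.tok k, .prevTok k)}

/-- The pairs `(w_E(k), r_{-1})`. -/
def pairsWK1 (V n : ℕ) : Set (Feature V n × Feature V n) :=
  {p | ∃ k, ∃ i : Fin (n + 1), (i : ℕ) = 1 ∧ p = (.tok k, .rel i)}

end RPETransformer

end

open RPETransformer

noncomputable section

namespace RPETransformer

variable {V d n : ℕ}

/-! ### The loss as a function of tables of bilinear scores -/

/-! The loss sees a trained matrix `W` only through the numbers `u_aᵀ W u_b` for pairs of features,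
and it sees the embeddings only through these numbers and the Gram table `G`. It is therefore a
smooth function `tableLoss` on a space of tables that does not involve `d`. By the chain rule a
gradient step from zero is a combination of the associations `u_a u_bᵀ`, whose coefficients are `-η`
times the partial derivatives of `tableLoss` (`gradStep_eq_assocSum`), and the matrix with
coefficient table `M` has the score table `G M G`. So the coefficients and scores of all three
trained matrices are continuous functions of `G` alone. Near-orthonormality says that `G` is close
to the identity; continuity there yields `ε` from `δ` uniformly in `d`. The numbers `α, α', β` are
the values at the identity, where scores and coefficients coincide.

The loss is invariant under relabelling the tokens, so at the identity the coefficients of the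
displayed pairs do not depend on the token. Each equals its average over the tokens, which is `-η /
V` times one directional derivative of the loss. In the simplified architecture softmax also ignores
a common shift of all logits or of all attention scores. Together with the symmetry this forces the
relevant blocks of `W_O²` and `W_K²` to be multiples of "identity minus `1/V`", with scales `a =
αV/(V-1)` and `a' = α'V/(V-1)`. Hence each score is an explicit expectation: `alphaOf_eq_expect`,
`alphaOf'_eq_expect`, `betaOf_eq_expect`.

All admissible triples `(q, o, z)` have the same weight. So `t_q` is uniform on `1, …, T-1`, and
given `t_q` and `q` the tokens away from the two triggers are independent and uniform on the tokens
other than `q`; this gives the chance `hitProb` that a position shows `o`. Then `α` measures the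
excess of the expected number of occurrences of `o` over `T/V`. The score `α'` measures the
correlation between showing `o` and the fraction of triggers seen so far, which is large right after
the first trigger. Summed over `t_q` and without its factors `1/T`, its main part is the harmonic
number `H_{T-1}` minus `2 - 2/T`, which is positive from `T = 3` on
(`le_sum_hitProb_mul_configFrac`). For `β`, moving first-layer attention to the previous token
raises the trigger fraction by about `(1/t)(1 - 1/t)` at `t = t_q + 1` and changes it only by
`O(1/s²)` at other positions `s`. As the second attention is uniform up to `O(1/V)`, only `t_q + 1`
matters to leading order (`abs_drift_sum_sub_le`). -/

instance : DecidableEq (Feature V n) := Classical.decEq _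

instance : Fintype (Feature V n) :=
  Fintype.ofSurjective
    (fun x : Fin V ⊕ Fin V ⊕ Fin V ⊕ Fin (n + 1) ⊕ Fin V ⊕ Fin V =>
      (match x with
        | .inl v => .tok v
        | .inr (.inl v) => .prevTok v
        | .inr (.inr (.inl v)) => .out v
        | .inr (.inr (.inr (.inl i))) => .rel i
        | .inr (.inr (.inr (.inr (.inl v)))) => .val v
        | .inr (.inr (.inr (.inr (.inr v)))) => .prevVal v : Feature V n))
    (by
      rintro (v | v | v | i | v | v)
      exacts [⟨.inl v, rfl⟩, ⟨.inr (.inl v), rfl⟩, ⟨.inr (.inr (.inl v)), rfl⟩,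
        ⟨.inr (.inr (.inr (.inl i))), rfl⟩, ⟨.inr (.inr (.inr (.inr (.inl v)))), rfl⟩,
        ⟨.inr (.inr (.inr (.inr (.inr v)))), rfl⟩])

/-- A bilinear score for each pair of features. -/
abbrev Table (V n : ℕ) := Feature V n → Feature V n → ℝ

/-- The Gram table of the features, and the scores of `W_K¹`, `W_K²` and `W_O²`. -/
abbrev Tables (V n : ℕ) := Table V n × Table V n × Table V n × Table V n

/-- First-layer score. -/
def tableScore1 (Y : Table V n) (z : TokenSeq V n) (t s : Fin (n + 1)) : ℝ :=
  Y (.tok (z t)) (.tok (z s)) + Y (.tok (z t)) (.rel ⟨t - s, by omega⟩)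

/-- Coefficients of the attention output, when `g v` is the feature of the token `v`. -/
def attnCoeff (g : Fin V → Feature V n) (Y : Table V n) (z : TokenSeq V n) (t : Fin (n + 1)) :
    Feature V n → ℝ :=
  ∑ s ∈ Finset.Iic t, causalSoftmax (tableScore1 Y z t) t s • Pi.single (g (z s)) (1 : ℝ)

/-- Coefficients of the input of the queries and the values, when the residual stream carries the
features `g₀ v` and the attention output carries the features `g₁ v`. -/
def streamCoeff (A : Arch) (g₀ g₁ : Fin V → Feature V n) (Y : Table V n) (z : TokenSeq V n)
    (t : Fin (n + 1)) : Feature V n → ℝ :=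
  match A with
  | .full => attnCoeff g₁ Y z t + Pi.single (g₀ (z t)) (1 : ℝ)
  | .streams => Pi.single (g₀ (z t)) (1 : ℝ)

/-- Coefficients of the keys of the second layer. -/
def keyCoeff (A : Arch) (Y : Table V n) (z : TokenSeq V n) (t : Fin (n + 1)) : Feature V n → ℝ :=
  match A with
  | .full => attnCoeff .prevTok Y z t + Pi.single (.tok (z t)) (1 : ℝ)
  | .streams => attnCoeff .prevTok Y z t

def tableForm (Y : Table V n) (u v : Feature V n → ℝ) : ℝ := ∑ a, ∑ b, u a * Y a b * v b

/-- Second-layer score. -/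
def tableScore2 (A : Arch) (X : Tables V n) (z : TokenSeq V n) (t s : Fin (n + 1)) : ℝ :=
  tableForm X.2.2.1 (streamCoeff A .tok .prevTok X.2.1 z t) (keyCoeff A X.2.1 z s)

def tableLogit (A : Arch) (X : Tables V n) (z : TokenSeq V n) (k : Fin V) : ℝ :=
  ∑ s ∈ Finset.Iic (Fin.last n), causalSoftmax (tableScore2 A X z (Fin.last n)) (Fin.last n) s *
      ∑ a, X.2.2.2 (.out k) a * streamCoeff A .val .prevVal X.2.1 z s a +
    ∑ a, X.1 (.out k) a * (attnCoeff .prevTok X.2.1 z (Fin.last n) +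
      Pi.single (.tok (z (Fin.last n))) (1 : ℝ) : Feature V n → ℝ) a

def tableLoss (A : Arch) (X : Tables V n) : ℝ :=
  expect V n fun _ y z => Real.log (∑ k, Real.exp (tableLogit A X z k)) - tableLogit A X z y

/-- The scores `e_aᵀ W e_b`. -/
def scoreTable (n : ℕ) (P : Frozen V d) (W : Mat d) : Table V n :=
  fun a b => P.vec a ⬝ᵥ (W *ᵥ P.vec b)

def gramTable (n : ℕ) (P : Frozen V d) : Table V n := fun a b => P.vec a ⬝ᵥ P.vec b

def tablesOf (n : ℕ) (P : Frozen V d) (W : Weights d) : Tables V n :=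
  (gramTable n P, scoreTable n P W.WK1, scoreTable n P W.WK2, scoreTable n P W.WO2)

def embed (P : Frozen V d) (c : Feature V n → ℝ) : Fin d → ℝ := ∑ a, c a • P.vec a

lemma embed_add (P : Frozen V d) (c c' : Feature V n → ℝ) :
    embed P (c + c') = embed P c + embed P c' := by
  simp [embed, add_smul, Finset.sum_add_distrib]

lemma embed_smul (P : Frozen V d) (r : ℝ) (c : Feature V n → ℝ) :
    embed P (r • c) = r • embed P c := by
  simp [embed, mul_smul, Finset.smul_sum]

lemma embed_sum (P : Frozen V d) {ι : Type*} (s : Finset ι) (c : ι → Feature V n → ℝ) :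
    embed P (∑ i ∈ s, c i) = ∑ i ∈ s, embed P (c i) := by
  simp only [embed, Finset.sum_apply, Finset.sum_smul]
  exact Finset.sum_comm

lemma embed_single (P : Frozen V d) (a : Feature V n) :
    embed P (Pi.single a (1 : ℝ)) = P.vec a := by
  rw [embed, Finset.sum_eq_single a]
  · simp
  · intro b _ hb; simp [hb]
  · simp

lemma tableForm_scoreTable (P : Frozen V d) (W : Mat d) (u v : Feature V n → ℝ) :
    tableForm (scoreTable n P W) u v = embed P u ⬝ᵥ (W *ᵥ embed P v) := by
  simp only [tableForm, scoreTable, embed, sum_dotProduct, Matrix.mulVec_sum, Matrix.mulVec_smul,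
    dotProduct_sum, smul_dotProduct, dotProduct_smul, smul_eq_mul, Finset.mul_sum]
  rw [Finset.sum_comm]
  refine Finset.sum_congr rfl fun a _ => Finset.sum_congr rfl fun b _ => by ring

lemma score1_eq (P : Frozen V d) (hQ : P.WQ1 = 1) (W : Weights d) (z : TokenSeq V n) :
    score1 P W z = tableScore1 (scoreTable n P W.WK1) z := by
  funext t s
  rw [score1, hQ, Matrix.one_mulVec, dotProduct_comm, Matrix.mulVec_add, dotProduct_add]
  rfl

lemma embed_attnCoeff (P : Frozen V d) (hQ : P.WQ1 = 1) (W : Weights d) (z : TokenSeq V n)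
    (g : Fin V → Feature V n) (t : Fin (n + 1)) :
    embed P (attnCoeff g (scoreTable n P W.WK1) z t) =
      ∑ s ∈ Finset.Iic t, causalSoftmax (score1 P W z t) t s • P.vec (g (z s)) := by
  simp only [attnCoeff, embed_sum, embed_smul, embed_single, score1_eq P hQ]

lemma x10_eq (P : Frozen V d) (hQ : P.WQ1 = 1) (W : Weights d) (z : TokenSeq V n)
    (t : Fin (n + 1)) : x10 P W z t = embed P (attnCoeff .prevTok (scoreTable n P W.WK1) z t) := by
  rw [embed_attnCoeff P hQ]; rfl

lemma x1_eq (P : Frozen V d) (hQ : P.WQ1 = 1) (W : Weights d) (z : TokenSeq V n)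
    (t : Fin (n + 1)) : x1 P W z t = embed P (attnCoeff .prevTok (scoreTable n P W.WK1) z t +
      Pi.single (.tok (z t)) (1 : ℝ)) := by
  rw [embed_add, ← x10_eq P hQ, embed_single]; rfl

lemma key2_eq (A : Arch) (P : Frozen V d) (hQ : P.WQ1 = 1) (W : Weights d) (z : TokenSeq V n)
    (t : Fin (n + 1)) : key2 A P W z t = embed P (keyCoeff A (scoreTable n P W.WK1) z t) := by
  cases A
  · exact x1_eq P hQ W z t
  · exact x10_eq P hQ W z t

lemma queryValue2_eq (A : Arch) (P : Frozen V d) (hQ : P.WQ1 = 1) (W : Weights d)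
    (z : TokenSeq V n) (t : Fin (n + 1)) : queryValue2 A P W z t =
      embed P (streamCoeff A .tok .prevTok (scoreTable n P W.WK1) z t) := by
  cases A
  · exact x1_eq P hQ W z t
  · exact (embed_single P (.tok (z t) : Feature V n)).symm

lemma mulVec_queryValue2_eq (A : Arch) (P : Frozen V d) (hQ : P.WQ1 = 1) (W : Weights d)
    (z : TokenSeq V n) (t : Fin (n + 1)) : P.WV2 *ᵥ queryValue2 A P W z t =
      embed P (streamCoeff A .val .prevVal (scoreTable n P W.WK1) z t) := by
  cases A
  · simp only [queryValue2, x1, x10, x11, streamCoeff, embed_add, embed_attnCoeff P hQ,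
      embed_single, Matrix.mulVec_add, Matrix.mulVec_sum, Matrix.mulVec_smul]
    rfl
  · exact (embed_single P (.val (z t) : Feature V n)).symm

lemma score2_eq (A : Arch) (P : Frozen V d) (hQ : P.WQ1 = 1) (hQ2 : P.WQ2 = 1) (W : Weights d)
    (z : TokenSeq V n) : score2 A P W z = tableScore2 A (tablesOf n P W) z := by
  funext t s
  rw [score2, hQ2, Matrix.one_mulVec, dotProduct_comm, key2_eq A P hQ, queryValue2_eq A P hQ,
    ← tableForm_scoreTable]
  rfl

lemma dotProduct_embed (P : Frozen V d) (u : Fin d → ℝ) (c : Feature V n → ℝ) :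
    u ⬝ᵥ embed P c = ∑ a, (u ⬝ᵥ P.vec a) * c a := by
  simp [embed, dotProduct_sum, dotProduct_smul, mul_comm]

lemma logit_eq (A : Arch) (P : Frozen V d) (hQ : P.WQ1 = 1) (hQ2 : P.WQ2 = 1) (W : Weights d)
    (z : TokenSeq V n) (k : Fin V) : logit A P W z k = tableLogit A (tablesOf n P W) z k := by
  rw [logit, x2, dotProduct_add, x1_eq P hQ, dotProduct_embed, tableLogit, score2_eq A P hQ hQ2]
  congr 1
  simp only [Matrix.mulVec_sum, Matrix.mulVec_smul, dotProduct_sum, dotProduct_smul, smul_eq_mul,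
    mulVec_queryValue2_eq A P hQ]
  refine Finset.sum_congr rfl fun s _ => ?_
  congr 1
  rw [Matrix.dotProduct_mulVec, dotProduct_embed]
  refine Finset.sum_congr rfl fun a _ => ?_
  rw [← Matrix.dotProduct_mulVec]
  rfl

/-- The dimension and the embeddings enter the network only through inner products of features, so
the loss factors through a space that does not depend on `d`. -/
lemma loss_eq (A : Arch) (P : Frozen V d) (hQ : P.WQ1 = 1) (hQ2 : P.WQ2 = 1) (W : Weights d) :
    loss n A P W = tableLoss A (tablesOf n P W) := by
  simp only [loss, tableLoss, logit_eq A P hQ hQ2]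

lemma scoreTable_zero (P : Frozen V d) : scoreTable n P 0 = 0 := by
  funext a b; simp [scoreTable]

/-! ### Smoothness -/

lemma contDiff_causalSoftmax {E : Type*} [NormedAddCommGroup E] [NormedSpace ℝ E] {m : WithTop ℕ∞}
    {u : E → Fin (n + 1) → ℝ} (hu : ∀ s, ContDiff ℝ m fun x => u x s) (t s : Fin (n + 1)) :
    ContDiff ℝ m fun x => causalSoftmax (u x) t s := by
  unfold causalSoftmax
  refine ContDiff.div (hu s).exp (ContDiff.sum fun i _ => (hu i).exp) fun x => ?_
  have : 0 < ∑ s' ∈ Finset.Iic t, Real.exp (u x s') :=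
    Finset.sum_pos (fun _ _ => Real.exp_pos _) ⟨t, by simp⟩
  exact this.ne'

lemma contDiff_attnCoeff (g : Fin V → Feature V n) (z : TokenSeq V n) (t : Fin (n + 1))
    (a : Feature V n) : ContDiff ℝ ⊤ fun X : Tables V n => attnCoeff g X.2.1 z t a := by
  simp only [attnCoeff, Finset.sum_apply, Pi.smul_apply, smul_eq_mul]
  refine ContDiff.sum fun s _ => ContDiff.mul ?_ contDiff_const
  refine contDiff_causalSoftmax (fun s => ?_) t s
  unfold tableScore1
  fun_prop

lemma contDiff_streamCoeff (A : Arch) (g₀ g₁ : Fin V → Feature V n) (z : TokenSeq V n)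
    (t : Fin (n + 1)) (a : Feature V n) :
    ContDiff ℝ ⊤ fun X : Tables V n => streamCoeff A g₀ g₁ X.2.1 z t a := by
  cases A
  · simp only [streamCoeff, Pi.add_apply]
    exact (contDiff_attnCoeff _ _ _ _).add contDiff_const
  · exact contDiff_const

lemma contDiff_keyCoeff (A : Arch) (z : TokenSeq V n) (t : Fin (n + 1)) (a : Feature V n) :
    ContDiff ℝ ⊤ fun X : Tables V n => keyCoeff A X.2.1 z t a := by
  cases A
  · simp only [keyCoeff, Pi.add_apply]
    exact (contDiff_attnCoeff _ _ _ _).add contDiff_const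
  · exact contDiff_attnCoeff _ _ _ _

lemma contDiff_tableScore2 (A : Arch) (z : TokenSeq V n) (t s : Fin (n + 1)) :
    ContDiff ℝ ⊤ fun X : Tables V n => tableScore2 A X z t s := by
  unfold tableScore2 tableForm
  refine ContDiff.sum fun a _ => ContDiff.sum fun b _ => ContDiff.mul (ContDiff.mul ?_ ?_) ?_
  · exact contDiff_streamCoeff _ _ _ _ _ _
  · fun_prop
  · exact contDiff_keyCoeff _ _ _ _

lemma contDiff_tableLogit (A : Arch) (z : TokenSeq V n) (k : Fin V) :
    ContDiff ℝ ⊤ fun X : Tables V n => tableLogit A X z k := by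
  unfold tableLogit
  refine ContDiff.add (ContDiff.sum fun s _ => ContDiff.mul ?_ ?_) ?_
  · exact contDiff_causalSoftmax (fun s => contDiff_tableScore2 _ _ _ _) _ _
  · refine ContDiff.sum fun a _ => ContDiff.mul (by fun_prop) (contDiff_streamCoeff _ _ _ _ _ _)
  · simp only [Pi.add_apply]
    exact ContDiff.sum fun a _ => ContDiff.mul (by fun_prop)
      ((contDiff_attnCoeff _ _ _ _).add contDiff_const)

lemma contDiff_expect {E : Type*} [NormedAddCommGroup E] [NormedSpace ℝ E] {m : WithTop ℕ∞}
    {f : E → Fin V → Fin V → TokenSeq V n → ℝ} (hf : ∀ q o z, ContDiff ℝ m fun x => f x q o z) :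
    ContDiff ℝ m fun x => expect V n (f x) := by
  unfold expect
  exact (ContDiff.sum fun q _ => ContDiff.sum fun o _ => ContDiff.sum fun z _ =>
    contDiff_const.mul (hf q o z)).div_const _

/-- Used twice: for the chain rule along arbitrary directions, and for the continuity of the
differential in the Gram table. -/
lemma contDiff_tableLoss (A : Arch) : ContDiff ℝ ⊤ (tableLoss A : Tables V n → ℝ) := by
  unfold tableLoss
  refine contDiff_expect fun q o z => ContDiff.sub (ContDiff.log ?_ fun X => ?_) ?_
  · exact ContDiff.sum fun k _ => (contDiff_tableLogit _ _ _).exp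
  · exact (Finset.sum_pos (fun _ _ => Real.exp_pos _) ⟨o, by simp⟩).ne'
  · exact contDiff_tableLogit _ _ _

/-! ### The trained matrices as combinations of associations -/

/-- The unit table at the pair `(a, b)`. -/
def unitTable (a b : Feature V n) : Table V n := Pi.single a (Pi.single b 1)

lemma unitTable_apply (a b c e : Feature V n) :
    unitTable a b c e = if c = a ∧ e = b then 1 else 0 := by
  unfold unitTable
  by_cases h : c = a
  · subst h; simp [Pi.single_apply]
  · simp [h]

lemma table_eq_sum (Y : Table V n) : Y = ∑ a, ∑ b, Y a b • unitTable a b := by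
  funext c e
  simp only [Finset.sum_apply, Pi.smul_apply, unitTable_apply, smul_eq_mul]
  rw [Finset.sum_eq_single c, Finset.sum_eq_single e] <;> simp +contextual [eq_comm]

/-- The matrix with coefficients `M` in the associations. -/
def assocSum (P : Frozen V d) (M : Table V n) : Mat d :=
  ∑ a, ∑ b, M a b • Matrix.vecMulVec (P.vec a) (P.vec b)

lemma scoreTable_smul_single (P : Frozen V d) (i j : Fin d) (x : ℝ) :
    scoreTable n P (x • Matrix.single i j (1 : ℝ)) = x • (fun a b => P.vec a i * P.vec b j : Table V n) := by
  funext a b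
  have h (c : ℝ) : (Function.update 0 i c : Fin d → ℝ) = Pi.single i c := rfl
  simp [scoreTable, Matrix.single_mulVec, h]
  ring

/-- The scores of the matrix unit `E_ij` form the table `u_a(i) u_b(j)`. Expanding it in unit tables
turns the partial derivative in the entry `(i, j)` into the `(i, j)` entry of a sum of rank-one
matrices. -/
lemma gradStep_eq_assocSum (P : Frozen V d) (η : ℝ) (L : Mat d → ℝ) (Λ : Table V n → ℝ)
    (Λ' : Table V n →L[ℝ] ℝ) (hL : ∀ W, L W = Λ (scoreTable n P W)) (hΛ : HasFDerivAt Λ Λ' 0) :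
    gradStep η L 0 = assocSum P fun a b => -η * Λ' (unitTable a b) := by
  ext i j
  have key : deriv (fun x : ℝ => L (0 + x • Matrix.single i j (1 : ℝ))) 0 =
      Λ' fun a b => P.vec a i * P.vec b j := by
    simp only [hL, zero_add, scoreTable_smul_single]
    have h1 : HasDerivAt (fun x : ℝ => x • (fun a b => P.vec a i * P.vec b j : Table V n))
        (fun a b => P.vec a i * P.vec b j) 0 := by
      simpa using (hasDerivAt_id (0 : ℝ)).smul_const
        (fun a b => P.vec a i * P.vec b j : Table V n)
    have h2 : HasFDerivAt Λ Λ' ((0 : ℝ) • (fun a b => P.vec a i * P.vec b j : Table V n)) := by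
      rwa [zero_smul]
    exact (h2.comp_hasDerivAt (0 : ℝ) h1).deriv
  have hsum := table_eq_sum (fun a b : Feature V n => P.vec a i * P.vec b j)
  rw [hsum] at key
  simp only [gradStep, grad, Matrix.sub_apply, Matrix.zero_apply, Matrix.smul_apply,
    Matrix.of_apply, key, assocSum, Matrix.sum_apply, Matrix.vecMulVec_apply, map_sum, map_smul,
    smul_eq_mul, Finset.mul_sum, zero_sub, ← Finset.sum_neg_distrib]
  refine Finset.sum_congr rfl fun a _ => Finset.sum_congr rfl fun b _ => by ring

/-- The coefficients of a gradient step from zero on the scores in the position `ι`. -/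
def stepCoeff (A : Arch) (η : ℝ) (ι : Table V n →L[ℝ] Tables V n) (X : Tables V n) : Table V n :=
  fun a b => -η * fderiv ℝ (tableLoss A) X (ι (unitTable a b))

def inWK1 : Table V n →L[ℝ] Tables V n :=
  (ContinuousLinearMap.inr ℝ (Table V n) (Table V n × Table V n × Table V n)).comp
    (ContinuousLinearMap.inl ℝ (Table V n) (Table V n × Table V n))

def inWK2 : Table V n →L[ℝ] Tables V n :=
  (ContinuousLinearMap.inr ℝ (Table V n) (Table V n × Table V n × Table V n)).comp
    ((ContinuousLinearMap.inr ℝ (Table V n) (Table V n × Table V n)).comp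
      (ContinuousLinearMap.inl ℝ (Table V n) (Table V n)))

def inWO2 : Table V n →L[ℝ] Tables V n :=
  (ContinuousLinearMap.inr ℝ (Table V n) (Table V n × Table V n × Table V n)).comp
    ((ContinuousLinearMap.inr ℝ (Table V n) (Table V n × Table V n)).comp
      (ContinuousLinearMap.inr ℝ (Table V n) (Table V n)))

lemma inWK1_apply (Y : Table V n) : inWK1 Y = (0, Y, 0, 0) := rfl
lemma inWK2_apply (Y : Table V n) : inWK2 Y = (0, 0, Y, 0) := rfl
lemma inWO2_apply (Y : Table V n) : inWO2 Y = (0, 0, 0, Y) := rfl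

/-- The table `G M G`. -/
def conjTable (G M : Table V n) : Table V n := fun a b => ∑ c, ∑ e, G a c * M c e * G e b

/-- This closes the recursion: the scores of a trained matrix, which the next step needs, again
depend only on tables. -/
lemma scoreTable_assocSum (P : Frozen V d) (M : Table V n) :
    scoreTable n P (assocSum P M) = conjTable (gramTable n P) M := by
  funext a b
  simp only [scoreTable, assocSum, conjTable, gramTable, Matrix.sum_mulVec, Matrix.smul_mulVec,
    dotProduct_sum, dotProduct_smul, Matrix.vecMulVec_mulVec, smul_eq_mul]
  refine Finset.sum_congr rfl fun c _ => Finset.sum_congr rfl fun e _ => ?_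
  simp
  ring

/-- In these three definitions a zero table stands for a matrix that is not yet trained, and
`conjTable` supplies the scores of those that are. -/
def coeffWO2 (A : Arch) (η : ℝ) (G : Table V n) : Table V n := stepCoeff A η inWO2 (G, 0, 0, 0)

def coeffWK2 (A : Arch) (η : ℝ) (G : Table V n) : Table V n :=
  stepCoeff A η inWK2 (G, 0, 0, conjTable G (coeffWO2 A η G))

def coeffWK1 (A : Arch) (η : ℝ) (G : Table V n) : Table V n :=
  stepCoeff A η inWK1 (G, 0, conjTable G (coeffWK2 A η G), conjTable G (coeffWO2 A η G))

lemma gradStep_eq_stepCoeff (A : Arch) (P : Frozen V d) (η : ℝ) (L : Mat d → ℝ)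
    (ι : Table V n →L[ℝ] Tables V n) (X : Tables V n)
    (hL : ∀ W, L W = tableLoss A (X + ι (scoreTable n P W))) :
    gradStep η L 0 = assocSum P (stepCoeff A η ι X) := by
  refine gradStep_eq_assocSum P η L (fun Y => tableLoss A (X + ι Y))
    ((fderiv ℝ (tableLoss A) X).comp ι) hL ?_
  have h1 : HasFDerivAt (fun Y : Table V n => X + ι Y) ι 0 :=
    (ι.hasFDerivAt).const_add X
  have h2 : HasFDerivAt (tableLoss A) (fderiv ℝ (tableLoss A) X) (X + ι 0) := by
    rw [map_zero, add_zero]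
    exact ((contDiff_tableLoss A).differentiable (by simp) X).hasFDerivAt
  exact h2.comp (0 : Table V n) h1

lemma trainedWO2_eq (A : Arch) (P : Frozen V d) (hQ : P.WQ1 = 1) (hQ2 : P.WQ2 = 1) (η : ℝ) :
    trainedWO2 n A P η = assocSum P (coeffWO2 A η (gramTable n P)) := by
  refine gradStep_eq_stepCoeff A P η _ inWO2 _ fun W => ?_
  rw [loss_eq A P hQ hQ2, tablesOf, inWO2_apply]
  simp [scoreTable_zero]

lemma trainedWK2_eq (A : Arch) (P : Frozen V d) (hQ : P.WQ1 = 1) (hQ2 : P.WQ2 = 1) (η : ℝ) :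
    trainedWK2 n A P η = assocSum P (coeffWK2 A η (gramTable n P)) := by
  refine gradStep_eq_stepCoeff A P η _ inWK2 _ fun W => ?_
  rw [loss_eq A P hQ hQ2, tablesOf, inWK2_apply]
  simp [scoreTable_zero, trainedWO2_eq A P hQ hQ2, scoreTable_assocSum]

lemma trainedWK1_eq (A : Arch) (P : Frozen V d) (hQ : P.WQ1 = 1) (hQ2 : P.WQ2 = 1) (η : ℝ) :
    trainedWK1 n A P η = assocSum P (coeffWK1 A η (gramTable n P)) := by
  refine gradStep_eq_stepCoeff A P η _ inWK1 _ fun W => ?_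
  rw [loss_eq A P hQ hQ2, tablesOf, inWK1_apply]
  simp [trainedWO2_eq A P hQ hQ2, trainedWK2_eq A P hQ hQ2, scoreTable_assocSum]

lemma continuous_stepCoeff (A : Arch) (η : ℝ) (ι : Table V n →L[ℝ] Tables V n)
    {X : Table V n → Tables V n} (hX : Continuous X) :
    Continuous fun G => stepCoeff A η ι (X G) := by
  unfold stepCoeff
  refine continuous_pi fun a => continuous_pi fun b => continuous_const.mul ?_
  exact (((contDiff_tableLoss A).continuous_fderiv (by simp)).comp hX).clm_apply continuous_const

lemma Continuous.conjTable {M : Table V n → Table V n} (hM : Continuous M) :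
    Continuous fun G => conjTable G (M G) := by
  unfold RPETransformer.conjTable
  fun_prop

lemma continuous_coeffWO2 (A : Arch) (η : ℝ) :
    Continuous (coeffWO2 A η : Table V n → Table V n) :=
  continuous_stepCoeff A η inWO2 (by fun_prop)

lemma continuous_coeffWK2 (A : Arch) (η : ℝ) :
    Continuous (coeffWK2 A η : Table V n → Table V n) :=
  continuous_stepCoeff A η inWK2 (continuous_id.prodMk (continuous_const.prodMk
    (continuous_const.prodMk (continuous_coeffWO2 A η).conjTable)))

lemma continuous_coeffWK1 (A : Arch) (η : ℝ) :
    Continuous (coeffWK1 A η : Table V n → Table V n) :=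
  continuous_stepCoeff A η inWK1 (continuous_id.prodMk (continuous_const.prodMk
    ((continuous_coeffWK2 A η).conjTable.prodMk (continuous_coeffWO2 A η).conjTable)))

/-- The Gram table of orthonormal embeddings. -/
def idTable : Table V n := fun a b => if a = b then 1 else 0

lemma conjTable_idTable (M : Table V n) : conjTable idTable M = M := by
  funext a b
  simp only [conjTable, idTable]
  rw [Finset.sum_eq_single a, Finset.sum_eq_single b] <;> simp +contextual [eq_comm]

lemma NearOrthonormal.dist_gramTable_le {ε : ℝ} {P : Frozen V d} (hε : 0 ≤ ε)
    (h : NearOrthonormal n ε P) : dist (gramTable n P) idTable ≤ ε := by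
  refine (dist_pi_le_iff hε).2 fun a => (dist_pi_le_iff hε).2 fun b => ?_
  rw [Real.dist_eq, gramTable, idTable]
  by_cases hab : a = b
  · subst hab; simpa using h.1 a
  · simpa [hab] using h.2 a b hab

/-- A continuous function of the Gram table is nearly constant for nearly orthonormal embeddings. -/
lemma exists_nearOrthonormal_dist_lt (F : Table V n → Table V n) (hF : Continuous F) {δ : ℝ}
    (hδ : 0 < δ) : ∃ ε > 0, ∀ G, dist G idTable ≤ ε → ∀ a b, |F G a b - F idTable a b| ≤ δ := by
  obtain ⟨ε, hε, h⟩ := Metric.continuousAt_iff.1 (hF.continuousAt (x := idTable)) δ hδ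
  refine ⟨ε / 2, by positivity, fun G hG a b => ?_⟩
  have h1 := (h (lt_of_le_of_lt hG (by linarith))).le
  exact ((dist_le_pi_dist (F G a) (F idTable a) b).trans (dist_le_pi_dist _ _ a)).trans h1

/-- Splitting off the associations of the pairs `(f v, g v)`. -/
lemma exists_otherAssociations (P : Frozen V d) (M : Table V n)
    (S : Set (Feature V n × Feature V n)) (f g : Fin V → Feature V n)
    (hf : Function.Injective f) (hS : S = Set.range fun v => (f v, g v)) :
    ∃ W' ∈ otherAssociations P S,
      assocSum P M = ∑ v, M (f v) (g v) • Matrix.vecMulVec (P.vec (f v)) (P.vec (g v)) + W' := by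
  classical
  refine ⟨∑ p ∈ Finset.univ.filter fun p : Feature V n × Feature V n => p ∉ S,
    M p.1 p.2 • Matrix.vecMulVec (P.vec p.1) (P.vec p.2), ?_, ?_⟩
  · refine Submodule.sum_mem _ fun p hp => Submodule.smul_mem _ _ (Submodule.subset_span ?_)
    exact ⟨p.1, p.2, (Finset.mem_filter.1 hp).2, rfl⟩
  · have hinj : Function.Injective fun v => (f v, g v) := fun v w h => hf (Prod.ext_iff.1 h).1
    rw [assocSum, ← Fintype.sum_prod_type'
      (f := fun a b => M a b • Matrix.vecMulVec (P.vec a) (P.vec b)),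
      ← Finset.sum_filter_add_sum_filter_not Finset.univ (fun p => p ∈ S)]
    congr 1
    have : Finset.univ.filter (fun p => p ∈ S) = Finset.univ.map ⟨_, hinj⟩ := by
      ext p; simp [hS]
    rw [this, Finset.sum_map]
    rfl

/-! ### Symmetry under permutations of the tokens -/

/-- The action of a permutation of the tokens on the features. -/
def permuteFun (ρ : Equiv.Perm (Fin V)) : Feature V n → Feature V n
  | .tok v => .tok (ρ v)
  | .prevTok v => .prevTok (ρ v)
  | .out v => .out (ρ v)
  | .rel i => .rel i
  | .val v => .val (ρ v)
  | .prevVal v => .prevVal (ρ v)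

def permute (ρ : Equiv.Perm (Fin V)) : Equiv.Perm (Feature V n) where
  toFun := permuteFun ρ
  invFun := permuteFun ρ.symm
  left_inv := by rintro (v | v | v | i | v | v) <;> simp [permuteFun]
  right_inv := by rintro (v | v | v | i | v | v) <;> simp [permuteFun]

def permuteTable (ρ : Equiv.Perm (Fin V)) (Y : Table V n) : Table V n :=
  fun a b => Y (permute ρ a) (permute ρ b)

def permuteTables (ρ : Equiv.Perm (Fin V)) (X : Tables V n) : Tables V n :=
  (permuteTable ρ X.1, permuteTable ρ X.2.1, permuteTable ρ X.2.2.1, permuteTable ρ X.2.2.2)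

lemma tableScore1_permute (ρ : Equiv.Perm (Fin V)) (Y : Table V n) (z : TokenSeq V n) :
    tableScore1 (permuteTable ρ Y) z = tableScore1 Y (ρ ∘ z) := rfl

lemma single_permute (ρ : Equiv.Perm (Fin V)) (a b : Feature V n) :
    (Pi.single (permute ρ a) 1 : Feature V n → ℝ) (permute ρ b) =
      (Pi.single a 1 : Feature V n → ℝ) b := by
  simp [Pi.single_apply]

lemma attnCoeff_permute (ρ : Equiv.Perm (Fin V)) (Y : Table V n) (z : TokenSeq V n)
    (g : Fin V → Feature V n) (hg : ∀ v, g (ρ v) = permute ρ (g v)) (t : Fin (n + 1)) :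
    attnCoeff g (permuteTable ρ Y) z t = attnCoeff g Y (ρ ∘ z) t ∘ permute ρ := by
  funext a
  simp [attnCoeff, Finset.sum_apply, tableScore1_permute, hg, single_permute]

lemma streamCoeff_permute (A : Arch) (ρ : Equiv.Perm (Fin V)) (Y : Table V n) (z : TokenSeq V n)
    (g₀ g₁ : Fin V → Feature V n) (h₀ : ∀ v, g₀ (ρ v) = permute ρ (g₀ v))
    (h₁ : ∀ v, g₁ (ρ v) = permute ρ (g₁ v)) (t : Fin (n + 1)) :
    streamCoeff A g₀ g₁ (permuteTable ρ Y) z t =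
      streamCoeff A g₀ g₁ Y (ρ ∘ z) t ∘ permute ρ := by
  funext a
  cases A <;> simp [streamCoeff, attnCoeff_permute ρ Y z g₁ h₁, h₀, single_permute]

lemma keyCoeff_permute (A : Arch) (ρ : Equiv.Perm (Fin V)) (Y : Table V n) (z : TokenSeq V n)
    (t : Fin (n + 1)) :
    keyCoeff A (permuteTable ρ Y) z t = keyCoeff A Y (ρ ∘ z) t ∘ permute ρ := by
  funext a
  have h (v : Fin V) : (.tok (ρ v) : Feature V n) = permute ρ (.tok v) := rfl
  cases A <;> simp [keyCoeff, attnCoeff_permute ρ Y z .prevTok (fun _ => rfl), h, single_permute]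

lemma tableForm_permute (ρ : Equiv.Perm (Fin V)) (Y : Table V n) (u v : Feature V n → ℝ) :
    tableForm (permuteTable ρ Y) (u ∘ permute ρ) (v ∘ permute ρ) = tableForm Y u v := by
  simp only [tableForm, permuteTable, Function.comp_apply]
  rw [← Equiv.sum_comp (permute ρ) fun a => ∑ b, u a * Y a b * v b]
  exact Finset.sum_congr rfl fun a _ =>
    Equiv.sum_comp (permute ρ) fun b => u (permute ρ a) * Y (permute ρ a) b * v b

lemma tableScore2_permute (A : Arch) (ρ : Equiv.Perm (Fin V)) (X : Tables V n)
    (z : TokenSeq V n) : tableScore2 A (permuteTables ρ X) z = tableScore2 A X (ρ ∘ z) := by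
  funext t s
  simp only [tableScore2, permuteTables]
  rw [streamCoeff_permute A ρ X.2.1 z _ _ (fun _ => rfl) (fun _ => rfl), keyCoeff_permute,
    tableForm_permute]

lemma tableLogit_permute (A : Arch) (ρ : Equiv.Perm (Fin V)) (X : Tables V n)
    (z : TokenSeq V n) (k : Fin V) :
    tableLogit A (permuteTables ρ X) z k = tableLogit A X (ρ ∘ z) (ρ k) := by
  have hout : permute ρ (.out k : Feature V n) = .out (ρ k) := rfl
  rw [tableLogit, tableScore2_permute, tableLogit]
  congr 1
  · refine Finset.sum_congr rfl fun s _ => ?_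
    congr 1
    simp only [permuteTables]
    rw [streamCoeff_permute A ρ X.2.1 z _ _ (fun _ => rfl) (fun _ => rfl)]
    simp only [permuteTable, Function.comp_apply, hout]
    exact Equiv.sum_comp (permute ρ)
      fun a => X.2.2.2 (.out (ρ k)) a * streamCoeff A .val .prevVal X.2.1 (ρ ∘ z) s a
  · simp only [permuteTables]
    rw [attnCoeff_permute ρ X.2.1 z .prevTok (fun _ => rfl)]
    refine Eq.trans (Finset.sum_congr rfl fun a _ => ?_) (Equiv.sum_comp (permute ρ) _)
    have h (v : Fin V) : (.tok (ρ v) : Feature V n) = permute ρ (.tok v) := rfl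
    simp only [permuteTable, Function.comp_apply, hout, Pi.add_apply, h, single_permute]

lemma trainWeight_permute (ρ : Equiv.Perm (Fin V)) (q o : Fin V) (z : TokenSeq V n) :
    trainWeight V n (ρ q) (ρ o) (ρ ∘ z) = trainWeight V n q o z := by
  simp [trainWeight, IsTrainingSeq, genProb, transProb]

lemma expect_permute (ρ : Equiv.Perm (Fin V)) (f : Fin V → Fin V → TokenSeq V n → ℝ) :
    expect V n (fun q o z => f (ρ q) (ρ o) (ρ ∘ z)) = expect V n f := by
  have key (g : Fin V → Fin V → TokenSeq V n → ℝ) :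
      ∑ q, ∑ o, ∑ z, g (ρ q) (ρ o) (ρ ∘ z) = ∑ q, ∑ o, ∑ z, g q o z := by
    rw [← Equiv.sum_comp ρ fun q => ∑ o, ∑ z, g q o z]
    refine Finset.sum_congr rfl fun q _ => ?_
    rw [← Equiv.sum_comp ρ fun o => ∑ z, g (ρ q) o z]
    exact Finset.sum_congr rfl fun o _ =>
      Equiv.sum_comp (Equiv.arrowCongr (Equiv.refl (Fin (n + 1))) ρ) fun z => g (ρ q) (ρ o) z
  have h := key fun q o z => trainWeight V n q o z * f q o z
  simp only [trainWeight_permute] at h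
  rw [expect, expect, h]

/-- Relabelling the tables amounts to relabelling the sequence and the label, and the law of the
data is invariant. -/
lemma tableLoss_permute (A : Arch) (ρ : Equiv.Perm (Fin V)) (X : Tables V n) :
    tableLoss A (permuteTables ρ X) = tableLoss A X := by
  simp only [tableLoss, tableLogit_permute]
  rw [← expect_permute ρ fun _ y z =>
    Real.log (∑ k, Real.exp (tableLogit A X z k)) - tableLogit A X z y]
  congr 1
  funext q o z
  rw [Equiv.sum_comp ρ fun k => Real.exp (tableLogit A X (ρ ∘ z) k)]

lemma hasDerivAt_tableLoss (A : Arch) (X D : Tables V n) :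
    HasDerivAt (fun x : ℝ => tableLoss A (X + x • D)) (fderiv ℝ (tableLoss A) X D) 0 := by
  have h1 : HasDerivAt (fun x : ℝ => X + x • D) D 0 := by
    simpa using ((hasDerivAt_id (0 : ℝ)).smul_const D).const_add X
  have h2 : HasFDerivAt (tableLoss A) (fderiv ℝ (tableLoss A) X) (X + (0 : ℝ) • D) := by
    rw [zero_smul, add_zero]
    exact ((contDiff_tableLoss A).differentiable (by simp) X).hasFDerivAt
  exact h2.comp_hasDerivAt (0 : ℝ) h1

lemma fderiv_tableLoss_permute (A : Arch) (ρ : Equiv.Perm (Fin V)) (X D : Tables V n) :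
    fderiv ℝ (tableLoss A) (permuteTables ρ X) (permuteTables ρ D) =
      fderiv ℝ (tableLoss A) X D := by
  refine (hasDerivAt_tableLoss A _ _).unique ?_
  have h (x : ℝ) : permuteTables ρ X + x • permuteTables ρ D = permuteTables ρ (X + x • D) := rfl
  simp only [h, tableLoss_permute]
  exact hasDerivAt_tableLoss A X D

lemma permuteTable_unitTable (ρ : Equiv.Perm (Fin V)) (a b : Feature V n) :
    permuteTable ρ (unitTable (permute ρ a) (permute ρ b)) = unitTable a b := by
  funext c e
  simp [permuteTable, unitTable_apply]

/-- The differential of an invariant function at a fixed point of the action is invariant. The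
starting point of each step is fixed because the coefficients of the earlier steps are. -/
lemma permuteTable_stepCoeff (A : Arch) (η : ℝ) (ι : Table V n →L[ℝ] Tables V n)
    (ρ : Equiv.Perm (Fin V)) (hι : ∀ Y, permuteTables ρ (ι Y) = ι (permuteTable ρ Y))
    (X : Tables V n) (hX : permuteTables ρ X = X) :
    permuteTable ρ (stepCoeff A η ι X) = stepCoeff A η ι X := by
  funext a b
  simp only [permuteTable, stepCoeff]
  rw [← fderiv_tableLoss_permute A ρ, hι, hX, permuteTable_unitTable]

lemma permuteTable_idTable (ρ : Equiv.Perm (Fin V)) :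
    permuteTable ρ (idTable : Table V n) = idTable := by
  funext a b
  simp [permuteTable, idTable]

lemma permuteTable_coeffWO2 (A : Arch) (η : ℝ) (ρ : Equiv.Perm (Fin V)) :
    permuteTable ρ (coeffWO2 A η (idTable : Table V n)) = coeffWO2 A η idTable :=
  permuteTable_stepCoeff A η inWO2 ρ (fun _ => rfl) _
    (by simp only [permuteTables, permuteTable_idTable]; rfl)

lemma permuteTable_coeffWK2 (A : Arch) (η : ℝ) (ρ : Equiv.Perm (Fin V)) :
    permuteTable ρ (coeffWK2 A η (idTable : Table V n)) = coeffWK2 A η idTable :=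
  permuteTable_stepCoeff A η inWK2 ρ (fun _ => rfl) _
    (by simp only [permuteTables, permuteTable_idTable, conjTable_idTable,
          permuteTable_coeffWO2]; rfl)

lemma permuteTable_coeffWK1 (A : Arch) (η : ℝ) (ρ : Equiv.Perm (Fin V)) :
    permuteTable ρ (coeffWK1 A η (idTable : Table V n)) = coeffWK1 A η idTable :=
  permuteTable_stepCoeff A η inWK1 ρ (fun _ => rfl) _
    (by simp only [permuteTables, permuteTable_idTable, conjTable_idTable,
          permuteTable_coeffWO2, permuteTable_coeffWK2]; rfl)

/-! ### Sums of coefficients -/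

/-- By linearity of the differential, a sum of coefficients over the tokens costs only one
directional derivative. -/
lemma sum_stepCoeff (A : Arch) (η : ℝ) (ι : Table V n →L[ℝ] Tables V n) (X : Tables V n)
    (f g : Fin V → Feature V n) (c : ℝ)
    (hc : HasDerivAt (fun x : ℝ => tableLoss A (X + x • ι (∑ v, unitTable (f v) (g v)))) c 0) :
    ∑ v, stepCoeff A η ι X (f v) (g v) = -η * c := by
  rw [← (hasDerivAt_tableLoss A X _).unique hc]
  simp only [stepCoeff, map_sum, Finset.mul_sum]

/-- The score that `W_O²` learns for orthonormal embeddings. -/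
def alphaOf (A : Arch) (V n : ℕ) (η : ℝ) : ℝ :=
  (1 / V) * ∑ v : Fin V, coeffWO2 A η (idTable : Table V n) (.out v) (.val v)

/-- The score that `W_K²` learns for orthonormal embeddings. -/
def alphaOf' (A : Arch) (V n : ℕ) (η : ℝ) : ℝ :=
  (1 / V) * ∑ v : Fin V, coeffWK2 A η (idTable : Table V n) (.tok v) (.prevTok v)

/-- The score that `W_K¹` learns at relative position `i` for orthonormal embeddings. -/
def betaOf (A : Arch) (V n : ℕ) (η : ℝ) (i : Fin (n + 1)) : ℝ :=
  (1 / V) * ∑ v : Fin V, coeffWK1 A η (idTable : Table V n) (.tok v) (.rel i)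

lemma eq_average {f : Fin V → ℝ} (hf : ∀ v w, f v = f w) (v : Fin V) :
    f v = (1 / V) * ∑ w, f w := by
  have hV : (V : ℝ) ≠ 0 := by
    have := v.pos
    positivity
  rw [Finset.sum_congr rfl fun w _ => hf w v]
  simp [hV]

lemma coeffWO2_diag (A : Arch) (η : ℝ) (v : Fin V) :
    coeffWO2 A η (idTable : Table V n) (.out v) (.val v) = alphaOf A V n η := by
  refine eq_average (f := fun v => coeffWO2 A η (idTable : Table V n) (.out v) (.val v))
    (fun v w => ?_) v
  have h := congrFun (congrFun (permuteTable_coeffWO2 (n := n) A η (Equiv.swap v w)) (.out w))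
    (.val w)
  simpa [permuteTable, permute, permuteFun] using h

lemma coeffWK2_diag (A : Arch) (η : ℝ) (v : Fin V) :
    coeffWK2 A η (idTable : Table V n) (.tok v) (.prevTok v) = alphaOf' A V n η := by
  refine eq_average (f := fun v => coeffWK2 A η (idTable : Table V n) (.tok v) (.prevTok v))
    (fun v w => ?_) v
  have h := congrFun (congrFun (permuteTable_coeffWK2 (n := n) A η (Equiv.swap v w)) (.tok w))
    (.prevTok w)
  simpa [permuteTable, permute, permuteFun] using h

lemma coeffWK1_rel (A : Arch) (η : ℝ) (v : Fin V) (i : Fin (n + 1)) :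
    coeffWK1 A η (idTable : Table V n) (.tok v) (.rel i) = betaOf A V n η i := by
  refine eq_average (f := fun v => coeffWK1 A η (idTable : Table V n) (.tok v) (.rel i))
    (fun v w => ?_) v
  have h := congrFun (congrFun (permuteTable_coeffWK1 (n := n) A η (Equiv.swap v w)) (.tok w))
    (.rel i)
  simpa [permuteTable, permute, permuteFun] using h

/-- The trained matrices for nearly orthonormal embeddings. -/
lemma trained_nearOrthonormal (A : Arch) (η : ℝ) (i : Fin (n + 1)) (hi : (i : ℕ) = 1) {δ : ℝ}
    (hδ : 0 < δ) : ∃ ε > 0, ∀ (d : ℕ) (P : Frozen V d),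
      P.WQ1 = 1 → P.WQ2 = 1 → NearOrthonormal n ε P →
        (∃ ω : Fin V → ℝ, ∃ W' ∈ otherAssociations P (pairsWO2 V n),
          trainedWO2 n A P η =
            ∑ v, ω v • Matrix.vecMulVec (P.wU v) (P.WV2 *ᵥ P.wE v) + W' ∧
          ∀ v, |ω v - alphaOf A V n η| ≤ δ) ∧
        (∃ ψ : Fin V → ℝ, ∃ W' ∈ otherAssociations P (pairsWK2 V n),
          trainedWK2 n A P η =
            ∑ k, ψ k • Matrix.vecMulVec (P.wE k) (P.Phi1 *ᵥ P.wE k) + W' ∧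
          ∀ k, |ψ k - alphaOf' A V n η| ≤ δ) ∧
        (∃ χ : Fin V → ℝ, ∃ W' ∈ otherAssociations P (pairsWK1 V n),
          trainedWK1 n A P η = ∑ k, χ k • Matrix.vecMulVec (P.wE k) (P.r 1) + W' ∧
          ∀ k, |χ k - betaOf A V n η i| ≤ δ) ∧
        (∀ v, |P.wU v ⬝ᵥ (trainedWO2 n A P η *ᵥ (P.WV2 *ᵥ P.wE v)) - alphaOf A V n η| ≤ δ) ∧
        (∀ k, |P.wE k ⬝ᵥ (trainedWK2 n A P η *ᵥ (P.Phi1 *ᵥ P.wE k)) - alphaOf' A V n η| ≤ δ) ∧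
        ∀ v, |P.wE v ⬝ᵥ (trainedWK1 n A P η *ᵥ P.r 1) - betaOf A V n η i| ≤ δ := by
  obtain ⟨ε₁, hε₁, h₁⟩ := exists_nearOrthonormal_dist_lt (n := n) (V := V) _
    (continuous_coeffWO2 A η) hδ
  obtain ⟨ε₂, hε₂, h₂⟩ := exists_nearOrthonormal_dist_lt (n := n) (V := V) _
    (continuous_coeffWK2 A η) hδ
  obtain ⟨ε₃, hε₃, h₃⟩ := exists_nearOrthonormal_dist_lt (n := n) (V := V) _
    (continuous_coeffWK1 A η) hδ
  obtain ⟨ε₄, hε₄, h₄⟩ := exists_nearOrthonormal_dist_lt (n := n) (V := V) _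
    (continuous_coeffWO2 A η).conjTable hδ
  obtain ⟨ε₅, hε₅, h₅⟩ := exists_nearOrthonormal_dist_lt (n := n) (V := V) _
    (continuous_coeffWK2 A η).conjTable hδ
  obtain ⟨ε₆, hε₆, h₆⟩ := exists_nearOrthonormal_dist_lt (n := n) (V := V) _
    (continuous_coeffWK1 A η).conjTable hδ
  -- At the identity `G M G = M`, so the scores are compared with the same three numbers as the
  -- coefficients.
  simp only [conjTable_idTable] at h₄ h₅ h₆
  refine ⟨min (min (min ε₁ ε₂) (min ε₃ ε₄)) (min ε₅ ε₆), by positivity, fun d P hQ hQ2 hP => ?_⟩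
  have hd := hP.dist_gramTable_le (by positivity)
  simp only [le_min_iff] at hd
  obtain ⟨⟨⟨d₁, d₂⟩, d₃, d₄⟩, d₅, d₆⟩ := hd
  have hr : P.vec (.rel i : Feature V n) = P.r 1 := by rw [← hi]; rfl
  refine ⟨?_, ?_, ?_, fun v => ?_, fun v => ?_, fun v => ?_⟩
  · obtain ⟨W', hW', h⟩ := exists_otherAssociations P (coeffWO2 A η (gramTable n P))
      (pairsWO2 V n) .out .val (fun _ _ h => by simpa using h)
      (by ext p; simp [pairsWO2, eq_comm])
    refine ⟨_, W', hW', (trainedWO2_eq A P hQ hQ2 η).trans h, fun v => ?_⟩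
    rw [← coeffWO2_diag A η v]
    exact h₁ _ d₁ _ _
  · obtain ⟨W', hW', h⟩ := exists_otherAssociations P (coeffWK2 A η (gramTable n P))
      (pairsWK2 V n) .tok .prevTok (fun _ _ h => by simpa using h)
      (by ext p; simp [pairsWK2, eq_comm])
    refine ⟨_, W', hW', (trainedWK2_eq A P hQ hQ2 η).trans h, fun v => ?_⟩
    rw [← coeffWK2_diag A η v]
    exact h₂ _ d₂ _ _
  · obtain ⟨W', hW', h⟩ := exists_otherAssociations P (coeffWK1 A η (gramTable n P))
      (pairsWK1 V n) .tok (fun _ => .rel i) (fun _ _ h => by simpa using h)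
      (by
        ext p
        simp only [pairsWK1, Set.mem_ofPred_eq, Set.mem_range]
        constructor
        · rintro ⟨k, j, hj, rfl⟩
          exact ⟨k, by rw [Fin.ext (hi.trans hj.symm)]⟩
        · rintro ⟨k, rfl⟩
          exact ⟨k, i, hi, rfl⟩)
    rw [hr] at h
    refine ⟨_, W', hW', (trainedWK1_eq A P hQ hQ2 η).trans h, fun v => ?_⟩
    rw [← coeffWK1_rel A η v i]
    exact h₃ _ d₃ _ _
  · rw [← coeffWO2_diag A η v, trainedWO2_eq A P hQ hQ2]
    have := h₄ _ d₄ (.out v) (.val v)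
    rwa [← scoreTable_assocSum] at this
  · rw [← coeffWK2_diag A η v, trainedWK2_eq A P hQ hQ2]
    have := h₅ _ d₅ (.tok v) (.prevTok v)
    rwa [← scoreTable_assocSum] at this
  · rw [← coeffWK1_rel A η v i, trainedWK1_eq A P hQ hQ2, ← hr]
    have := h₆ _ d₆ (.tok v) (.rel i)
    rwa [← scoreTable_assocSum] at this

/-! ### Derivatives of softmax and of the cross-entropy -/

/-- Probabilities of the tokens for given logits. -/
def tokenProb (l : Fin V → ℝ) (k : Fin V) : ℝ := Real.exp (l k) / ∑ j, Real.exp (l j)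

lemma sum_causalSoftmax (u : Fin (n + 1) → ℝ) (t : Fin (n + 1)) :
    ∑ s ∈ Finset.Iic t, causalSoftmax u t s = 1 := by
  have : 0 < ∑ s' ∈ Finset.Iic t, Real.exp (u s') :=
    Finset.sum_pos (fun _ _ => Real.exp_pos _) ⟨t, by simp⟩
  simp only [causalSoftmax, ← Finset.sum_div]
  exact div_self this.ne'

lemma sum_tokenProb [NeZero V] (l : Fin V → ℝ) : ∑ k, tokenProb l k = 1 := by
  have : 0 < ∑ j, Real.exp (l j) := Finset.sum_pos (fun _ _ => Real.exp_pos _) ⟨0, by simp⟩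
  simp only [tokenProb, ← Finset.sum_div]
  exact div_self this.ne'

lemma causalSoftmax_const (c : ℝ) (t s : Fin (n + 1)) :
    causalSoftmax (fun _ => c) t s = 1 / ((t : ℝ) + 1) := by
  have := Real.exp_pos c
  simp only [causalSoftmax, Finset.sum_const, Fin.card_Iic, nsmul_eq_mul, Nat.cast_add,
    Nat.cast_one]
  field_simp

lemma hasDerivAt_causalSoftmax {u : ℝ → Fin (n + 1) → ℝ} {u' : Fin (n + 1) → ℝ} {x : ℝ}
    (hu : ∀ s, HasDerivAt (fun x => u x s) (u' s) x) (t s : Fin (n + 1)) :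
    HasDerivAt (fun x => causalSoftmax (u x) t s)
      (causalSoftmax (u x) t s *
        (u' s - ∑ s' ∈ Finset.Iic t, causalSoftmax (u x) t s' * u' s')) x := by
  have hpos : 0 < ∑ s' ∈ Finset.Iic t, Real.exp (u x s') :=
    Finset.sum_pos (fun _ _ => Real.exp_pos _) ⟨t, by simp⟩
  have h := (hu s).exp.div (HasDerivAt.fun_sum fun s' (_ : s' ∈ Finset.Iic t) => (hu s').exp)
    hpos.ne'
  refine h.congr_deriv ?_
  simp only [causalSoftmax, div_mul_eq_mul_div, ← Finset.sum_div]
  field_simp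

lemma hasDerivAt_expect {f : ℝ → Fin V → Fin V → TokenSeq V n → ℝ}
    {f' : Fin V → Fin V → TokenSeq V n → ℝ} {x : ℝ}
    (hf : ∀ q o z, HasDerivAt (fun x => f x q o z) (f' q o z) x) :
    HasDerivAt (fun x => expect V n (f x)) (expect V n f') x := by
  unfold expect
  exact (HasDerivAt.fun_sum fun q _ => HasDerivAt.fun_sum fun o _ =>
    HasDerivAt.fun_sum fun z _ => (hf q o z).const_mul _).div_const _

lemma hasDerivAt_crossEntropy {l : ℝ → TokenSeq V n → Fin V → ℝ} {l' : TokenSeq V n → Fin V → ℝ}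
    {x : ℝ} (hl : ∀ z k, HasDerivAt (fun x => l x z k) (l' z k) x) :
    HasDerivAt (fun x => expect V n fun _ y z =>
        Real.log (∑ k, Real.exp (l x z k)) - l x z y)
      (expect V n fun _ y z => ∑ k, tokenProb (l x z) k * l' z k - l' z y) x := by
  refine hasDerivAt_expect fun q y z => HasDerivAt.sub ?_ (hl z y)
  have hpos : 0 < ∑ k, Real.exp (l x z k) :=
    Finset.sum_pos (fun _ _ => Real.exp_pos _) ⟨y, by simp⟩
  refine ((HasDerivAt.fun_sum fun k (_ : k ∈ Finset.univ) => (hl z k).exp).log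
    hpos.ne').congr_deriv ?_
  simp only [tokenProb, Finset.sum_div]
  exact Finset.sum_congr rfl fun k _ => by ring

/-! ### The loss near the starting point of each step, for orthonormal embeddings -/

lemma sum_idTable_mul (a : Feature V n) (c : Feature V n → ℝ) :
    ∑ b, idTable a b * c b = c a := by
  simp [idTable]

lemma sum_mul_attnCoeff (f : Feature V n → ℝ) (g : Fin V → Feature V n) (Y : Table V n)
    (z : TokenSeq V n) (t : Fin (n + 1)) :
    ∑ a, f a * attnCoeff g Y z t a =
      ∑ s ∈ Finset.Iic t, causalSoftmax (tableScore1 Y z t) t s * f (g (z s)) := by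
  simp only [attnCoeff, Finset.sum_apply, Pi.smul_apply, smul_eq_mul, Finset.mul_sum]
  rw [Finset.sum_comm]
  refine Finset.sum_congr rfl fun s _ => ?_
  rw [Finset.sum_eq_single (g (z s))]
  · simp [mul_comm]
  · intro b _ hb; simp [hb]
  · simp

lemma attnCoeff_eq_zero (g : Fin V → Feature V n) (Y : Table V n) (z : TokenSeq V n)
    (t : Fin (n + 1)) (a : Feature V n) (ha : ∀ v, a ≠ g v) : attnCoeff g Y z t a = 0 := by
  simp [attnCoeff, Finset.sum_apply, ha]

/-- Orthonormality makes the residual stream invisible in the logits: output vectors are orthogonal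
to the token features and to the features of the attention output. -/
lemma tableLogit_idTable (A : Arch) (Y₁ Y₂ Y₃ : Table V n) (z : TokenSeq V n) (k : Fin V) :
    tableLogit A (idTable, Y₁, Y₂, Y₃) z k =
      ∑ s, causalSoftmax (tableScore2 A (idTable, Y₁, Y₂, Y₃) z (Fin.last n)) (Fin.last n) s *
        ∑ a, Y₃ (.out k) a * streamCoeff A .val .prevVal Y₁ z s a := by
  rw [tableLogit, sum_idTable_mul, Pi.add_apply, attnCoeff_eq_zero _ _ _ _ _ (by simp)]
  have : Finset.Iic (Fin.last n) = Finset.univ := by ext; simp [Fin.le_last]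
  simp [this]

lemma tableLogit_streams (Y₁ Y₂ Y₃ : Table V n) (z : TokenSeq V n) (k : Fin V) :
    tableLogit .streams (idTable, Y₁, Y₂, Y₃) z k =
      ∑ s, causalSoftmax (tableScore2 .streams (idTable, Y₁, Y₂, Y₃) z (Fin.last n))
        (Fin.last n) s * Y₃ (.out k) (.val (z s)) := by
  rw [tableLogit_idTable]
  simp [streamCoeff, Pi.single_apply]

lemma tableScore2_streams (G Y₁ Y₂ Y₃ : Table V n) (z : TokenSeq V n) (t s : Fin (n + 1)) :
    tableScore2 .streams (G, Y₁, Y₂, Y₃) z t s =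
      ∑ s' ∈ Finset.Iic s, causalSoftmax (tableScore1 Y₁ z s) s s' *
        Y₂ (.tok (z t)) (.prevTok (z s')) := by
  rw [← sum_mul_attnCoeff (fun b => Y₂ (.tok (z t)) b)]
  simp [tableScore2, tableForm, streamCoeff, keyCoeff, Pi.single_apply]

lemma tableScore2_zero (A : Arch) (G Y₁ Y₃ : Table V n) (z : TokenSeq V n) (t : Fin (n + 1)) :
    tableScore2 A (G, Y₁, 0, Y₃) z t = fun _ => 0 := by
  funext s
  simp [tableScore2, tableForm]

lemma tableScore1_zero (z : TokenSeq V n) (t : Fin (n + 1)) :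
    tableScore1 (0 : Table V n) z t = fun _ => 0 := by
  funext s
  simp [tableScore1]

/-- With `W_K² = 0` the attention is uniform and the logits are linear in `W_O²`; they vanish at the
start, so every token has probability `1/V`. -/
lemma hasDerivAt_stepWO2 (A : Arch) (D : Table V n) :
    HasDerivAt (fun x : ℝ => tableLoss A ((idTable, 0, 0, 0) + x • inWO2 D))
      (expect V n fun _ y z =>
        ∑ k, 1 / (V : ℝ) * (∑ s, 1 / ((n : ℝ) + 1) *
            ∑ a, D (.out k) a * streamCoeff A .val .prevVal 0 z s a) -
          ∑ s, 1 / ((n : ℝ) + 1) * ∑ a, D (.out y) a * streamCoeff A .val .prevVal 0 z s a) 0 := by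
  have hX (x : ℝ) : ((idTable, 0, 0, 0) + x • inWO2 D : Tables V n) = (idTable, 0, 0, x • D) := by
    simp [inWO2_apply]
  have hl (x : ℝ) (z : TokenSeq V n) (k : Fin V) :
      tableLogit A (idTable, 0, 0, x • D) z k = x * ∑ s, 1 / ((n : ℝ) + 1) *
            ∑ a, D (.out k) a * streamCoeff A .val .prevVal 0 z s a := by
    simp only [tableLogit_idTable, tableScore2_zero, causalSoftmax_const, Pi.smul_apply,
      smul_eq_mul, Finset.mul_sum, Fin.val_last]
    exact Finset.sum_congr rfl fun s _ => Finset.sum_congr rfl fun a _ => by ring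
  simp only [hX, tableLoss, hl]
  refine (hasDerivAt_crossEntropy (l' := fun z k => ∑ s, 1 / ((n : ℝ) + 1) *
    ∑ a, D (.out k) a * streamCoeff A .val .prevVal 0 z s a)
    fun z k => hasDerivAt_mul_const _).congr_deriv ?_
  simp [tokenProb]

/-- Values do not depend on the attention scores here, so only the softmax weights move, and the
derivative of a softmax average is a covariance under `π`. -/
lemma hasDerivAt_tableLogit_streams {Y₁ Y₂ : ℝ → Table V n} (Y₃ : Table V n)
    (z : TokenSeq V n) {u' : Fin (n + 1) → ℝ}
    (hu : ∀ s, HasDerivAt (fun x => tableScore2 .streams (idTable, Y₁ x, Y₂ x, Y₃) z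
      (Fin.last n) s) (u' s) 0) (π : Fin (n + 1) → ℝ)
    (hπ : ∀ s, causalSoftmax (tableScore2 .streams (idTable, Y₁ 0, Y₂ 0, Y₃) z (Fin.last n))
      (Fin.last n) s = π s) (k : Fin V) :
    HasDerivAt (fun x => tableLogit .streams (idTable, Y₁ x, Y₂ x, Y₃) z k)
      (∑ s, π s * (u' s - ∑ s', π s' * u' s') * Y₃ (.out k) (.val (z s))) 0 := by
  simp only [tableLogit_streams]
  have : Finset.Iic (Fin.last n) = Finset.univ := by ext; simp [Fin.le_last]
  refine HasDerivAt.fun_sum fun s _ => ?_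
  have h := (hasDerivAt_causalSoftmax hu (Fin.last n) s).mul_const (Y₃ (.out k) (.val (z s)))
  simpa only [hπ, this] using h

lemma hasDerivAt_stepWK2 (Y₃ D : Table V n) :
    HasDerivAt (fun x : ℝ => tableLoss .streams ((idTable, 0, 0, Y₃) + x • inWK2 D))
      (expect V n fun _ y z =>
        let u' := fun s : Fin (n + 1) => ∑ s' ∈ Finset.Iic s, 1 / ((s : ℝ) + 1) *
          D (.tok (z (Fin.last n))) (.prevTok (z s'))
        let l' := fun k => ∑ s, 1 / ((n : ℝ) + 1) * (u' s - ∑ s', 1 / ((n : ℝ) + 1) * u' s') *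
          Y₃ (.out k) (.val (z s))
        ∑ k, tokenProb (fun k => ∑ s, 1 / ((n : ℝ) + 1) * Y₃ (.out k) (.val (z s))) k * l' k -
          l' y) 0 := by
  have hX (x : ℝ) : ((idTable, 0, 0, Y₃) + x • inWK2 D : Tables V n) =
      (idTable, 0, x • D, Y₃) := by
    simp [inWK2_apply]
  simp only [hX, tableLoss]
  refine (hasDerivAt_crossEntropy (x := 0) fun z k =>
    hasDerivAt_tableLogit_streams (Y₁ := fun _ => 0) (Y₂ := fun x => x • D) Y₃ z
      (u' := fun s : Fin (n + 1) => ∑ s' ∈ Finset.Iic s, 1 / ((s : ℝ) + 1) *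
          D (.tok (z (Fin.last n))) (.prevTok (z s'))) (fun s => ?_)
      (fun s => 1 / ((n : ℝ) + 1)) (fun s => ?_) k).congr_deriv ?_
  · simp only [tableScore2_streams, tableScore1_zero, causalSoftmax_const, Pi.smul_apply,
      smul_eq_mul]
    refine HasDerivAt.fun_sum fun s' _ => ?_
    simpa [mul_comm] using ((hasDerivAt_mul_const (x := (0 : ℝ))
      (D (.tok (z (Fin.last n))) (.prevTok (z s')))).const_mul (1 / ((s : ℝ) + 1)))
  · simp [zero_smul, tableScore2_zero, causalSoftmax_const]
  · have hl (z : TokenSeq V n) : tableLogit .streams (idTable, 0, 0, Y₃) z =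
        fun k => ∑ s, 1 / ((n : ℝ) + 1) * Y₃ (.out k) (.val (z s)) := by
      funext k
      simp only [tableLogit_streams, tableScore2_zero, causalSoftmax_const, Fin.val_last]
    simp only [zero_smul, hl]

/-- The chain rule passes through both softmaxes: `u'` is a covariance under the uniform first
attention, and `π` is the second attention as already shaped by `W_K²`. -/
lemma hasDerivAt_stepWK1 (Y₂ Y₃ D : Table V n) :
    HasDerivAt (fun x : ℝ => tableLoss .streams ((idTable, 0, Y₂, Y₃) + x • inWK1 D))
      (expect V n fun _ y z =>
        let π := causalSoftmax (fun s : Fin (n + 1) => ∑ s' ∈ Finset.Iic s, 1 / ((s : ℝ) + 1) *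
          Y₂ (.tok (z (Fin.last n))) (.prevTok (z s'))) (Fin.last n)
        let u' := fun s : Fin (n + 1) => ∑ s' ∈ Finset.Iic s, 1 / ((s : ℝ) + 1) *
          (tableScore1 D z s s' - ∑ s'' ∈ Finset.Iic s, 1 / ((s : ℝ) + 1) * tableScore1 D z s s'') *
          Y₂ (.tok (z (Fin.last n))) (.prevTok (z s'))
        let l' := fun k => ∑ s, π s * (u' s - ∑ s', π s' * u' s') * Y₃ (.out k) (.val (z s))
        ∑ k, tokenProb (fun k => ∑ s, π s * Y₃ (.out k) (.val (z s))) k * l' k - l' y) 0 := by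
  have hX (x : ℝ) : ((idTable, 0, Y₂, Y₃) + x • inWK1 D : Tables V n) =
      (idTable, x • D, Y₂, Y₃) := by
    simp [inWK1_apply]
  have h0 (z : TokenSeq V n) : tableScore2 .streams (idTable, 0, Y₂, Y₃) z (Fin.last n) =
      fun s : Fin (n + 1) => ∑ s' ∈ Finset.Iic s, 1 / ((s : ℝ) + 1) *
        Y₂ (.tok (z (Fin.last n))) (.prevTok (z s')) := by
    funext s
    simp only [tableScore2_streams, tableScore1_zero, causalSoftmax_const]
  simp only [hX, tableLoss]
  refine (hasDerivAt_crossEntropy (x := 0) fun z k =>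
    hasDerivAt_tableLogit_streams (Y₁ := fun x => x • D) (Y₂ := fun _ => Y₂) Y₃ z
      (u' := fun s : Fin (n + 1) => ∑ s' ∈ Finset.Iic s, 1 / ((s : ℝ) + 1) *
          (tableScore1 D z s s' - ∑ s'' ∈ Finset.Iic s, 1 / ((s : ℝ) + 1) * tableScore1 D z s s'') *
          Y₂ (.tok (z (Fin.last n))) (.prevTok (z s'))) (fun s => ?_)
      (causalSoftmax (fun s : Fin (n + 1) => ∑ s' ∈ Finset.Iic s, 1 / ((s : ℝ) + 1) *
          Y₂ (.tok (z (Fin.last n))) (.prevTok (z s'))) (Fin.last n)) (fun s => ?_)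
      k).congr_deriv ?_
  · simp only [tableScore2_streams]
    refine HasDerivAt.fun_sum fun s' _ => HasDerivAt.mul_const ?_ _
    have hs (s' : Fin (n + 1)) : HasDerivAt (fun x : ℝ => tableScore1 (x • D) z s s')
        (tableScore1 D z s s') 0 := by
      have (x : ℝ) : tableScore1 (x • D) z s s' = x * tableScore1 D z s s' := by
        simp [tableScore1, mul_add]
      simp only [this]
      exact hasDerivAt_mul_const _
    have h := hasDerivAt_causalSoftmax (u := fun x : ℝ => tableScore1 (x • D) z s)
      (x := 0) hs s s'
    simpa only [zero_smul, tableScore1_zero, causalSoftmax_const] using h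
  · simp only [zero_smul, h0]
  · have hl (z : TokenSeq V n) : tableLogit .streams (idTable, 0, Y₂, Y₃) z =
        fun k => ∑ s, causalSoftmax (fun s : Fin (n + 1) => ∑ s' ∈ Finset.Iic s,
          1 / ((s : ℝ) + 1) * Y₂ (.tok (z (Fin.last n))) (.prevTok (z s'))) (Fin.last n) s *
            Y₃ (.out k) (.val (z s)) := by
      funext k
      simp only [tableLogit_streams, h0]
    simp only [zero_smul, hl]

/-! ### The law of the training sequences -/

/-- The triggers are at the positions `t` and `Fin.last n`, and `o` follows the first one. -/
def IsConfig (t : Fin n) (q o : Fin V) (z : TokenSeq V n) : Prop :=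
  (∀ i, z i = q ↔ i = t.castSucc ∨ i = Fin.last n) ∧ z t.succ = o

instance (t : Fin n) (q o : Fin V) (z : TokenSeq V n) : Decidable (IsConfig t q o z) := by
  unfold IsConfig; infer_instance

lemma IsConfig.isTrainingSeq {t : Fin n} {q o : Fin V} {z : TokenSeq V n}
    (h : IsConfig t q o z) : IsTrainingSeq q z := by
  refine ⟨(h.1 _).2 (Or.inr rfl), ?_⟩
  have : Finset.univ.filter (fun i => z i = q) = {t.castSucc, Fin.last n} := by
    ext i; simp [h.1 i]
  rw [this, Finset.card_pair (Fin.castSucc_lt_last t).ne]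

lemma IsConfig.eq {t t' : Fin n} {q o : Fin V} {z : TokenSeq V n}
    (h : IsConfig t q o z) (h' : IsConfig t' q o z) : t' = t := by
  rcases (h.1 t'.castSucc).1 ((h'.1 _).2 (Or.inl rfl)) with h | h
  · exact Fin.castSucc_injective n h
  · exact absurd h (Fin.castSucc_lt_last t').ne

lemma IsTrainingSeq.exists_iff {q : Fin V} {z : TokenSeq V n} (h : IsTrainingSeq q z) :
    ∃ t : Fin n, ∀ i, z i = q ↔ i = t.castSucc ∨ i = Fin.last n := by
  have hcard : ((Finset.univ.filter fun i => z i = q).erase (Fin.last n)).card = 1 := by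
    rw [Finset.card_erase_of_mem (by simpa using h.1), h.2]
  obtain ⟨j, hj⟩ := Finset.card_eq_one.1 hcard
  have hjm : j ∈ (Finset.univ.filter fun i => z i = q).erase (Fin.last n) := by simp [hj]
  have hjl : j ≠ Fin.last n := (Finset.mem_erase.1 hjm).1
  refine ⟨j.castPred hjl, fun i => ?_⟩
  rw [Fin.castSucc_castPred]
  by_cases hi : i = Fin.last n
  · simp [hi, h.1]
  · have : i ∈ (Finset.univ.filter fun i => z i = q).erase (Fin.last n) ↔ i ∈ ({j} : Finset _) := by
      rw [hj]
    simpa [hi] using this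

/-- Among the `n` transitions only the one out of the first trigger is deterministic, since the
second trigger sits at the end. The weight is thus the same for all configurations. -/
lemma IsConfig.genProb {t : Fin n} {q o : Fin V} {z : TokenSeq V n} (h : IsConfig t q o z) :
    genProb V n q o z = (1 / (V : ℝ)) ^ 3 * (1 / (V : ℝ)) ^ (n - 1) := by
  have hprod : ∏ i : Fin n, transProb V q o (z i.castSucc) (z i.succ) =
      (1 / (V : ℝ)) ^ (n - 1) := by
    rw [← Finset.mul_prod_erase Finset.univ _ (Finset.mem_univ t),
      Finset.prod_congr rfl (g := fun _ => 1 / (V : ℝ))]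
    · simp [transProb, (h.1 t.castSucc).2 (Or.inl rfl), h.2]
    · intro i hi
      have : z i.castSucc ≠ q := fun hz => by
        rcases (h.1 _).1 hz with h | h
        · exact (Finset.mem_erase.1 hi).1 (Fin.castSucc_injective n h)
        · exact absurd h (Fin.castSucc_lt_last i).ne
      simp [transProb, this]
  rw [RPETransformer.genProb, hprod]
  ring

lemma trainWeight_eq_sum (q o : Fin V) (z : TokenSeq V n) :
    trainWeight V n q o z = (1 / (V : ℝ)) ^ 3 * (1 / (V : ℝ)) ^ (n - 1) *
      ∑ t : Fin n, if IsConfig t q o z then 1 else 0 := by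
  by_cases h : ∃ t : Fin n, IsConfig t q o z
  · obtain ⟨t, ht⟩ := h
    rw [Finset.sum_eq_single t, if_pos ht, trainWeight, if_pos ht.isTrainingSeq, ht.genProb,
      mul_one]
    · intro t' _ hne
      exact if_neg fun h' => hne (ht.eq h')
    · simp
  · have h0 : ∀ t : Fin n, ¬ IsConfig t q o z := fun t ht => h ⟨t, ht⟩
    simp only [h0, if_false, Finset.sum_const_zero, mul_zero]
    rw [trainWeight]
    split_ifs with hz
    -- Here the first trigger is not followed by `o`, so its transition has probability zero.
    · obtain ⟨t, ht⟩ := hz.exists_iff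
      have hto : z t.succ ≠ o := fun ho => h0 t ⟨ht, ho⟩
      have : ∏ i : Fin n, transProb V q o (z i.castSucc) (z i.succ) = 0 :=
        Finset.prod_eq_zero (Finset.mem_univ t)
          (by simp [transProb, (ht t.castSucc).2 (Or.inl rfl), hto])
      simp [genProb, this]
    · rfl

/-- The constraints at different positions are independent, so the set is a product: one choice at
the two triggers and on `I`, and `V - 1` choices elsewhere. Pinning to `o` is compatible with
avoiding `q` only if `o ≠ q`. -/
lemma card_filter_pinned (t : Fin n) (q o : Fin V) (I : Finset (Fin (n + 1)))
    (ht : t.castSucc ∉ I) (hl : Fin.last n ∉ I) (ho : I.Nonempty → o ≠ q) :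
    (Finset.univ.filter fun z : TokenSeq V n =>
        (∀ i, z i = q ↔ i = t.castSucc ∨ i = Fin.last n) ∧ ∀ i ∈ I, z i = o).card =
      (V - 1) ^ (n - 1 - I.card) := by
  have hset : (Finset.univ.filter fun z : TokenSeq V n =>
        (∀ i, z i = q ↔ i = t.castSucc ∨ i = Fin.last n) ∧ ∀ i ∈ I, z i = o) =
      Fintype.piFinset fun i => if i = t.castSucc ∨ i = Fin.last n then {q} else
        if i ∈ I then {o} else Finset.univ.erase q := by
    ext z
    simp only [Finset.mem_filter, Finset.mem_univ, true_and, Fintype.mem_piFinset]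
    constructor
    · rintro ⟨h1, h2⟩ i
      split_ifs with h h'
      · simpa using (h1 i).2 h
      · simpa using h2 i h'
      · simpa using fun hz => h ((h1 i).1 hz)
    · intro h
      refine ⟨fun i => ?_, fun i hi => ?_⟩
      · have hi := h i
        split_ifs at hi with h1 h2
        · simpa [h1] using hi
        · have := ho ⟨i, h2⟩
          rw [Finset.mem_singleton] at hi
          simp [h1, hi, this]
        · simpa [h1] using hi
      · have hi' := h i
        rw [if_neg, if_pos hi] at hi'
        · simpa using hi'
        · rintro (rfl | rfl)
          exacts [ht hi, hl hi]
  have hcard (i : Fin (n + 1)) : (if i = t.castSucc ∨ i = Fin.last n then {q} else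
        if i ∈ I then {o} else Finset.univ.erase q : Finset (Fin V)).card =
      if i ∈ insert t.castSucc (insert (Fin.last n) I) then 1 else V - 1 := by
    simp only [Finset.mem_insert]
    split_ifs with h1 h2 h3 h4 h5 <;> simp_all
  rw [hset, Fintype.card_piFinset]
  simp only [hcard]
  rw [Finset.prod_ite]
  simp only [Finset.prod_const, one_pow, one_mul]
  congr 1
  rw [Finset.filter_not, Finset.filter_mem_eq_inter, Finset.univ_inter,
    Finset.card_sdiff_of_subset (Finset.subset_univ _), Finset.card_univ, Fintype.card_fin,
    Finset.card_insert_of_notMem, Finset.card_insert_of_notMem hl]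
  · omega
  · simp [ht, (Fin.castSucc_lt_last t).ne]

/-- Expectation over the training sequences with first trigger at the position `t`. -/
def condExpect (V n : ℕ) (t : Fin n) (f : Fin V → Fin V → TokenSeq V n → ℝ) : ℝ :=
  (∑ q, ∑ o, ∑ z, if IsConfig t q o z then f q o z else 0) /
    ((V : ℝ) * ((V : ℝ) - 1) ^ (n - 1))

/-- The output is read off from `z`, so the sum over `o` contributes a single term for each
admissible `z`. -/
lemma sum_isConfig_const (hV : 1 ≤ V) (t : Fin n) (c : ℝ) :
    (∑ q : Fin V, ∑ o : Fin V, ∑ z : TokenSeq V n, if IsConfig t q o z then c else 0) =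
      (V : ℝ) * ((V : ℝ) - 1) ^ (n - 1) * c := by
  have hq (q : Fin V) : (∑ o : Fin V, ∑ z : TokenSeq V n, if IsConfig t q o z then c else 0) =
      ((V : ℝ) - 1) ^ (n - 1) * c := by
    rw [Finset.sum_comm]
    have hz (z : TokenSeq V n) : (∑ o : Fin V, if IsConfig t q o z then c else 0) =
        if (∀ i, z i = q ↔ i = t.castSucc ∨ i = Fin.last n) ∧
          ∀ i ∈ (∅ : Finset (Fin (n + 1))), z i = q then c else 0 := by
      by_cases h : ∀ i, z i = q ↔ i = t.castSucc ∨ i = Fin.last n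
      · simp [IsConfig, h]
      · simp [IsConfig, h]
    simp only [hz]
    rw [← Finset.sum_filter, Finset.sum_const,
      card_filter_pinned t q q ∅ (by simp) (by simp) (by simp)]
    simp [Nat.cast_sub hV]
  simp only [hq, Finset.sum_const, Finset.card_univ, Fintype.card_fin, nsmul_eq_mul]
  ring

section
variable (hV : 2 ≤ V)
include hV

lemma configCount_pos : 0 < (V : ℝ) * ((V : ℝ) - 1) ^ (n - 1) := by
  have : (2 : ℝ) ≤ V := by exact_mod_cast hV
  have h1 : (0 : ℝ) < V - 1 := by linarith
  positivity

lemma condExpect_const (t : Fin n) (c : ℝ) : condExpect V n t (fun _ _ _ => c) = c := by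
  rw [condExpect, sum_isConfig_const (by omega), mul_div_assoc]
  exact mul_div_cancel₀ c (configCount_pos hV).ne'

lemma condExpect_mono {t : Fin n} {f g : Fin V → Fin V → TokenSeq V n → ℝ}
    (h : ∀ q o z, IsConfig t q o z → f q o z ≤ g q o z) :
    condExpect V n t f ≤ condExpect V n t g := by
  unfold condExpect
  refine div_le_div_of_nonneg_right ?_ (configCount_pos hV).le
  refine Finset.sum_le_sum fun q _ => Finset.sum_le_sum fun o _ => Finset.sum_le_sum fun z _ => ?_
  split_ifs with hz
  exacts [h q o z hz, le_rfl]

lemma abs_condExpect_le {t : Fin n} {f g : Fin V → Fin V → TokenSeq V n → ℝ}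
    (h : ∀ q o z, IsConfig t q o z → |f q o z| ≤ g q o z) :
    |condExpect V n t f| ≤ condExpect V n t g := by
  refine abs_le.2 ⟨?_, condExpect_mono hV fun q o z hz => (abs_le.1 (h q o z hz)).2⟩
  have hneg : -condExpect V n t g = condExpect V n t fun q o z => -g q o z := by
    rw [condExpect, condExpect, ← neg_div]
    congr 1
    simp only [← Finset.sum_neg_distrib]
    refine Finset.sum_congr rfl fun q _ => Finset.sum_congr rfl fun o _ =>
      Finset.sum_congr rfl fun z _ => ?_
    split_ifs <;> simp
  rw [hneg]
  exact condExpect_mono hV fun q o z hz => (abs_le.1 (h q o z hz)).1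

lemma condExpect_eq_of_forall {t : Fin n} {f : Fin V → Fin V → TokenSeq V n → ℝ} {c : ℝ}
    (h : ∀ q o z, IsConfig t q o z → f q o z = c) : condExpect V n t f = c := by
  rw [← condExpect_const hV t c]
  exact le_antisymm (condExpect_mono hV fun q o z hz => (h q o z hz).le)
    (condExpect_mono hV fun q o z hz => (h q o z hz).ge)

/-- Configurations are equally likely and equally numerous for every `t`, so the conditioned law is
a uniform mixture over the first trigger position. -/
lemma expect_eq_average (hn : 1 ≤ n) (f : Fin V → Fin V → TokenSeq V n → ℝ) :
    expect V n f = 1 / n * ∑ t, condExpect V n t f := by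
  have hV' : (0 : ℝ) < V := by
    have : 0 < V := by omega
    exact_mod_cast this
  have hN := configCount_pos (n := n) hV
  have hn' : (0 : ℝ) < n := by exact_mod_cast hn
  set w : ℝ := (1 / (V : ℝ)) ^ 3 * (1 / (V : ℝ)) ^ (n - 1) with hw
  have hwpos : 0 < w := by positivity
  have key (g : Fin V → Fin V → TokenSeq V n → ℝ) :
      ∑ q, ∑ o, ∑ z, trainWeight V n q o z * g q o z =
        w * ∑ t : Fin n, ∑ q, ∑ o, ∑ z, if IsConfig t q o z then g q o z else 0 := by
    simp only [trainWeight_eq_sum, ← hw, mul_assoc, ← Finset.mul_sum]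
    congr 1
    symm
    rw [Finset.sum_comm]
    refine Finset.sum_congr rfl fun q _ => ?_
    rw [Finset.sum_comm]
    refine Finset.sum_congr rfl fun o _ => ?_
    rw [Finset.sum_comm]
    refine Finset.sum_congr rfl fun z _ => ?_
    rw [Finset.sum_mul]
    refine Finset.sum_congr rfl fun t _ => ?_
    split_ifs <;> simp
  have h1 := key fun _ _ _ => 1
  simp only [mul_one, sum_isConfig_const (by omega : 1 ≤ V), Finset.sum_const, Finset.card_univ,
    Fintype.card_fin, nsmul_eq_mul] at h1
  rw [expect, key f, h1]
  simp only [condExpect, ← Finset.sum_div]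
  field_simp

end

lemma condExpect_add (t : Fin n) (f g : Fin V → Fin V → TokenSeq V n → ℝ) :
    condExpect V n t (fun q o z => f q o z + g q o z) =
      condExpect V n t f + condExpect V n t g := by
  rw [condExpect, condExpect, condExpect, ← add_div]
  congr 1
  simp only [← Finset.sum_add_distrib]
  refine Finset.sum_congr rfl fun q _ => Finset.sum_congr rfl fun o _ =>
    Finset.sum_congr rfl fun z _ => ?_
  split_ifs <;> simp

lemma condExpect_const_mul (t : Fin n) (c : ℝ) (f : Fin V → Fin V → TokenSeq V n → ℝ) :
    condExpect V n t (fun q o z => c * f q o z) = c * condExpect V n t f := by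
  rw [condExpect, condExpect, ← mul_div_assoc]
  simp only [Finset.mul_sum, mul_ite, mul_zero]

lemma condExpect_sum {ι : Type*} (S : Finset ι) (t : Fin n)
    (f : ι → Fin V → Fin V → TokenSeq V n → ℝ) :
    condExpect V n t (fun q o z => ∑ i ∈ S, f i q o z) = ∑ i ∈ S, condExpect V n t (f i) := by
  classical
  induction S using Finset.induction_on with
  | empty => simp [condExpect]
  | insert i S hi ih =>
    simp only [Finset.sum_insert hi]
    rw [condExpect_add, ih]

/-- The indicator of `z_s = o`. -/
def hit (o : Fin V) (z : TokenSeq V n) (s : Fin (n + 1)) : ℝ := if z s = o then 1 else 0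

/-- Probability that the token at the position `s` equals the output token, when the first trigger
is at the position `t`. -/
def hitProb (V : ℕ) (t : Fin n) (s : Fin (n + 1)) : ℝ :=
  if t.succ = Fin.last n then (if s = t.castSucc ∨ s = Fin.last n then 1 else 0)
  else if s = t.succ then 1
  else if s = t.castSucc ∨ s = Fin.last n then 0 else 1 / ((V : ℝ) - 1)

lemma IsConfig.output_ne {t : Fin n} {q o : Fin V} {z : TokenSeq V n} (h : IsConfig t q o z)
    (ht : t.succ ≠ Fin.last n) : o ≠ q := by
  rw [← h.2]
  intro hz
  rcases (h.1 _).1 hz with h' | h'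
  · exact absurd h' (Fin.castSucc_lt_succ).ne'
  · exact ht h'

lemma IsConfig.output_eq {t : Fin n} {q o : Fin V} {z : TokenSeq V n} (h : IsConfig t q o z)
    (ht : t.succ = Fin.last n) : o = q := by
  rw [← h.2]
  exact (h.1 _).2 (Or.inr ht)

lemma condExpect_hit (hV : 2 ≤ V) (t : Fin n) (s : Fin (n + 1)) :
    condExpect V n t (fun _ o z => hit o z s) = hitProb V t s := by
  unfold hitProb
  split_ifs with h1 h2 h3 h4
  · refine condExpect_eq_of_forall hV fun q o z hz => ?_
    rw [hit, if_pos (by rw [hz.output_eq h1]; exact (hz.1 s).2 h2)]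
  · refine condExpect_eq_of_forall hV fun q o z hz => ?_
    rw [hit, if_neg (by rw [hz.output_eq h1, hz.1 s]; exact h2)]
  · refine condExpect_eq_of_forall hV fun q o z hz => ?_
    rw [hit, if_pos (by rw [h3]; exact hz.2)]
  · refine condExpect_eq_of_forall hV fun q o z hz => ?_
    rw [hit, if_neg (by rw [(hz.1 s).2 h4]; exact (hz.output_ne h1).symm)]
  -- The generic position: both `t + 1` and `s` are pinned to `o`, and `o` ranges over the `V - 1`
  -- tokens other than `q`.
  · push Not at h4
    have hV' : (1 : ℝ) < V := by
      have : 1 < V := by omega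
      exact_mod_cast this
    have hI : ({t.succ, s} : Finset (Fin (n + 1))).card = 2 := Finset.card_pair (Ne.symm h3)
    have htI : t.castSucc ∉ ({t.succ, s} : Finset (Fin (n + 1))) := by
      simp [(Fin.castSucc_lt_succ (i := t)).ne, Ne.symm h4.1]
    have hlI : Fin.last n ∉ ({t.succ, s} : Finset (Fin (n + 1))) := by
      simp [Ne.symm h1, Ne.symm h4.2]
    -- The positions `t`, `t + 1`, `s` and the last one are distinct, so the exponent `n - 3` is not
    -- truncated.
    have hn : 3 ≤ n := by
      have hc := Finset.card_le_univ
        (insert t.castSucc (insert (Fin.last n) ({t.succ, s} : Finset (Fin (n + 1)))))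
      rw [Finset.card_insert_of_notMem, Finset.card_insert_of_notMem hlI, hI,
        Fintype.card_fin] at hc
      · omega
      · simp only [Finset.mem_insert, not_or]
        exact ⟨(Fin.castSucc_lt_last t).ne, by simpa using htI⟩
    have hqo (q o : Fin V) : (∑ z : TokenSeq V n, if IsConfig t q o z then hit o z s else 0) =
        if o = q then 0 else ((V : ℝ) - 1) ^ (n - 3) := by
      split_ifs with ho
      · refine Finset.sum_eq_zero fun z _ => if_neg fun hz => hz.output_ne h1 ho
      · have hz (z : TokenSeq V n) : (if IsConfig t q o z then hit o z s else 0) =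
            if (∀ i, z i = q ↔ i = t.castSucc ∨ i = Fin.last n) ∧
              ∀ i ∈ ({t.succ, s} : Finset (Fin (n + 1))), z i = o then (1 : ℝ) else 0 := by
          rw [hit, ← ite_and]
          refine if_congr ?_ rfl rfl
          simp [IsConfig, and_assoc]
        simp only [hz]
        rw [← Finset.sum_filter, Finset.sum_const,
          card_filter_pinned t q o _ htI hlI fun _ => ho, hI]
        simp [Nat.cast_sub (by omega : 1 ≤ V), Nat.sub_sub]
    have hq (q : Fin V) : ∑ o : Fin V, (if o = q then 0 else ((V : ℝ) - 1) ^ (n - 3)) =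
        ((V : ℝ) - 1) * ((V : ℝ) - 1) ^ (n - 3) := by
      rw [← Finset.add_sum_erase _ _ (Finset.mem_univ q), if_pos rfl, zero_add,
        Finset.sum_congr rfl (g := fun _ => ((V : ℝ) - 1) ^ (n - 3))
          fun o ho => if_neg (Finset.mem_erase.1 ho).1]
      simp [Nat.cast_sub (by omega : 1 ≤ V)]
    rw [condExpect]
    simp only [hqo, hq]
    obtain ⟨m, rfl⟩ : ∃ m, n = m + 3 := ⟨n - 3, by omega⟩
    have h0 : (V : ℝ) - 1 ≠ 0 := by linarith
    have h0' : (V : ℝ) ≠ 0 := by linarith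
    simp only [Finset.sum_const, Finset.card_univ, Fintype.card_fin, nsmul_eq_mul,
      show m + 3 - 3 = m by omega, show m + 3 - 1 = m + 2 by omega]
    field_simp
    ring

lemma probFirstTrigger_eq (hV : 2 ≤ V) (hn : 1 ≤ n) (s : ℕ) :
    probFirstTrigger V n s = if 1 ≤ s ∧ s ≤ n then 1 / (n : ℝ) else 0 := by
  classical
  have hn' : (n : ℝ) ≠ 0 := by positivity
  have ht (t : Fin n) : condExpect V n t (fun q _ z =>
      if ∃ t : Fin (n + 1), (t : ℕ) + 1 = s ∧ z t = q ∧ ∀ t' < t, z t' ≠ q then (1 : ℝ) else 0) =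
      if (t : ℕ) + 1 = s then 1 else 0 := by
    refine condExpect_eq_of_forall hV fun q o z hz => if_congr ⟨?_, ?_⟩ rfl rfl
    · rintro ⟨i, rfl, hi, hlt⟩
      rcases (hz.1 i).1 hi with rfl | rfl
      · rfl
      · exact absurd ((hz.1 t.castSucc).2 (Or.inl rfl)) (hlt _ (Fin.castSucc_lt_last t))
    · rintro rfl
      refine ⟨t.castSucc, rfl, (hz.1 _).2 (Or.inl rfl), fun i hi hzi => ?_⟩
      rcases (hz.1 i).1 hzi with rfl | rfl
      · exact absurd hi (lt_irrefl _)
      · exact absurd (Fin.castSucc_lt_last t) hi.asymm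
  rw [probFirstTrigger, expect_eq_average hV hn]
  rw [Finset.sum_congr rfl fun t _ => (by convert ht t)]
  split_ifs with h
  · rw [Finset.sum_eq_single (⟨s - 1, by omega⟩ : Fin n)]
    · rw [if_pos (show s - 1 + 1 = s by omega), mul_one]
    · intro t _ hne
      refine if_neg fun h' => hne (Fin.ext ?_)
      simp only
      omega
    · simp
  · rw [Finset.sum_eq_zero, mul_zero]
    intro t _
    refine if_neg fun h' => h ?_
    omega

/-! ### The learned scores as expectations over the training sequences -/

lemma expect_const_mul (c : ℝ) (f : Fin V → Fin V → TokenSeq V n → ℝ) :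
    expect V n (fun q o z => c * f q o z) = c * expect V n f := by
  rw [expect, expect, ← mul_div_assoc]
  simp only [Finset.mul_sum, mul_left_comm]

lemma sum_unitTable_apply_out (k : Fin V) (a : Feature V n) :
    (∑ v : Fin V, unitTable (.out v : Feature V n) (.val v)) (.out k) a =
      if a = .val k then 1 else 0 := by
  simp [Finset.sum_apply, unitTable_apply, ite_and]

/-- In the full architecture the values also contain the attention output, but on the features
`prevVal`, which the averaged direction does not read. Hence both architectures give the same
number. -/
lemma alphaOf_eq_expect (hV : 2 ≤ V) (A : Arch) (η : ℝ) :
    alphaOf A V n η = -η / V * expect V n fun _ y z =>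
      1 / (V : ℝ) - ∑ s, 1 / ((n : ℝ) + 1) * hit y z s := by
  have hV0 : (V : ℝ) ≠ 0 := by positivity
  have hstream (z : TokenSeq V n) (s : Fin (n + 1)) (k : Fin V) :
      streamCoeff A .val .prevVal 0 z s (.val k) = hit k z s := by
    cases A <;> simp [streamCoeff, hit, Pi.single_apply, attnCoeff_eq_zero, eq_comm]
  rw [alphaOf, coeffWO2, sum_stepCoeff A η _ _ _ _ _ (hasDerivAt_stepWO2 A _), ← mul_assoc,
    show 1 / (V : ℝ) * -η = -η / V by ring]
  congr 2
  funext q y z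
  simp only [sum_unitTable_apply_out, ite_mul, one_mul, zero_mul, Finset.sum_ite_eq',
    Finset.mem_univ, if_true, hstream]
  congr 1
  rw [← Finset.mul_sum, Finset.sum_comm]
  simp only [hit, ← Finset.mul_sum, Finset.sum_ite_eq, Finset.mem_univ, if_true, Finset.sum_const,
    Finset.card_univ, Fintype.card_fin, nsmul_eq_mul]
  push_cast
  field_simp

lemma eq_centered_of_sum_eq_zero (hV : 2 ≤ V) {f : Fin V → ℝ} {α : ℝ} (v : Fin V) (hv : f v = α)
    (ho : ∀ j j', j ≠ v → j' ≠ v → f j = f j') (hs : ∑ j, f j = 0) (j : Fin V) :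
    f j = α * V / (V - 1) * ((if j = v then 1 else 0) - 1 / V) := by
  have hV1 : (0 : ℝ) < V - 1 := by
    have : (2 : ℝ) ≤ V := by exact_mod_cast hV
    linarith
  have hV0 : (V : ℝ) ≠ 0 := by positivity
  split_ifs with h
  · subst h; rw [hv]; field_simp
  · rw [← Finset.add_sum_erase _ _ (Finset.mem_univ v), hv,
      Finset.sum_congr rfl fun j' hj' => ho j' j (Finset.mem_erase.1 hj').1 h] at hs
    simp only [Finset.sum_const, Finset.card_erase_of_mem (Finset.mem_univ v), Finset.card_univ,
      Fintype.card_fin, nsmul_eq_mul, Nat.cast_sub (show 1 ≤ V by omega), Nat.cast_one] at hs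
    field_simp
    linarith

/-- Transpositions fixing `v` make the column constant off the diagonal. Its sum vanishes because
adding the same amount to all logits leaves the loss unchanged. -/
lemma coeffWO2_streams (hV : 2 ≤ V) (η : ℝ) (k v : Fin V) :
    coeffWO2 .streams η (idTable : Table V n) (.out k) (.val v) =
      alphaOf .streams V n η * V / (V - 1) * ((if k = v then 1 else 0) - 1 / V) := by
  have hV0 : (V : ℝ) ≠ 0 := by positivity
  refine eq_centered_of_sum_eq_zero hV v (coeffWO2_diag .streams η v)
    (f := fun k => coeffWO2 .streams η (idTable : Table V n) (.out k) (.val v))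
    (fun j j' hj hj' => ?_) ?_ k
  · have h := congrFun (congrFun (permuteTable_coeffWO2 (n := n) .streams η (Equiv.swap j j'))
      (.out j')) (.val v)
    simpa [permuteTable, permute, permuteFun, Equiv.swap_apply_of_ne_of_ne hj.symm hj'.symm]
      using h
  · rw [coeffWO2, sum_stepCoeff .streams η _ _ _ (fun _ => .val v) _
      (hasDerivAt_stepWO2 .streams _)]
    have hD (k : Fin V) (a : Feature V n) :
        (∑ j : Fin V, unitTable (.out j : Feature V n) (.val v)) (.out k) a =
          if a = .val v then 1 else 0 := by
      simp [Finset.sum_apply, unitTable_apply, ite_and]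
    simp only [hD, Finset.sum_const, Finset.card_univ, Fintype.card_fin, nsmul_eq_mul]
    simp [hV0, expect]

/-- The fraction of trigger tokens among the positions up to `s`. -/
def triggerFrac (z : TokenSeq V n) (s : Fin (n + 1)) : ℝ :=
  ∑ s' ∈ Finset.Iic s, 1 / ((s : ℝ) + 1) * if z s' = z (Fin.last n) then 1 else 0

/-- The centered logit of a token under the weights `π` of the positions. -/
def centeredLogit (a : ℝ) (π : Fin (n + 1) → ℝ) (z : TokenSeq V n) (k : Fin V) : ℝ :=
  ∑ s, π s * (a * ((if k = z s then 1 else 0) - 1 / V))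

/-- The probabilities sum to one, so the centering constant `1/V` cancels; `w` may be signed. -/
lemma sum_tokenProb_mul_centeredLogit (a : ℝ) (l : Fin V → ℝ) (w : Fin (n + 1) → ℝ)
    (z : TokenSeq V n) (y : Fin V) :
    ∑ k, tokenProb l k * centeredLogit a w z k - centeredLogit a w z y =
      -a * ∑ s, w s * (hit y z s - tokenProb l (z s)) := by
  have : NeZero V := ⟨by have := y.pos; omega⟩
  have h1 : ∑ k, tokenProb l k * centeredLogit a w z k =
      ∑ s, w s * (a * (tokenProb l (z s) - 1 / V)) := by
    simp only [centeredLogit, Finset.mul_sum]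
    rw [Finset.sum_comm]
    refine Finset.sum_congr rfl fun s _ => ?_
    calc ∑ k, tokenProb l k * (w s * (a * ((if k = z s then 1 else 0) - 1 / V)))
        = w s * (a * (∑ k, (tokenProb l k * if k = z s then 1 else 0) -
            (∑ k, tokenProb l k) * (1 / V))) := by
          rw [Finset.sum_mul, ← Finset.sum_sub_distrib, Finset.mul_sum, Finset.mul_sum]
          exact Finset.sum_congr rfl fun k _ => by ring
      _ = _ := by simp [sum_tokenProb]
  rw [h1, centeredLogit, ← Finset.sum_sub_distrib, Finset.mul_sum]
  refine Finset.sum_congr rfl fun s _ => ?_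
  have : (if y = z s then (1 : ℝ) else 0) = hit y z s := if_congr eq_comm rfl rfl
  rw [this]
  ring

lemma tableLoss_stepWK2_eq (hV : 2 ≤ V) (η : ℝ) (D : Table V n) :
    let a := alphaOf .streams V n η * V / (V - 1)
    HasDerivAt (fun x : ℝ => tableLoss .streams
        ((idTable, 0, 0, conjTable idTable (coeffWO2 .streams η idTable)) + x • inWK2 D))
      (-a * expect V n fun _ y z =>
        let u' := fun s : Fin (n + 1) => ∑ s' ∈ Finset.Iic s, 1 / ((s : ℝ) + 1) *
          D (.tok (z (Fin.last n))) (.prevTok (z s'))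
        ∑ s, 1 / ((n : ℝ) + 1) * (u' s - ∑ s', 1 / ((n : ℝ) + 1) * u' s') *
          (hit y z s - tokenProb (centeredLogit a (fun _ => 1 / ((n : ℝ) + 1)) z) (z s))) 0 := by
  intro a
  refine (hasDerivAt_stepWK2 _ D).congr_deriv ?_
  rw [← expect_const_mul]
  congr 1
  funext q y z
  simp only [conjTable_idTable, coeffWO2_streams hV]
  exact sum_tokenProb_mul_centeredLogit a _ _ z y

/-- As for `W_O²`, now by rows: the row sum vanishes because a constant row shifts all attention
scores equally, which softmax ignores. -/
lemma coeffWK2_streams (hV : 2 ≤ V) (η : ℝ) (k v : Fin V) :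
    coeffWK2 .streams η (idTable : Table V n) (.tok k) (.prevTok v) =
      alphaOf' .streams V n η * V / (V - 1) * ((if v = k then 1 else 0) - 1 / V) := by
  refine eq_centered_of_sum_eq_zero hV k (coeffWK2_diag .streams η k)
    (f := fun v => coeffWK2 .streams η (idTable : Table V n) (.tok k) (.prevTok v))
    (fun j j' hj hj' => ?_) ?_ v
  · have h := congrFun (congrFun (permuteTable_coeffWK2 (n := n) .streams η (Equiv.swap j j'))
      (.tok k)) (.prevTok j')
    simpa [permuteTable, permute, permuteFun, Equiv.swap_apply_of_ne_of_ne hj.symm hj'.symm]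
      using h
  · rw [coeffWK2, sum_stepCoeff .streams η _ _ (fun _ => .tok k) _ _
      (tableLoss_stepWK2_eq hV η _)]
    have hD (j v : Fin V) :
        (∑ v : Fin V, unitTable (.tok k : Feature V n) (.prevTok v)) (.tok j) (.prevTok v) =
          if j = k then 1 else 0 := by
      simp [Finset.sum_apply, unitTable_apply, ite_and]
    have h1 (s : Fin (n + 1)) (c : ℝ) : ∑ s' ∈ Finset.Iic s, 1 / ((s : ℝ) + 1) * c = c := by
      simp only [Finset.sum_const, Fin.card_Iic, nsmul_eq_mul]
      push_cast
      field_simp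
    have h2 (c : ℝ) : ∑ _s' : Fin (n + 1), 1 / ((n : ℝ) + 1) * c = c := by
      simp only [Finset.sum_const, Finset.card_univ, Fintype.card_fin, nsmul_eq_mul]
      push_cast
      field_simp
    simp only [hD, h1, h2]
    simp [expect]

lemma alphaOf'_eq_expect (hV : 2 ≤ V) (η : ℝ) :
    let a := alphaOf .streams V n η * V / (V - 1)
    alphaOf' .streams V n η = η / V * a * expect V n fun _ y z =>
      ∑ s, 1 / ((n : ℝ) + 1) * (triggerFrac z s - ∑ s', 1 / ((n : ℝ) + 1) * triggerFrac z s') *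
        (hit y z s - tokenProb (centeredLogit a (fun _ => 1 / ((n : ℝ) + 1)) z) (z s)) := by
  intro a
  have hD (j v : Fin V) :
      (∑ v : Fin V, unitTable (.tok v : Feature V n) (.prevTok v)) (.tok j) (.prevTok v) =
        if v = j then 1 else 0 := by
    simp [Finset.sum_apply, unitTable_apply, ite_and]
  rw [alphaOf', coeffWK2, sum_stepCoeff .streams η _ _ _ _ _ (tableLoss_stepWK2_eq hV η _)]
  simp only [hD, triggerFrac]
  ring

/-- The indicator of `s'` being the position before `s`. -/
def isPrev (s s' : Fin (n + 1)) : ℝ := if (s : ℕ) - s' = 1 then 1 else 0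

/-- The derivative of the fraction of trigger tokens seen at `s`, when the first attention moves to
the previous position. -/
def triggerDrift (z : TokenSeq V n) (s : Fin (n + 1)) : ℝ :=
  ∑ s' ∈ Finset.Iic s, 1 / ((s : ℝ) + 1) *
    (isPrev s s' - ∑ s'' ∈ Finset.Iic s, 1 / ((s : ℝ) + 1) * isPrev s s'') *
    if z s' = z (Fin.last n) then 1 else 0

/-- The second-layer attention from the last position when `W_K²` is trained. -/
def trainedAttn (V : ℕ) (a' : ℝ) (z : TokenSeq V n) (s : Fin (n + 1)) : ℝ :=
  causalSoftmax (fun s => a' * (triggerFrac z s - 1 / V)) (Fin.last n) s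

/-- Centering `W_K²` shifts all second-layer scores equally, and it drops out of their derivative
because the derivatives of the first-layer softmax weights sum to zero. -/
lemma betaOf_eq_expect (hV : 2 ≤ V) (η : ℝ) (i : Fin (n + 1)) (hi : (i : ℕ) = 1) :
    let a := alphaOf .streams V n η * V / (V - 1)
    let a' := alphaOf' .streams V n η * V / (V - 1)
    betaOf .streams V n η i = η / V * a * a' * expect V n fun _ y z =>
      ∑ s, trainedAttn V a' z s * (triggerDrift z s - ∑ s', trainedAttn V a' z s' *
          triggerDrift z s') *
        (hit y z s - tokenProb (centeredLogit a (trainedAttn V a' z) z) (z s)) := by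
  intro a a'
  have hD (z : TokenSeq V n) (s s' : Fin (n + 1)) :
      tableScore1 (∑ v : Fin V, unitTable (.tok v : Feature V n) (.rel i)) z s s' =
        isPrev s s' := by
    have h : (⟨(s : ℕ) - s', by omega⟩ : Fin (n + 1)) = i ↔ (s : ℕ) - s' = 1 := by
      rw [Fin.ext_iff, hi]
    simp only [tableScore1, Finset.sum_apply, unitTable_apply, ite_and, isPrev]
    simp [h]
  have hone (s : Fin (n + 1)) : ∑ s' ∈ Finset.Iic s, 1 / ((s : ℝ) + 1) = 1 := by
    simp only [Finset.sum_const, Fin.card_Iic, nsmul_eq_mul]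
    push_cast
    field_simp
  have hattn (z : TokenSeq V n) (s : Fin (n + 1)) :
      ∑ s' ∈ Finset.Iic s, 1 / ((s : ℝ) + 1) *
        (a' * ((if z s' = z (Fin.last n) then 1 else 0) - 1 / (V : ℝ))) =
      a' * (triggerFrac z s - 1 / V) := by
    calc _ = a' * (∑ s' ∈ Finset.Iic s, (1 / ((s : ℝ) + 1) *
            if z s' = z (Fin.last n) then 1 else 0) -
          (∑ s' ∈ Finset.Iic s, 1 / ((s : ℝ) + 1)) * (1 / V)) := by
          rw [Finset.sum_mul, ← Finset.sum_sub_distrib, Finset.mul_sum]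
          exact Finset.sum_congr rfl fun s' _ => by ring
      _ = _ := by rw [hone, one_mul, triggerFrac]
  have hdrift (z : TokenSeq V n) (s : Fin (n + 1)) :
      ∑ s' ∈ Finset.Iic s, 1 / ((s : ℝ) + 1) *
        (isPrev s s' - ∑ s'' ∈ Finset.Iic s, 1 / ((s : ℝ) + 1) * isPrev s s'') *
        (a' * ((if z s' = z (Fin.last n) then 1 else 0) - 1 / (V : ℝ))) =
      a' * triggerDrift z s := by
    have h0 : ∑ s' ∈ Finset.Iic s, 1 / ((s : ℝ) + 1) *
        (isPrev s s' - ∑ s'' ∈ Finset.Iic s, 1 / ((s : ℝ) + 1) * isPrev s s'') = 0 := by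
      simp only [mul_sub, Finset.sum_sub_distrib, ← Finset.sum_mul, hone, one_mul, sub_self]
    calc _ = a' * (triggerDrift z s - (∑ s' ∈ Finset.Iic s, 1 / ((s : ℝ) + 1) *
          (isPrev s s' - ∑ s'' ∈ Finset.Iic s, 1 / ((s : ℝ) + 1) * isPrev s s'')) * (1 / V)) := by
          rw [Finset.sum_mul, triggerDrift, ← Finset.sum_sub_distrib, Finset.mul_sum]
          exact Finset.sum_congr rfl fun s' _ => by ring
      _ = _ := by rw [h0, zero_mul, sub_zero]
  rw [betaOf, coeffWK1, sum_stepCoeff .streams η _ _ _ (fun _ => .rel i) _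
    (hasDerivAt_stepWK1 _ _ _)]
  have key (E F : ℝ) (h : F = -(a * a') * E) : 1 / V * (-η * F) = η / V * a * a' * E := by
    rw [h]; ring
  refine key _ _ ?_
  · rw [← expect_const_mul]
    congr 1
    funext q y z
    simp only [conjTable_idTable, coeffWO2_streams hV, coeffWK2_streams hV, hD]
    simp only [show alphaOf .streams V n η * V / (V - 1) = a from rfl,
      show alphaOf' .streams V n η * V / (V - 1) = a' from rfl, hattn, hdrift]
    refine (sum_tokenProb_mul_centeredLogit a _ _ z y).trans ?_
    rw [neg_mul, neg_mul, neg_inj, mul_assoc, Finset.mul_sum (a := a')]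
    congr 1
    refine Finset.sum_congr rfl fun s _ => ?_
    simp only [mul_left_comm _ a', ← Finset.mul_sum, ← mul_sub, mul_assoc]
    rfl

/-! ### Softmax of nearly constant scores -/

/-- The quantity compared with `1` is the reciprocal of the mean of `exp (u j - u i)`, hence lies
between `exp (-b)` and `exp b`. -/
lemma abs_card_mul_softmax_sub_one_le {ι : Type*} {S : Finset ι} {u : ι → ℝ} {b : ℝ} {i : ι}
    (hi : i ∈ S) (h : ∀ j ∈ S, |u j - u i| ≤ b) :
    |S.card * (Real.exp (u i) / ∑ j ∈ S, Real.exp (u j)) - 1| ≤ Real.exp b - 1 := by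
  have hsum : Real.exp (u i) / ∑ j ∈ S, Real.exp (u j) = (∑ j ∈ S, Real.exp (u j - u i))⁻¹ := by
    simp only [Real.exp_sub, ← Finset.sum_div, inv_div]
  have hc : (0 : ℝ) < S.card := by exact_mod_cast Finset.card_pos.2 ⟨i, hi⟩
  have hle : ∑ j ∈ S, Real.exp (u j - u i) ≤ S.card * Real.exp b := by
    rw [← nsmul_eq_mul]
    exact Finset.sum_le_card_nsmul _ _ _ fun j hj => Real.exp_le_exp.2 (abs_le.1 (h j hj)).2
  have hge : S.card * Real.exp (-b) ≤ ∑ j ∈ S, Real.exp (u j - u i) := by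
    rw [← nsmul_eq_mul]
    exact Finset.card_nsmul_le_sum _ _ _ fun j hj => Real.exp_le_exp.2 (abs_le.1 (h j hj)).1
  have hb := Real.exp_pos b
  have hnb := Real.exp_pos (-b)
  have hmul : Real.exp b * Real.exp (-b) = 1 := by rw [← Real.exp_add]; simp
  have hpos : 0 < ∑ j ∈ S, Real.exp (u j - u i) := lt_of_lt_of_le (by positivity) hge
  rw [hsum, ← div_eq_mul_inv, abs_le]
  constructor
  · have : Real.exp (-b) ≤ S.card / ∑ j ∈ S, Real.exp (u j - u i) := by
      rw [le_div_iff₀ hpos]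
      calc _ ≤ Real.exp (-b) * (S.card * Real.exp b) := by gcongr
        _ = (Real.exp b * Real.exp (-b)) * S.card := by ring
        _ = _ := by rw [hmul, one_mul]
    -- The lower side uses `1 - exp (-b) ≤ exp b - 1`, that is `x + 1/x ≥ 2`.
    nlinarith [sq_nonneg (Real.exp b - 1)]
  · have : S.card / ∑ j ∈ S, Real.exp (u j - u i) ≤ Real.exp b := by
      rw [div_le_iff₀ hpos]
      calc (S.card : ℝ) = (Real.exp b * Real.exp (-b)) * S.card := by rw [hmul, one_mul]
        _ = Real.exp b * (S.card * Real.exp (-b)) := by ring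
        _ ≤ _ := by gcongr
    linarith

lemma exp_sub_one_le_mul_exp (b : ℝ) : Real.exp b - 1 ≤ b * Real.exp b := by
  have h := Real.add_one_le_exp (-b)
  have hmul : Real.exp b * Real.exp (-b) = 1 := by rw [← Real.exp_add]; simp
  nlinarith [Real.exp_pos b]

lemma abs_tokenProb_sub_le (hV : 2 ≤ V) {l : Fin V → ℝ} {b : ℝ} (h : ∀ j k, |l j - l k| ≤ b)
    (k : Fin V) : |tokenProb l k - 1 / V| ≤ (Real.exp b - 1) / V := by
  have hV0 : (0 : ℝ) < V := by
    have : 0 < V := by omega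
    exact_mod_cast this
  have := abs_card_mul_softmax_sub_one_le (Finset.mem_univ k) fun j _ => h j k
  rw [Finset.card_univ, Fintype.card_fin] at this
  rw [le_div_iff₀ hV0, ← abs_of_pos hV0, ← abs_mul, abs_of_pos hV0]
  have e : (tokenProb l k - 1 / V) * V =
      V * (Real.exp (l k) / ∑ j, Real.exp (l j)) - 1 := by
    rw [tokenProb]; field_simp
  rwa [e]

lemma tokenProb_nonneg (l : Fin V → ℝ) (k : Fin V) : 0 ≤ tokenProb l k :=
  div_nonneg (Real.exp_pos _).le (Finset.sum_nonneg fun _ _ => (Real.exp_pos _).le)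

lemma tokenProb_le_one (l : Fin V → ℝ) (k : Fin V) : tokenProb l k ≤ 1 := by
  have : NeZero V := ⟨by have := k.pos; omega⟩
  rw [← sum_tokenProb l]
  exact Finset.single_le_sum (fun k _ => tokenProb_nonneg l k) (Finset.mem_univ k)

lemma hit_nonneg (o : Fin V) (z : TokenSeq V n) (s : Fin (n + 1)) : 0 ≤ hit o z s := by
  unfold hit; split_ifs <;> simp

lemma hit_le_one (o : Fin V) (z : TokenSeq V n) (s : Fin (n + 1)) : hit o z s ≤ 1 := by
  unfold hit; split_ifs <;> simp

lemma abs_hit_sub_tokenProb_le (o : Fin V) (z : TokenSeq V n) (s : Fin (n + 1)) (l : Fin V → ℝ)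
    (k : Fin V) : |hit o z s - tokenProb l k| ≤ 1 := by
  rw [abs_le]
  constructor <;>
    linarith [hit_nonneg o z s, hit_le_one o z s, tokenProb_nonneg l k, tokenProb_le_one l k]

lemma abs_centeredLogit_sub_le (a : ℝ) {π : Fin (n + 1) → ℝ} (hπ : ∀ s, 0 ≤ π s)
    (hπ1 : ∑ s, π s = 1) (z : TokenSeq V n) (j k : Fin V) :
    |centeredLogit a π z j - centeredLogit a π z k| ≤ |a| := by
  rw [centeredLogit, centeredLogit, ← Finset.sum_sub_distrib]
  refine (Finset.abs_sum_le_sum_abs _ _).trans ?_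
  calc _ ≤ ∑ s, π s * |a| := Finset.sum_le_sum fun s _ => ?_
    _ = |a| := by rw [← Finset.sum_mul, hπ1, one_mul]
  rw [← mul_sub, ← mul_sub, abs_mul, abs_mul, abs_of_nonneg (hπ s)]
  refine mul_le_mul_of_nonneg_left (mul_le_of_le_one_right (abs_nonneg a) ?_) (hπ s)
  rw [sub_sub_sub_cancel_right]
  split_ifs <;> norm_num

/-! ### The score of `W_O²` -/

/-- Off the case `t + 1 = T`, the probability is `1/(V-1)` except at three positions, so weighted
sums reduce to the total weight and three exceptional values. -/
lemma sum_hitProb_mul (V : ℕ) (t : Fin n) (w : Fin (n + 1) → ℝ) :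
    ∑ s, hitProb V t s * w s =
      if t.succ = Fin.last n then w t.castSucc + w (Fin.last n)
      else w t.succ + (∑ s, w s - w t.castSucc - w t.succ - w (Fin.last n)) / ((V : ℝ) - 1) := by
  have hne : t.castSucc ≠ Fin.last n := (Fin.castSucc_lt_last t).ne
  have hsum (a : Fin (n + 1)) : w a = ∑ s, if s = a then w s else 0 := by simp
  split_ifs with h
  · rw [hsum t.castSucc, hsum (Fin.last n), ← Finset.sum_add_distrib]
    refine Finset.sum_congr rfl fun s _ => ?_
    simp only [hitProb, h, if_true]
    by_cases h1 : s = t.castSucc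
    · subst h1; simp [hne]
    · simp [h1]
  · have hne' : t.castSucc ≠ t.succ := (Fin.castSucc_lt_succ).ne
    rw [hsum t.castSucc, hsum (Fin.last n), hsum t.succ, ← Finset.sum_sub_distrib,
      ← Finset.sum_sub_distrib, ← Finset.sum_sub_distrib, Finset.sum_div, ← Finset.sum_add_distrib]
    refine Finset.sum_congr rfl fun s _ => ?_
    simp only [hitProb, h, if_false]
    by_cases h1 : s = t.succ
    · subst h1; simp [hne'.symm, h]
    · by_cases h2 : s = t.castSucc
      · subst h2; simp [hne, hne']
      · by_cases h3 : s = Fin.last n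
        · subst h3; simp [hne.symm, Ne.symm h]
        · simp [h1, h2, h3]; ring

lemma sum_hitProb (V : ℕ) (t : Fin n) :
    ∑ s, hitProb V t s =
      if t.succ = Fin.last n then 2 else 1 + ((n : ℝ) - 2) / ((V : ℝ) - 1) := by
  have h := sum_hitProb_mul V t fun _ => 1
  simp only [mul_one, Finset.sum_const, Finset.card_univ, Fintype.card_fin, nsmul_eq_mul] at h
  rw [h]
  push_cast
  congr 1
  · norm_num
  · ring

lemma castSucc_succ_ne_last {m : ℕ} (t : Fin m) :
    (t.castSucc : Fin (m + 1)).succ ≠ Fin.last (m + 1) := by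
  rw [Ne, Fin.ext_iff]
  have := t.isLt
  simp
  omega

lemma alphaOf_eq (hV : 2 ≤ V) (hn : 1 ≤ n) (A : Arch) (η : ℝ) :
    alphaOf A V n η = η / (V * ((n : ℝ) + 1)) *
      (1 / n * ∑ t : Fin n, ∑ s, hitProb V t s - ((n : ℝ) + 1) / V) := by
  have hV0 : (V : ℝ) ≠ 0 := by positivity
  have hn0 : (n : ℝ) ≠ 0 := by positivity
  have hn1 : (n : ℝ) + 1 ≠ 0 := by positivity
  have ht (t : Fin n) : condExpect V n t (fun _ y z =>
      1 / (V : ℝ) - ∑ s, 1 / ((n : ℝ) + 1) * hit y z s) =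
        1 / V + -(1 / ((n : ℝ) + 1)) * ∑ s, hitProb V t s := by
    have := condExpect_add t (fun _ _ _ => 1 / (V : ℝ))
      (fun (_ y : Fin V) z => -(1 / ((n : ℝ) + 1)) * ∑ s, hit y z s)
    rw [condExpect_const hV, condExpect_const_mul,
      condExpect_sum Finset.univ t fun s _ y z => hit y z s] at this
    simp only [condExpect_hit hV] at this
    rw [← this]
    congr 1
    funext q y z
    rw [← Finset.mul_sum]
    ring
  rw [alphaOf_eq_expect hV, expect_eq_average hV hn, Finset.sum_congr rfl fun t _ => ht t]
  simp only [Finset.sum_add_distrib, ← Finset.mul_sum, Finset.sum_const, Finset.card_univ,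
    Fintype.card_fin, nsmul_eq_mul]
  field_simp
  ring

/-- The last `t` contributes `2`, as both triggers show `o = q`; the `m` others contribute `1 +
(m-1)/(V-1)` each. -/
lemma average_sum_hitProb (V m : ℕ) :
    1 / ((m + 1 : ℕ) : ℝ) * ∑ t : Fin (m + 1), ∑ s, hitProb V t s =
      1 + (1 + m * ((m : ℝ) - 1) / ((V : ℝ) - 1)) / ((m : ℝ) + 1) := by
  have hm : (m : ℝ) + 1 ≠ 0 := by positivity
  simp only [sum_hitProb]
  rw [Fin.sum_univ_castSucc]
  simp only [castSucc_succ_ne_last, if_false, Fin.succ_last, if_true, Finset.sum_const,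
    Finset.card_univ, Fintype.card_fin, nsmul_eq_mul]
  push_cast
  field_simp
  ring

/-- Chance occurrences of `o` number `Q/(V-1)` on average, where `T - 4 ≤ Q ≤ T`, so they nearly
cancel against the term `T/V`. -/
lemma average_sum_hitProb_bounds (hV : 2 ≤ V) (hn : 1 ≤ n) :
    -4 / (V : ℝ) ≤ 1 / n * ∑ t : Fin n, ∑ s, hitProb V t s - ((n : ℝ) + 1) / V - 1 ∧
    1 / n * ∑ t : Fin n, ∑ s, hitProb V t s - ((n : ℝ) + 1) / V - 1 ≤
      2 * (1 / ((n : ℝ) + 1)) + 2 * (((n : ℝ) + 1) / V ^ 2) := by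
  obtain ⟨m, rfl⟩ : ∃ m, n = m + 1 := ⟨n - 1, by omega⟩
  rw [average_sum_hitProb]
  have hV2 : (2 : ℝ) ≤ V := by exact_mod_cast hV
  have hm : (0 : ℝ) ≤ m := by positivity
  have hV1 : (0 : ℝ) < V - 1 := by linarith
  have hV0 : (0 : ℝ) < V := by linarith
  push_cast
  have hq1 : (m : ℝ) - 2 ≤ m * (m - 1) / (m + 1) := by
    rw [le_div_iff₀ (by positivity)]; nlinarith
  have hq2 : m * ((m : ℝ) - 1) / (m + 1) ≤ m + 2 := by
    rw [div_le_iff₀ (by positivity)]; nlinarith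
  have hq0 : 0 ≤ m * ((m : ℝ) - 1) / (m + 1) := by
    refine div_nonneg ?_ (by positivity)
    rcases Nat.eq_zero_or_pos m with rfl | h
    · simp
    · have : (1 : ℝ) ≤ m := by exact_mod_cast h
      exact mul_nonneg hm (by linarith)
  have heq : (1 + m * ((m : ℝ) - 1) / (V - 1)) / (m + 1) =
      1 / (m + 1) + m * ((m : ℝ) - 1) / (m + 1) / (V - 1) := by
    field_simp
  rw [heq]
  set Q := m * ((m : ℝ) - 1) / (m + 1)
  have hQV : Q / V ≤ Q / (V - 1) := by
    gcongr
    linarith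
  have h1 : 0 ≤ 1 / ((m : ℝ) + 1) := by positivity
  constructor
  · have h2 : ((m : ℝ) - 2) / V ≤ Q / V := by gcongr
    have h3 : ((m : ℝ) - 2) / V - (m + 1 + 1) / V = -4 / V := by ring
    linarith
  · have h2 : Q / (V - 1) ≤ (m + 2) / (V - 1) := by gcongr
    have h3 : ((m : ℝ) + 2) / (V - 1) - (m + 1 + 1) / V = (m + 2) * (1 / (V * (V - 1))) := by
      field_simp
      ring
    have h4 : (1 : ℝ) / (V * (V - 1)) ≤ 2 / V ^ 2 := by
      rw [div_le_div_iff₀ (by positivity) (by positivity)]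
      nlinarith
    have h5 : ((m : ℝ) + 2) * (1 / (V * (V - 1))) ≤ (m + 2) * (2 / V ^ 2) := by gcongr
    have h6 : 1 / ((m : ℝ) + 1) ≤ 2 * (1 / (m + 1 + 1)) := by
      rw [mul_one_div, div_le_div_iff₀ (by positivity) (by positivity)]
      nlinarith
    have h7 : ((m : ℝ) + 2) * (2 / V ^ 2) = 2 * ((m + 1 + 1) / V ^ 2) := by ring
    linarith

lemma abs_alphaOf_sub_le (hV : 2 ≤ V) (hn : 1 ≤ n) (A : Arch) {η : ℝ} (hη : 0 < η) :
    |alphaOf A V n η - η / (V * ((n : ℝ) + 1))| ≤ 4 * (η / (V * ((n : ℝ) + 1))) *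
      (1 / V + 1 / ((n : ℝ) + 1) + ((n : ℝ) + 1) / V ^ 2) := by
  have hV0 : (0 : ℝ) < V := by
    have : 0 < V := by omega
    exact_mod_cast this
  obtain ⟨h1, h2⟩ := average_sum_hitProb_bounds hV hn
  rw [alphaOf_eq hV hn, ← mul_sub_one, abs_mul, abs_of_pos (by positivity), mul_comm (4 : ℝ),
    mul_assoc]
  refine mul_le_mul_of_nonneg_left (abs_le.2 ⟨?_, ?_⟩) (by positivity)
  · have h3 : -4 / (V : ℝ) = -(4 * (1 / V)) := by ring
    have h4 : (0 : ℝ) ≤ 1 / ((n : ℝ) + 1) := by positivity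
    have h5 : (0 : ℝ) ≤ ((n : ℝ) + 1) / V ^ 2 := by positivity
    linarith
  · have h3 : (0 : ℝ) ≤ 1 / V := by positivity
    have h4 : (0 : ℝ) ≤ 1 / ((n : ℝ) + 1) := by positivity
    have h5 : (0 : ℝ) ≤ ((n : ℝ) + 1) / V ^ 2 := by positivity
    linarith

/-- A crude bound that does not require `T ≤ V`; it serves the estimate of `β`. -/
lemma abs_alphaOf_le (hV : 2 ≤ V) (hn : 1 ≤ n) (A : Arch) {η : ℝ} (hη : 0 < η) :
    |alphaOf A V n η| ≤ 4 * η / V := by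
  have hV2 : (2 : ℝ) ≤ V := by exact_mod_cast hV
  have hV0 : (0 : ℝ) < V := by linarith
  have hn1 : (1 : ℝ) ≤ n := by exact_mod_cast hn
  obtain ⟨h1, h2⟩ := average_sum_hitProb_bounds hV hn
  set R := 1 / n * ∑ t : Fin n, ∑ s, hitProb V t s - ((n : ℝ) + 1) / V with hR
  have h3 : (4 : ℝ) / V ≤ 2 := by rw [div_le_iff₀ hV0]; linarith
  have h4 : 1 / ((n : ℝ) + 1) ≤ 1 := by rw [div_le_iff₀ (by positivity)]; linarith
  have h5 : ((n : ℝ) + 1) / V ^ 2 ≤ ((n : ℝ) + 1) / 4 := by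
    gcongr
    nlinarith
  have h6 : |R| ≤ 4 * ((n : ℝ) + 1) := by
    rw [neg_div] at h1
    exact abs_le.2 ⟨by linarith, by linarith⟩
  rw [alphaOf_eq hV hn, ← hR, abs_mul, abs_of_pos (by positivity)]
  calc _ ≤ η / (V * ((n : ℝ) + 1)) * (4 * ((n : ℝ) + 1)) := by gcongr
    _ = 4 * η / V := by field_simp

lemma alphaOf_bounds (hV : 8 ≤ V) (hn : 1 ≤ n) (hnV : n + 1 ≤ V) (A : Arch) {η : ℝ}
    (hη : 0 < η) : 0 < alphaOf A V n η ∧ alphaOf A V n η ≤ 7 * (η / (V * ((n : ℝ) + 1))) := by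
  have hV8 : (8 : ℝ) ≤ V := by exact_mod_cast hV
  have hV0 : (0 : ℝ) < V := by linarith
  have hn1 : (1 : ℝ) ≤ n := by exact_mod_cast hn
  have hnV' : (n : ℝ) + 1 ≤ V := by exact_mod_cast hnV
  obtain ⟨h1, h2⟩ := average_sum_hitProb_bounds (by omega : 2 ≤ V) hn
  have h3 : (4 : ℝ) / V ≤ 1 / 2 := by rw [div_le_iff₀ hV0]; linarith
  have h4 : 1 / ((n : ℝ) + 1) ≤ 1 := by rw [div_le_iff₀ (by positivity)]; linarith
  have h5 : ((n : ℝ) + 1) / V ^ 2 ≤ 1 := by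
    rw [div_le_iff₀ (by positivity)]
    nlinarith
  rw [neg_div] at h1
  rw [alphaOf_eq (by omega) hn]
  constructor
  · refine mul_pos (by positivity) (by linarith)
  · rw [mul_comm (7 : ℝ)]
    refine mul_le_mul_of_nonneg_left (by linarith) (by positivity)

/-! ### The score of `W_K²` -/

/-- The fraction of trigger tokens up to `s`, when the first trigger is at the position `t`. -/
def configFrac (t : Fin n) (s : Fin (n + 1)) : ℝ :=
  (if t.castSucc ≤ s then 1 / ((s : ℝ) + 1) else 0) +
    if s = Fin.last n then 1 / ((s : ℝ) + 1) else 0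

lemma IsConfig.sum_Iic_mul {t : Fin n} {q o : Fin V} {z : TokenSeq V n} (h : IsConfig t q o z)
    (s : Fin (n + 1)) (f : Fin (n + 1) → ℝ) :
    ∑ s' ∈ Finset.Iic s, f s' * (if z s' = z (Fin.last n) then 1 else 0) =
      (if t.castSucc ≤ s then f t.castSucc else 0) +
        if s = Fin.last n then f (Fin.last n) else 0 := by
  have hl : z (Fin.last n) = q := (h.1 _).2 (Or.inr rfl)
  have hi (s' : Fin (n + 1)) : (f s' * if z s' = z (Fin.last n) then 1 else 0) =
      (if s' = t.castSucc then f s' else 0) + if s' = Fin.last n then f s' else 0 := by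
    simp only [hl, h.1 s']
    by_cases h1 : s' = t.castSucc
    · subst h1; simp [(Fin.castSucc_lt_last t).ne]
    · simp [h1]
  simp only [hi, Finset.sum_add_distrib, Finset.sum_ite_eq', Finset.mem_Iic, Fin.last_le_iff]

lemma IsConfig.triggerFrac_eq {t : Fin n} {q o : Fin V} {z : TokenSeq V n}
    (h : IsConfig t q o z) (s : Fin (n + 1)) : triggerFrac z s = configFrac t s :=
  h.sum_Iic_mul s _

lemma configFrac_nonneg (t : Fin n) (s : Fin (n + 1)) : 0 ≤ configFrac t s := by
  unfold configFrac
  split_ifs <;> positivity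

lemma configFrac_le_one (t : Fin n) (s : Fin (n + 1)) : configFrac t s ≤ 1 := by
  have h1 : 1 / ((s : ℝ) + 1) ≤ 1 := by
    rw [div_le_one (by positivity)]
    have : (0 : ℝ) ≤ s := by positivity
    linarith
  unfold configFrac
  by_cases hs : s = Fin.last n
  · have hn : (1 : ℝ) ≤ n := by
      have := t.pos
      exact_mod_cast this
    have h2 : 1 / ((n : ℝ) + 1) ≤ 1 / 2 := by gcongr; linarith
    subst hs
    split_ifs <;> simp only [Fin.val_last] at * <;> linarith
  · rw [if_neg hs, add_zero]
    split_ifs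
    exacts [h1, zero_le_one]

/-- The mean over the positions of the fraction of trigger tokens. -/
def configMean (t : Fin n) : ℝ := ∑ s, 1 / ((n : ℝ) + 1) * configFrac t s

lemma sum_uniform (n : ℕ) : ∑ _s : Fin (n + 1), 1 / ((n : ℝ) + 1) = 1 := by
  simp only [Finset.sum_const, Finset.card_univ, Fintype.card_fin, nsmul_eq_mul]
  push_cast
  field_simp

lemma configMean_nonneg (t : Fin n) : 0 ≤ configMean t :=
  Finset.sum_nonneg fun s _ => mul_nonneg (by positivity) (configFrac_nonneg t s)

lemma configMean_le_one (t : Fin n) : configMean t ≤ 1 := by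
  rw [← sum_uniform n]
  exact Finset.sum_le_sum fun s _ => mul_le_of_le_one_right (by positivity) (configFrac_le_one t s)

lemma abs_configFrac_sub_le (t : Fin n) (s : Fin (n + 1)) :
    |configFrac t s - configMean t| ≤ 1 := by
  rw [abs_le]
  constructor <;> linarith [configFrac_nonneg t s, configFrac_le_one t s, configMean_nonneg t,
    configMean_le_one t]

lemma sum_configFrac_sub (t : Fin n) : ∑ s, (configFrac t s - configMean t) = 0 := by
  have hn : (n : ℝ) + 1 ≠ 0 := by positivity
  rw [Finset.sum_sub_distrib, configMean, ← Finset.mul_sum]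
  simp only [Finset.sum_const, Finset.card_univ, Fintype.card_fin, nsmul_eq_mul]
  push_cast
  field_simp
  simp

/-- The sum over the positions whose expectation is the score of `W_K²`. -/
def stepSum (a : ℝ) (y : Fin V) (z : TokenSeq V n) : ℝ :=
  ∑ s, 1 / ((n : ℝ) + 1) * (triggerFrac z s - ∑ s', 1 / ((n : ℝ) + 1) * triggerFrac z s') *
    (hit y z s - tokenProb (centeredLogit a (fun _ => 1 / ((n : ℝ) + 1)) z) (z s))

lemma IsConfig.stepSum_eq {t : Fin n} {q o : Fin V} {z : TokenSeq V n} (h : IsConfig t q o z)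
    (a : ℝ) : stepSum a o z = ∑ s, 1 / ((n : ℝ) + 1) * (configFrac t s - configMean t) *
      (hit o z s - tokenProb (centeredLogit a (fun _ => 1 / ((n : ℝ) + 1)) z) (z s)) := by
  simp only [stepSum, h.triggerFrac_eq, configMean]

lemma alphaOf'_eq_average (hV : 2 ≤ V) (hn : 1 ≤ n) (η : ℝ) :
    alphaOf' .streams V n η = η / V * (alphaOf .streams V n η * V / (V - 1)) *
      (1 / n * ∑ t : Fin n, condExpect V n t fun _ y z =>
        stepSum (alphaOf .streams V n η * V / (V - 1)) y z) := by
  rw [← expect_eq_average hV hn]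
  exact alphaOf'_eq_expect hV η

/-- Every factor in the expectation is at most `1` in absolute value. With the crude bound on `α`
this makes `α'` of order `1/V`, hence the second attention almost uniform. -/
lemma abs_alphaOf'_le (hV : 2 ≤ V) (hn : 1 ≤ n) {η : ℝ} (hη : 0 < η) :
    |alphaOf' .streams V n η| ≤ η / V * |alphaOf .streams V n η * V / (V - 1)| := by
  have hn0 : (0 : ℝ) < n := by exact_mod_cast hn
  set a := alphaOf .streams V n η * V / (V - 1) with ha
  have h1 (t : Fin n) : |condExpect V n t fun _ y z => stepSum a y z| ≤ 1 := by
    rw [← condExpect_const hV t 1]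
    refine abs_condExpect_le hV fun q o z hz => ?_
    rw [hz.stepSum_eq]
    refine le_trans ?_ (sum_uniform n).le
    refine (Finset.abs_sum_le_sum_abs _ _).trans (Finset.sum_le_sum fun s _ => ?_)
    rw [abs_mul, abs_mul, abs_of_pos (by positivity : (0 : ℝ) < 1 / ((n : ℝ) + 1))]
    refine (mul_le_of_le_one_right (by positivity) (abs_hit_sub_tokenProb_le _ _ _ _ _)).trans ?_
    exact mul_le_of_le_one_right (by positivity) (abs_configFrac_sub_le t s)
  rw [alphaOf'_eq_average hV hn, ← ha, abs_mul, abs_mul, abs_of_pos (by positivity : 0 < η / V)]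
  refine mul_le_of_le_one_right (by positivity) ?_
  rw [abs_mul, abs_of_pos (by positivity), one_div, inv_mul_le_iff₀ hn0, mul_one]
  refine (Finset.abs_sum_le_sum_abs _ _).trans ((Finset.sum_le_sum fun t _ => h1 t).trans ?_)
  simp

/-- The deviations from the mean sum to zero, so the probabilities may be replaced by their distance
to `1/V`, which is at most `(exp |a| - 1) / V`. -/
lemma le_condExpect_stepSum (hV : 2 ≤ V) (t : Fin n) (a : ℝ) :
    1 / ((n : ℝ) + 1) * ∑ s, hitProb V t s * (configFrac t s - configMean t) -
      (Real.exp |a| - 1) / V ≤ condExpect V n t fun _ y z => stepSum a y z := by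
  have h1 : 1 / ((n : ℝ) + 1) * ∑ s, hitProb V t s * (configFrac t s - configMean t) -
      (Real.exp |a| - 1) / V = condExpect V n t fun _ y z =>
        (∑ s, 1 / ((n : ℝ) + 1) * (configFrac t s - configMean t) * hit y z s) +
          -((Real.exp |a| - 1) / V) := by
    rw [condExpect_add t (fun _ y z => ∑ s, 1 / ((n : ℝ) + 1) *
        (configFrac t s - configMean t) * hit y z s), condExpect_const hV,
      condExpect_sum Finset.univ t fun s _ y z =>
        1 / ((n : ℝ) + 1) * (configFrac t s - configMean t) * hit y z s]
    simp only [condExpect_const_mul, condExpect_hit hV]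
    rw [← sub_eq_add_neg, Finset.mul_sum]
    congr 1
    exact Finset.sum_congr rfl fun s _ => by ring
  rw [h1]
  refine condExpect_mono hV fun q o z hz => ?_
  set p := tokenProb (centeredLogit a (fun _ => 1 / ((n : ℝ) + 1)) z) with hp
  have h2 : stepSum a o z = (∑ s, 1 / ((n : ℝ) + 1) * (configFrac t s - configMean t) *
      hit o z s) - ∑ s, 1 / ((n : ℝ) + 1) * ((configFrac t s - configMean t) *
        (p (z s) - 1 / V)) := by
    have h3 : ∑ s, 1 / ((n : ℝ) + 1) * ((configFrac t s - configMean t) * (1 / V)) = 0 := by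
      rw [← Finset.mul_sum, ← Finset.sum_mul, sum_configFrac_sub, zero_mul, mul_zero]
    have h4 : ∑ s, 1 / ((n : ℝ) + 1) * ((configFrac t s - configMean t) * (p (z s) - 1 / V)) =
        ∑ s, 1 / ((n : ℝ) + 1) * ((configFrac t s - configMean t) * p (z s)) := by
      rw [← sub_zero (∑ s, 1 / ((n : ℝ) + 1) * ((configFrac t s - configMean t) * p (z s))),
        ← h3, ← Finset.sum_sub_distrib]
      exact Finset.sum_congr rfl fun s _ => by ring
    rw [h4, hz.stepSum_eq, ← Finset.sum_sub_distrib]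
    exact Finset.sum_congr rfl fun s _ => by ring
  have h5 : ∑ s, 1 / ((n : ℝ) + 1) * ((configFrac t s - configMean t) * (p (z s) - 1 / V)) ≤
      (Real.exp |a| - 1) / V := by
    calc _ ≤ ∑ s : Fin (n + 1), 1 / ((n : ℝ) + 1) * ((Real.exp |a| - 1) / V) := by
          refine Finset.sum_le_sum fun s _ => mul_le_mul_of_nonneg_left ?_ (by positivity)
          refine (le_abs_self _).trans ?_
          rw [abs_mul]
          refine (mul_le_of_le_one_left (abs_nonneg _) (abs_configFrac_sub_le t s)).trans ?_
          exact abs_tokenProb_sub_le hV (abs_centeredLogit_sub_le a (fun _ => by positivity)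
            (sum_uniform n) z) _
      _ = _ := by rw [← Finset.sum_mul, sum_uniform, one_mul]
  rw [h2]
  linarith

/-- Harmonic numbers. -/
def harm (n : ℕ) : ℝ := ∑ i ∈ Finset.range n, 1 / ((i : ℝ) + 1)

lemma one_le_harm (m : ℕ) : 1 ≤ harm (m + 1) := by
  rw [harm, Finset.sum_range_succ']
  have : 0 ≤ ∑ k ∈ Finset.range m, 1 / (((k + 1 : ℕ) : ℝ) + 1) :=
    Finset.sum_nonneg fun _ _ => by positivity
  norm_num at *
  exact this

/-- Equality holds at `m = 0`, which is `T = 3`. It leaves a ninth of the harmonic number as the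
margin of positivity. -/
lemma two_le_harm_add (m : ℕ) : 2 ≤ 8 / 9 * harm (m + 2) + 2 / ((m : ℝ) + 3) := by
  induction m with
  | zero => norm_num [harm, Finset.sum_range_succ]
  | succ m ih =>
    have h : harm (m + 1 + 2) = harm (m + 2) + 1 / ((m : ℝ) + 3) := by
      rw [harm, Finset.sum_range_succ, ← harm]
      push_cast
      ring
    have h2 : 10 / 9 * (1 / ((m : ℝ) + 3)) ≤ 2 / ((m : ℝ) + 4) := by
      rw [mul_one_div, div_le_div_iff₀ (by positivity) (by positivity)]
      have : (0 : ℝ) ≤ m := by positivity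
      linarith
    rw [h]
    push_cast
    have h3 : 2 / ((m : ℝ) + 3) = 2 * (1 / ((m : ℝ) + 3)) := by ring
    have h4 : (m : ℝ) + 1 + 3 = m + 4 := by ring
    rw [h4]
    linarith

lemma sum_configFrac (t : Fin n) :
    ∑ s, configFrac t s =
      (∑ j : Fin n, if t ≤ j then 1 / ((j : ℝ) + 1) else 0) + 2 / ((n : ℝ) + 1) := by
  rw [Fin.sum_univ_castSucc]
  congr 1
  · refine Finset.sum_congr rfl fun j _ => ?_
    simp [configFrac, (Fin.castSucc_lt_last j).ne]
  · simp [configFrac, Fin.le_last]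
    ring

/-- After exchanging the sums, a non-final position `j` lies at or after the first trigger for
exactly `j + 1` values of `t`, each contributing `1/(j+1)`. -/
lemma sum_configMean (n : ℕ) :
    ∑ t : Fin n, configMean t = 1 / ((n : ℝ) + 1) * (n + n * (2 / ((n : ℝ) + 1))) := by
  simp only [configMean, ← Finset.mul_sum, sum_configFrac, Finset.sum_add_distrib,
    Finset.sum_const, Finset.card_univ, Fintype.card_fin, nsmul_eq_mul]
  congr 2
  rw [Finset.sum_comm]
  have h (j : Fin n) : (∑ t : Fin n, if t ≤ j then 1 / ((j : ℝ) + 1) else 0) = 1 := by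
    rw [← Finset.sum_filter, Finset.sum_const]
    have : Finset.univ.filter (fun t => t ≤ j) = Finset.Iic j := by ext; simp
    rw [this, Fin.card_Iic, nsmul_eq_mul]
    push_cast
    field_simp
  simp only [h]
  simp

lemma configMean_last (m : ℕ) :
    configMean (Fin.last m) = 1 / ((m : ℝ) + 2) * (1 / ((m : ℝ) + 1) + 2 / ((m : ℝ) + 2)) := by
  rw [configMean, ← Finset.mul_sum, sum_configFrac, Fin.sum_univ_castSucc]
  have h (j : Fin m) : ¬ Fin.last m ≤ j.castSucc := not_le.2 (Fin.castSucc_lt_last j)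
  simp only [h, if_false, Finset.sum_const_zero, le_refl, if_true, zero_add, Fin.val_last]
  push_cast
  ring

/-- The position after a non-final `t` has fraction `1/(t+2)`, and these sum to `harm (m+1) - 1`.
The last `t` counts both trigger positions, hence its mean twice. Subtracting all the means leaves
`harm (m+1) - 2 + 2/(m+2)`, up to chance hits. -/
lemma le_sum_hitProb_mul_configFrac (hV : 2 ≤ V) (m : ℕ) :
    harm (m + 1) - 2 + 2 / ((m : ℝ) + 2) - 4 * harm (m + 1) / ((V : ℝ) - 1) ≤
      ∑ t : Fin (m + 1), ∑ s, hitProb V t s * (configFrac t s - configMean t) := by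
  have hV1 : (0 : ℝ) < V - 1 := by
    have : (2 : ℝ) ≤ V := by exact_mod_cast hV
    linarith
  have hcs (t : Fin (m + 1)) : configFrac t t.castSucc = 1 / ((t : ℝ) + 1) := by
    simp [configFrac, (Fin.castSucc_lt_last t).ne]
  have hlast (t : Fin (m + 1)) : configFrac t (Fin.last (m + 1)) = 2 / ((m : ℝ) + 2) := by
    simp [configFrac, Fin.le_last]
    ring
  have hsucc (t : Fin m) :
      configFrac t.castSucc (t.castSucc : Fin (m + 1)).succ = 1 / ((t : ℝ) + 2) := by
    rw [configFrac, if_pos (Fin.castSucc_lt_succ).le, if_neg (castSucc_succ_ne_last t)]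
    simp
    ring
  have hterm (t : Fin m) : 1 / ((t : ℝ) + 2) - configMean t.castSucc -
      4 * (1 / ((t : ℝ) + 1)) / ((V : ℝ) - 1) ≤
        ∑ s, hitProb V t.castSucc s * (configFrac t.castSucc s - configMean t.castSucc) := by
    -- The deviations sum to zero, so the chance hits contribute minus the three exceptional
    -- deviations over `V - 1`.
    rw [sum_hitProb_mul, if_neg (castSucc_succ_ne_last t), sum_configFrac_sub, hcs, hlast, hsucc]
    have h0 : (0 : ℝ) ≤ t := by positivity
    have htm : ((t : ℕ) : ℝ) + 1 ≤ m := by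
      have := t.isLt
      exact_mod_cast this
    have h1 : 1 / ((t : ℝ) + 2) ≤ 1 / ((t : ℝ) + 1) := by gcongr; norm_num
    have h2 : 2 / ((m : ℝ) + 2) ≤ 2 * (1 / ((t : ℝ) + 1)) := by
      rw [mul_one_div, div_le_div_iff₀ (by positivity) (by positivity)]
      linarith
    have h3 := configMean_nonneg (t.castSucc : Fin (m + 1))
    have h4 : -(4 * (1 / ((t : ℝ) + 1))) / ((V : ℝ) - 1) ≤
        (0 - (1 / (((t.castSucc : Fin (m + 1)) : ℝ) + 1) - configMean t.castSucc) -
          (1 / ((t : ℝ) + 2) - configMean t.castSucc) -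
          (2 / ((m : ℝ) + 2) - configMean t.castSucc)) / ((V : ℝ) - 1) := by
      refine div_le_div_of_nonneg_right ?_ hV1.le
      simp only [Fin.val_castSucc]
      linarith
    rw [neg_div] at h4
    linarith
  have hsum : ∑ t : Fin (m + 1), configMean t =
      1 / ((m : ℝ) + 2) * ((m + 1) + (m + 1) * (2 / ((m : ℝ) + 2))) := by
    rw [sum_configMean]
    push_cast
    ring
  rw [Fin.sum_univ_castSucc] at hsum ⊢
  have hmain := Finset.sum_le_sum fun (t : Fin m) (_ : t ∈ Finset.univ) => hterm t
  simp only [Finset.sum_sub_distrib, ← Finset.sum_div, ← Finset.mul_sum] at hmain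
  have hh1 : ∑ t : Fin m, 1 / ((t : ℝ) + 2) = harm (m + 1) - 1 := by
    rw [harm, Finset.sum_range_succ', Fin.sum_univ_eq_sum_range fun i => 1 / ((i : ℝ) + 2)]
    norm_num [add_assoc]
  have hh2 : ∑ t : Fin m, 1 / ((t : ℝ) + 1) ≤ harm (m + 1) := by
    rw [harm, Finset.sum_range_succ, Fin.sum_univ_eq_sum_range fun i => 1 / ((i : ℝ) + 1)]
    have : 0 ≤ 1 / ((m : ℝ) + 1) := by positivity
    linarith
  have hh3 : 4 * (∑ t : Fin m, 1 / ((t : ℝ) + 1)) / ((V : ℝ) - 1) ≤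
      4 * harm (m + 1) / ((V : ℝ) - 1) := by gcongr
  have hl : ∑ s, hitProb V (Fin.last m) s * (configFrac (Fin.last m) s - configMean (Fin.last m)) =
      1 / ((m : ℝ) + 1) + 2 / ((m : ℝ) + 2) - 2 * configMean (Fin.last m) := by
    rw [sum_hitProb_mul, if_pos (Fin.succ_last m), hcs, hlast]
    simp only [Fin.val_last]
    ring
  rw [hl]
  have hlm := configMean_last m
  have hid : 1 / ((m : ℝ) + 1) + 2 / ((m : ℝ) + 2) -
      1 / ((m : ℝ) + 2) * ((m + 1) + (m + 1) * (2 / ((m : ℝ) + 2))) -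
      1 / ((m : ℝ) + 2) * (1 / ((m : ℝ) + 1) + 2 / ((m : ℝ) + 2)) = -1 + 2 / ((m : ℝ) + 2) := by
    field_simp
    ring
  linarith

lemma le_alphaOf' {H : ℝ} (hV : 73 ≤ V) (hVH : 1512 * H ≤ V) (hn : 2 ≤ n) (hnV : n + 1 ≤ V) {η : ℝ}
    (hη : 0 < η) (hηH : η ≤ H) :
    1 / 36 * (alphaOf .streams V n η * η / (V * ((n : ℝ) + 1))) * (1 / ((n : ℝ) + 1)) ≤
      alphaOf' .streams V n η := by
  have hV' : (73 : ℝ) ≤ V := by exact_mod_cast hV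
  have hV0 : (0 : ℝ) < V := by linarith
  have hV1 : (0 : ℝ) < V - 1 := by linarith
  have hnV' : (n : ℝ) + 1 ≤ V := by exact_mod_cast hnV
  have hn0 : (0 : ℝ) < n := by
    have : 0 < n := by omega
    exact_mod_cast this
  have hn1 : (0 : ℝ) < (n : ℝ) + 1 := by linarith
  have hH : 0 < H := hη.trans_le hηH
  obtain ⟨hα, hα7⟩ := alphaOf_bounds (by omega) (by omega : 1 ≤ n) hnV .streams hη
  set α := alphaOf .streams V n η with hαdef
  set a := α * V / (V - 1) with ha
  have haα : α ≤ a := by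
    rw [ha, le_div_iff₀ hV1]
    nlinarith
  have ha2 : a ≤ 2 * α := by
    rw [ha, div_le_iff₀ hV1]
    nlinarith
  have hb : a ≤ 14 * H / (V * ((n : ℝ) + 1)) := by
    calc a ≤ 2 * (7 * (η / (V * ((n : ℝ) + 1)))) := by linarith
      _ = 14 * η / (V * ((n : ℝ) + 1)) := by ring
      _ ≤ _ := by gcongr
  have ha1 : a ≤ 1 := by
    refine hb.trans ?_
    rw [div_le_one (by positivity)]
    nlinarith
  have ha0 : 0 < a := hα.trans_le haα
  -- Here `42 = 14 * 3` with `exp a ≤ 3`, and `1512 = 42 * 36` makes the error at most half of the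
  -- main term.
  have herr : (Real.exp |a| - 1) / V ≤ 1 / ((n : ℝ) + 1) * (1 / (36 * n)) := by
    rw [abs_of_pos ha0]
    have h1 : Real.exp a ≤ 3 := by
      have := Real.exp_le_exp.2 ha1
      have h2 := Real.exp_one_lt_d9
      linarith
    have h2 : Real.exp a - 1 ≤ 42 * H / (V * ((n : ℝ) + 1)) := by
      calc _ ≤ a * Real.exp a := exp_sub_one_le_mul_exp a
        _ ≤ (14 * H / (V * ((n : ℝ) + 1))) * 3 := by gcongr
        _ = _ := by ring
    calc _ ≤ 42 * H / (V * ((n : ℝ) + 1)) / V := by gcongr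
      _ = 1 / ((n : ℝ) + 1) * (42 * H / V ^ 2) := by field_simp
      _ ≤ _ := by
        refine mul_le_mul_of_nonneg_left ?_ (by positivity)
        rw [div_le_div_iff₀ (by positivity) (by positivity)]
        nlinarith [mul_le_mul hVH (by linarith : (n : ℝ) ≤ V) hn0.le hV0.le]
  -- The main part is at least `harm / 9`; as `V ≥ 73` gives `4/(V-1) ≤ 1/18`, the error takes at
  -- most `harm / 18`, and the harmonic number is at least `1`.
  have hR : 1 / 18 ≤ ∑ t : Fin n, ∑ s, hitProb V t s * (configFrac t s - configMean t) := by
    obtain ⟨m, rfl⟩ : ∃ m, n = m + 1 + 1 := ⟨n - 2, by omega⟩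
    refine le_trans ?_ (le_sum_hitProb_mul_configFrac (by omega) (m + 1))
    have h1 := two_le_harm_add m
    have h2 := one_le_harm (m + 1)
    have h3 : 4 * harm (m + 1 + 1) / ((V : ℝ) - 1) ≤ harm (m + 1 + 1) / 18 := by
      rw [div_le_div_iff₀ hV1 (by norm_num)]
      nlinarith
    have h4 : ((m + 1 : ℕ) : ℝ) + 2 = m + 3 := by push_cast; ring
    rw [h4]
    change 1 / 18 ≤ harm (m + 2) - 2 + 2 / ((m : ℝ) + 3) - _
    change 1 ≤ harm (m + 2) at h2
    change _ ≤ harm (m + 2) / 18 at h3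
    linarith
  have hmean : 1 / ((n : ℝ) + 1) * (1 / (36 * n)) ≤
      1 / n * ∑ t : Fin n, condExpect V n t fun _ y z => stepSum a y z := by
    have h1 := Finset.sum_le_sum fun (t : Fin n) (_ : t ∈ Finset.univ) =>
      le_condExpect_stepSum (by omega : 2 ≤ V) t a
    rw [Finset.sum_sub_distrib, ← Finset.mul_sum] at h1
    simp only [Finset.sum_const, Finset.card_univ, Fintype.card_fin, nsmul_eq_mul] at h1
    rw [one_div (n : ℝ), le_inv_mul_iff₀ hn0]
    refine le_trans ?_ h1
    have h2 : n * ((Real.exp |a| - 1) / V) ≤ n * (1 / ((n : ℝ) + 1) * (1 / (36 * n))) := by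
      gcongr
    have h3 : 1 / ((n : ℝ) + 1) * (1 / 18) ≤ 1 / ((n : ℝ) + 1) *
        ∑ t : Fin n, ∑ s, hitProb V t s * (configFrac t s - configMean t) := by gcongr
    have h4 : (n : ℝ) * (1 / ((n : ℝ) + 1) * (1 / (36 * n))) =
        1 / ((n : ℝ) + 1) * (1 / 18) - n * (1 / ((n : ℝ) + 1) * (1 / (36 * n))) := by
      field_simp
      ring
    linarith
  rw [alphaOf'_eq_average (by omega) (by omega), ← hαdef, ← ha]
  calc _ = η / V * α * (1 / ((n : ℝ) + 1) * (1 / (36 * ((n : ℝ) + 1)))) := by field_simp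
    _ ≤ η / V * a * (1 / ((n : ℝ) + 1) * (1 / (36 * n))) := by
      gcongr
      linarith
    _ ≤ _ := by gcongr

/-! ### The score of `W_K¹` -/

lemma sum_isPrev (s : Fin (n + 1)) :
    ∑ s' ∈ Finset.Iic s, isPrev s s' = if 1 ≤ (s : ℕ) then 1 else 0 := by
  split_ifs with h
  · rw [Finset.sum_eq_single (⟨s - 1, by omega⟩ : Fin (n + 1))]
    · rw [isPrev, if_pos (show (s : ℕ) - (s - 1) = 1 by omega)]
    · intro s' _ hne
      refine if_neg fun h' => hne (Fin.ext ?_)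
      simp only
      omega
    · intro h'
      exact absurd (Finset.mem_Iic.2 (Fin.le_def.2 (Nat.sub_le _ _))) h'
  · exact Finset.sum_eq_zero fun s' _ => if_neg (by omega)

/-- The derivative of the fraction of trigger tokens seen at `s`, when the first trigger is at the
position `t`. -/
def configDrift (t : Fin n) (s : Fin (n + 1)) : ℝ :=
  (if t.castSucc ≤ s then 1 / ((s : ℝ) + 1) *
      (isPrev s t.castSucc - 1 / ((s : ℝ) + 1) * if 1 ≤ (s : ℕ) then 1 else 0) else 0) +
    if s = Fin.last n then 1 / ((s : ℝ) + 1) *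
      (0 - 1 / ((s : ℝ) + 1) * if 1 ≤ (s : ℕ) then 1 else 0) else 0

lemma IsConfig.triggerDrift_eq {t : Fin n} {q o : Fin V} {z : TokenSeq V n}
    (h : IsConfig t q o z) (s : Fin (n + 1)) : triggerDrift z s = configDrift t s := by
  rw [triggerDrift, h.sum_Iic_mul s fun s' => 1 / ((s : ℝ) + 1) *
    (isPrev s s' - ∑ s'' ∈ Finset.Iic s, 1 / ((s : ℝ) + 1) * isPrev s s''), ← Finset.mul_sum,
    sum_isPrev, configDrift]
  congr 1
  refine if_ctx_congr Iff.rfl (fun hs => ?_) fun _ => rfl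
  rw [hs, isPrev, if_neg (by omega)]

/-- The drift at the position after the first trigger, apart from the second trigger. -/
def mainDrift (t : Fin n) : ℝ := 1 / ((t : ℝ) + 2) * (1 - 1 / ((t : ℝ) + 2))

/-- A bound of the drift at the other positions. -/
def driftBound (t : Fin n) (s : Fin (n + 1)) : ℝ :=
  (if t.castSucc ≤ s then (1 / ((s : ℝ) + 1)) ^ 2 else 0) +
    if s = Fin.last n then (1 / ((s : ℝ) + 1)) ^ 2 else 0

lemma driftBound_nonneg (t : Fin n) (s : Fin (n + 1)) : 0 ≤ driftBound t s := by
  unfold driftBound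
  split_ifs <;> positivity

/-- Away from `t + 1` the previous token is not a trigger, so attention to the triggers only decays,
by `(1/(s+1))²` for each trigger seen. -/
lemma abs_configDrift_le (t : Fin n) {s : Fin (n + 1)} (hs : s ≠ t.succ) :
    |configDrift t s| ≤ driftBound t s := by
  unfold configDrift driftBound
  have h1 : |1 / ((s : ℝ) + 1) * (0 - 1 / ((s : ℝ) + 1) * if 1 ≤ (s : ℕ) then 1 else 0)| ≤
      (1 / ((s : ℝ) + 1)) ^ 2 := by
    rw [zero_sub, mul_neg, abs_neg, ← mul_assoc, ← sq, abs_mul, abs_of_pos (by positivity)]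
    refine mul_le_of_le_one_right (by positivity) ?_
    split_ifs <;> simp
  refine (abs_add_le _ _).trans (add_le_add ?_ ?_)
  · by_cases h : t.castSucc ≤ s
    · have : isPrev s t.castSucc = 0 := by
        refine if_neg fun h' => hs (Fin.ext ?_)
        simp only [Fin.val_castSucc] at h'
        simp only [Fin.val_succ]
        omega
      rw [if_pos h, if_pos h, this]
      exact h1
    · rw [if_neg h, if_neg h, abs_zero]
  · by_cases h : s = Fin.last n
    · rw [if_pos h, if_pos h]
      exact h1
    · rw [if_neg h, if_neg h, abs_zero]

/-- The correction occurs when the second trigger is at `t + 1` itself and also loses attention. -/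
lemma configDrift_succ (t : Fin n) :
    configDrift t t.succ = mainDrift t -
      if t.succ = Fin.last n then (1 / ((t : ℝ) + 2)) ^ 2 else 0 := by
  rw [configDrift, if_pos (Fin.castSucc_lt_succ).le, isPrev, if_pos (by simp),
    if_pos (by simp), mainDrift]
  have h2 : (((t.succ : Fin (n + 1)) : ℕ) : ℝ) + 1 = (t : ℝ) + 2 := by
    simp; ring
  rw [h2]
  split_ifs <;> ring

lemma abs_configDrift_succ_sub_le (t : Fin n) :
    |configDrift t t.succ - mainDrift t| ≤ 1 / ((t : ℝ) + 2) * (1 / ((n : ℝ) + 1)) := by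
  rw [configDrift_succ, sub_sub_cancel_left, abs_neg]
  split_ifs with h
  · have hn : (n : ℝ) + 1 = (t : ℝ) + 2 := by
      have := Fin.ext_iff.1 h
      simp only [Fin.val_succ, Fin.val_last] at this
      have : (t : ℝ) + 1 = n := by exact_mod_cast this
      linarith
    rw [hn, abs_of_nonneg (by positivity), sq]
  · rw [abs_zero]; positivity

lemma abs_configDrift_succ_le (t : Fin n) : |configDrift t t.succ| ≤ 1 / ((t : ℝ) + 2) := by
  have h0 : 0 < 1 / ((t : ℝ) + 2) := by positivity
  have h1 : 1 / ((t : ℝ) + 2) ≤ 1 / 2 := by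
    gcongr
    have : (0 : ℝ) ≤ t := by positivity
    linarith
  rw [configDrift_succ, mainDrift, abs_le]
  constructor <;> split_ifs <;> nlinarith

/-- Telescoping, since `(1/(i+1))² ≤ 2/((i+1)(i+2))`. -/
lemma sum_range_inv_sq_le (t N : ℕ) (h : t ≤ N) :
    ∑ i ∈ Finset.range N, (if t ≤ i then (1 / ((i : ℝ) + 1)) ^ 2 else 0) ≤
      2 * (1 / ((t : ℝ) + 1) - 1 / ((N : ℝ) + 1)) := by
  induction N, h using Nat.le_induction with
  | base =>
    rw [Finset.sum_eq_zero fun i hi => if_neg (by simpa using hi)]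
    simp
  | succ N hN ih =>
    rw [Finset.sum_range_succ, if_pos hN]
    have : (1 / ((N : ℝ) + 1)) ^ 2 ≤ 2 * (1 / ((N : ℝ) + 1) - 1 / (((N + 1 : ℕ) : ℝ) + 1)) := by
      have h0 : (0 : ℝ) ≤ N := by positivity
      have h1 : 2 * (1 / ((N : ℝ) + 1) - 1 / (((N + 1 : ℕ) : ℝ) + 1)) =
          2 / (((N : ℝ) + 1) * (N + 2)) := by
        push_cast
        field_simp
        ring
      rw [h1, div_pow, div_le_div_iff₀ (by positivity) (by positivity)]
      nlinarith
    linarith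

lemma sum_driftBound_le (t : Fin n) : ∑ s, driftBound t s ≤ 5 / ((t : ℝ) + 2) := by
  have ht0 : (0 : ℝ) ≤ t := by positivity
  have htn : (t : ℝ) + 1 ≤ n := by
    have := t.isLt
    exact_mod_cast this
  simp only [driftBound, Finset.sum_add_distrib, Finset.sum_ite_eq', Finset.mem_univ, if_true,
    Fin.le_def, Fin.val_castSucc, Fin.val_last]
  rw [Fin.sum_univ_eq_sum_range fun i => if (t : ℕ) ≤ i then (1 / ((i : ℝ) + 1)) ^ 2 else 0]
  have h1 := sum_range_inv_sq_le t (n + 1) (by omega)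
  have h2 : 0 ≤ 1 / (((n + 1 : ℕ) : ℝ) + 1) := by positivity
  have h3 : 2 * (1 / ((t : ℝ) + 1)) ≤ 4 / ((t : ℝ) + 2) := by
    rw [mul_one_div, div_le_div_iff₀ (by positivity) (by positivity)]
    linarith
  have h4 : (1 / ((n : ℝ) + 1)) ^ 2 ≤ 1 / ((t : ℝ) + 2) := by
    rw [div_pow, one_pow, div_le_div_iff₀ (by positivity) (by positivity)]
    nlinarith
  have h5 : 5 / ((t : ℝ) + 2) = 4 / ((t : ℝ) + 2) + 1 / ((t : ℝ) + 2) := by ring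
  linarith

/-- A deterministic estimate for one sequence: `h` is the hit indicator, `p` the predicted
probability and `W` stands for `V`. The sums over `h` stay in the bound, since they are small only
in expectation. -/
lemma abs_drift_sum_sub_le (t : Fin n) {π p h : Fin (n + 1) → ℝ} {K W : ℝ} (hK : 1 ≤ K)
    (hW : 0 < W) (hπ0 : ∀ s, 0 ≤ π s) (hπ1 : ∑ s, π s = 1)
    (hπ : ∀ s, |((n : ℝ) + 1) * π s - 1| ≤ K / W) (hπK : ∀ s, ((n : ℝ) + 1) * π s ≤ K)
    (hp0 : ∀ s, 0 ≤ p s) (hp1 : ∀ s, p s ≤ 1) (hp : ∀ s, p s ≤ K / W) (hh0 : ∀ s, 0 ≤ h s)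
    (hh1 : ∀ s, h s ≤ 1) (hsucc : h t.succ = 1) :
    |((n : ℝ) + 1) * ∑ s, π s * (configDrift t s - ∑ s', π s' * configDrift t s') *
        (h s - p s) - mainDrift t| ≤
      1 / ((t : ℝ) + 2) * (14 * K ^ 2 / W + 1 / ((n : ℝ) + 1)) +
        (1 / ((t : ℝ) + 2) * (6 * K ^ 2 / ((n : ℝ) + 1)) * ∑ s, h s +
          K * ∑ s, (if s = t.succ then 0 else driftBound t s) * h s) := by
  set T : ℝ := (n : ℝ) + 1 with hT
  have hT0 : 0 < T := by positivity
  set D := configDrift t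
  set g : Fin (n + 1) → ℝ := fun s => h s - p s with hg
  set m := ∑ s, π s * g s with hm
  have hm1 : |m| ≤ 1 := by
    rw [← hπ1]
    refine (Finset.abs_sum_le_sum_abs _ _).trans (Finset.sum_le_sum fun s _ => ?_)
    rw [abs_mul, abs_of_nonneg (hπ0 s)]
    refine mul_le_of_le_one_right (hπ0 s) (abs_le.2 ⟨?_, ?_⟩) <;>
      linarith [hh0 s, hh1 s, hp0 s, hp1 s]
  have hmH : |m| ≤ K / T * ∑ s, h s + K / W := by
    have h1 : |m| ≤ ∑ s, (K / T * h s + π s * (K / W)) := by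
      refine (Finset.abs_sum_le_sum_abs _ _).trans (Finset.sum_le_sum fun s _ => ?_)
      have hπT : π s ≤ K / T := by
        rw [le_div_iff₀ hT0]; linarith [hπK s]
      rw [abs_mul, abs_of_nonneg (hπ0 s)]
      calc π s * |g s| ≤ π s * (h s + K / W) := by
            refine mul_le_mul_of_nonneg_left (abs_le.2 ⟨?_, ?_⟩) (hπ0 s) <;>
              linarith [hh0 s, hp0 s, hp s]
        _ = π s * h s + π s * (K / W) := by ring
        _ ≤ _ := by
          have := mul_le_mul_of_nonneg_right hπT (hh0 s)
          linarith
    rwa [Finset.sum_add_distrib, ← Finset.mul_sum, ← Finset.sum_mul, hπ1, one_mul] at h1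
  -- A covariance may be centered in either factor. Centering `h - p` instead of the drift isolates
  -- the term at `t + 1`.
  have hsplit : T * ∑ s, π s * (D s - ∑ s', π s' * D s') * (h s - p s) =
      ∑ s, (T * π s) * D s * (g s - m) := by
    have h1 : ∑ s, π s * (D s - ∑ s', π s' * D s') * (h s - p s) =
        ∑ s, π s * D s * g s - (∑ s', π s' * D s') * m := by
      rw [hm, Finset.mul_sum, ← Finset.sum_sub_distrib]
      exact Finset.sum_congr rfl fun s _ => by ring
    have h2 : ∑ s, (T * π s) * D s * (g s - m) =
        T * (∑ s, π s * D s * g s - (∑ s', π s' * D s') * m) := by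
      rw [Finset.sum_mul, ← Finset.sum_sub_distrib, Finset.mul_sum]
      exact Finset.sum_congr rfl fun s _ => by ring
    rw [h1, h2]
  set x : ℝ := 1 / ((t : ℝ) + 2) with hx
  have hx0 : 0 < x := by positivity
  have hKW : 0 ≤ K / W := by positivity
  have hD1 : |D t.succ| ≤ x := abs_configDrift_succ_le t
  have hmain : |(T * π t.succ) * D t.succ * (g t.succ - m) - mainDrift t| ≤
      x * (3 * (K / W) + |m| + 1 / T) := by
    have hg1 : |g t.succ - m| ≤ 2 := by
      refine (abs_sub _ _).trans ?_
      have : |g t.succ| ≤ 1 := by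
        rw [abs_le]
        constructor <;> linarith [hh0 t.succ, hh1 t.succ, hp0 t.succ, hp1 t.succ]
      linarith
    have hg2 : |g t.succ - m - 1| ≤ K / W + |m| := by
      have : g t.succ - m - 1 = -p t.succ - m := by simp only [hg, hsucc]; ring
      rw [this]
      refine (abs_sub _ _).trans ?_
      rw [abs_neg, abs_of_nonneg (hp0 _)]
      linarith [hp t.succ]
    have e : (T * π t.succ) * D t.succ * (g t.succ - m) - mainDrift t =
        (T * π t.succ - 1) * D t.succ * (g t.succ - m) + D t.succ * (g t.succ - m - 1) +
          (D t.succ - mainDrift t) := by ring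
    rw [e]
    refine (abs_add_three _ _ _).trans ?_
    rw [abs_mul, abs_mul, abs_mul]
    have h1 : |T * π t.succ - 1| * |D t.succ| * |g t.succ - m| ≤ K / W * x * 2 := by
      gcongr
      exact hπ _
    have h2 : |D t.succ| * |g t.succ - m - 1| ≤ x * (K / W + |m|) := by gcongr
    have h3 := abs_configDrift_succ_sub_le t
    calc _ ≤ K / W * x * 2 + x * (K / W + |m|) + x * (1 / T) := by
          gcongr
      _ = _ := by ring
  have hrest : |∑ s ∈ Finset.univ.erase t.succ, (T * π s) * D s * (g s - m)| ≤
      K * (∑ s, (if s = t.succ then 0 else driftBound t s) * h s) +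
        5 * K * x * (K / W + |m|) := by
    have h1 (s : Fin (n + 1)) (hs : s ≠ t.succ) : |(T * π s) * D s * (g s - m)| ≤
        K * (driftBound t s * h s) + K * (K / W + |m|) * driftBound t s := by
      rw [abs_mul, abs_mul, abs_of_nonneg (mul_nonneg hT0.le (hπ0 s))]
      have h2 : |g s - m| ≤ h s + (K / W + |m|) := by
        refine (abs_sub _ _).trans ?_
        have : |g s| ≤ h s + K / W := by
          rw [abs_le]
          constructor <;> linarith [hh0 s, hp0 s, hp s]
        linarith
      calc T * π s * |D s| * |g s - m| ≤ K * driftBound t s * (h s + (K / W + |m|)) := by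
            have := abs_configDrift_le t hs
            have h0 := driftBound_nonneg t s
            gcongr
            exact hπK s
        _ = _ := by ring
    have h3 : ∑ s, (if s = t.succ then 0 else driftBound t s) * h s =
        ∑ s ∈ Finset.univ.erase t.succ, driftBound t s * h s := by
      rw [← Finset.add_sum_erase _ _ (Finset.mem_univ t.succ), if_pos rfl, zero_mul, zero_add]
      exact Finset.sum_congr rfl fun s hs => by rw [if_neg (Finset.mem_erase.1 hs).1]
    have h4 : ∑ s ∈ Finset.univ.erase t.succ, driftBound t s ≤ 5 * x := by
      refine (Finset.sum_le_sum_of_subset_of_nonneg (Finset.subset_univ _)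
        fun s _ _ => driftBound_nonneg t s).trans ((sum_driftBound_le t).trans (le_of_eq ?_))
      rw [hx]; ring
    refine (Finset.abs_sum_le_sum_abs _ _).trans ((Finset.sum_le_sum fun s hs =>
      h1 s (Finset.mem_erase.1 hs).1).trans ?_)
    rw [Finset.sum_add_distrib, ← Finset.mul_sum, ← Finset.mul_sum, h3]
    have h5 : K * (K / W + |m|) * ∑ s ∈ Finset.univ.erase t.succ, driftBound t s ≤
        K * (K / W + |m|) * (5 * x) := by gcongr
    linarith
  rw [hsplit, ← Finset.add_sum_erase _ _ (Finset.mem_univ t.succ), add_sub_right_comm]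
  refine (abs_add_le _ _).trans ((add_le_add hmain hrest).trans ?_)
  have hK2 : K ≤ K ^ 2 := by nlinarith
  have hcoef : x * (3 * (K / W) + |m| + 1 / T) + 5 * K * x * (K / W + |m|) ≤
      x * (14 * K ^ 2 / W + 1 / T) + x * (6 * K ^ 2 / T) * ∑ s, h s := by
    have h6 : (1 + 5 * K) * |m| ≤ 6 * K * (K / T * ∑ s, h s + K / W) := by
      have : 0 ≤ |m| := abs_nonneg m
      have h7 : (1 + 5 * K) * |m| ≤ 6 * K * |m| := by gcongr; linarith
      have h8 : 6 * K * |m| ≤ 6 * K * (K / T * ∑ s, h s + K / W) := by gcongr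
      linarith
    have h9 : K / W ≤ K ^ 2 / W := by gcongr
    have h10 : 6 * K * (K / T * ∑ s, h s + K / W) + 3 * (K / W) + 5 * K * (K / W) ≤
        14 * K ^ 2 / W + 6 * K ^ 2 / T * ∑ s, h s := by
      have e1 : 6 * K * (K / T * ∑ s, h s + K / W) + 3 * (K / W) + 5 * K * (K / W) =
          11 * (K ^ 2 / W) + 3 * (K / W) + 6 * K ^ 2 / T * ∑ s, h s := by ring
      have e2 : 14 * K ^ 2 / W = 14 * (K ^ 2 / W) := by ring
      rw [e1, e2]
      linarith
    calc _ = x * ((1 + 5 * K) * |m| + 3 * (K / W) + 5 * K * (K / W) + 1 / T) := by ring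
      _ ≤ x * (14 * K ^ 2 / W + 6 * K ^ 2 / T * ∑ s, h s + 1 / T) := by
        refine mul_le_mul_of_nonneg_left ?_ hx0.le
        linarith
      _ = _ := by ring
  linarith

lemma sum_hitProb_le (hV : 2 ≤ V) (t : Fin n) :
    ∑ s, hitProb V t s ≤ 2 + 2 * ((n : ℝ) + 1) / V := by
  have hV2 : (2 : ℝ) ≤ V := by exact_mod_cast hV
  have hV1 : (0 : ℝ) < V - 1 := by linarith
  have h0 : 0 ≤ 2 * ((n : ℝ) + 1) / V := by positivity
  rw [sum_hitProb]
  split_ifs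
  · linarith
  · have : ((n : ℝ) - 2) / (V - 1) ≤ 2 * ((n : ℝ) + 1) / V := by
      rw [div_le_div_iff₀ hV1 (by linarith)]
      have : (0 : ℝ) ≤ n := by positivity
      nlinarith
    linarith

/-- Chance hits cost `5/(V-1) ≤ 10/V`. If `t + 1 = T`, the position `t` also shows `o` and costs
`1/(t+1)² ≤ 4/(t+2)²`. -/
lemma sum_driftBound_mul_hitProb_le (hV : 2 ≤ V) (t : Fin n) :
    ∑ s, (if s = t.succ then 0 else driftBound t s) * hitProb V t s ≤
      1 / ((t : ℝ) + 2) * (10 / V + 4 / ((n : ℝ) + 1)) := by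
  have hV2 : (2 : ℝ) ≤ V := by exact_mod_cast hV
  have hV0 : (0 : ℝ) < V := by linarith
  have hV1 : (0 : ℝ) < V - 1 := by linarith
  set w : Fin (n + 1) → ℝ := fun s => if s = t.succ then 0 else driftBound t s with hw
  have hw0 (s : Fin (n + 1)) : 0 ≤ w s := by
    simp only [hw]
    split_ifs
    exacts [le_rfl, driftBound_nonneg t s]
  have hwsum : ∑ s, w s ≤ 5 / ((t : ℝ) + 2) := by
    refine le_trans (Finset.sum_le_sum fun s _ => ?_) (sum_driftBound_le t)
    simp only [hw]
    split_ifs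
    exacts [driftBound_nonneg t s, le_rfl]
  have h1 : ∑ s, w s * hitProb V t s = ∑ s, hitProb V t s * w s :=
    Finset.sum_congr rfl fun s _ => mul_comm _ _
  rw [h1, sum_hitProb_mul]
  split_ifs with h
  · have hn : (n : ℝ) + 1 = (t : ℝ) + 2 := by
      have := Fin.ext_iff.1 h
      simp only [Fin.val_succ, Fin.val_last] at this
      have : (t : ℝ) + 1 = n := by exact_mod_cast this
      linarith
    have ht0 : (0 : ℝ) ≤ t := by positivity
    have h2 : w (Fin.last n) = 0 := if_pos h.symm
    have h3 : w t.castSucc = (1 / ((t : ℝ) + 1)) ^ 2 := by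
      simp [hw, (Fin.castSucc_lt_succ (i := t)).ne, driftBound, (Fin.castSucc_lt_last t).ne]
    have h4 : (1 / ((t : ℝ) + 1)) ^ 2 ≤ 1 / ((t : ℝ) + 2) * (4 / ((t : ℝ) + 2)) := by
      rw [div_pow, one_pow, div_mul_div_comm, div_le_div_iff₀ (by positivity) (by positivity)]
      nlinarith
    have h5 : 0 ≤ 1 / ((t : ℝ) + 2) * (10 / V) := by positivity
    rw [h2, h3, hn, mul_add]
    linarith
  · have h2 : w t.succ = 0 := if_pos rfl
    have h3 : (∑ s, w s - w t.castSucc - w t.succ - w (Fin.last n)) / ((V : ℝ) - 1) ≤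
        (5 / ((t : ℝ) + 2)) / ((V : ℝ) - 1) := by
      gcongr
      linarith [hw0 t.castSucc, hw0 t.succ, hw0 (Fin.last n)]
    have h4 : (5 / ((t : ℝ) + 2)) / ((V : ℝ) - 1) ≤ 1 / ((t : ℝ) + 2) * (10 / V) := by
      rw [div_div, div_mul_div_comm, div_le_div_iff₀ (by positivity) (by positivity)]
      have : (0 : ℝ) ≤ t := by positivity
      nlinarith
    have h5 : 0 ≤ 1 / ((t : ℝ) + 2) * (4 / ((n : ℝ) + 1)) := by positivity
    rw [h2] at h3
    rw [h2, mul_add]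
    linarith

/-- The sum over the positions whose expectation is the score of `W_K¹`. -/
def driftSum (a a' : ℝ) (y : Fin V) (z : TokenSeq V n) : ℝ :=
  ∑ s, trainedAttn V a' z s * (triggerDrift z s - ∑ s', trainedAttn V a' z s' *
      triggerDrift z s') *
    (hit y z s - tokenProb (centeredLogit a (trainedAttn V a' z) z) (z s))

lemma condExpect_driftSum (hV : 2 ≤ V) (t : Fin n) {a a' K : ℝ} (hK : 1 ≤ K)
    (haK : Real.exp |a| ≤ K) (haK' : Real.exp |a'| ≤ K) (ha' : Real.exp |a'| - 1 ≤ K / V) :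
    |((n : ℝ) + 1) * (condExpect V n t fun _ y z => driftSum a a' y z) - mainDrift t| ≤
      36 * K ^ 2 * (1 / V + 1 / ((n : ℝ) + 1)) * (1 / ((t : ℝ) + 2)) := by
  have hV0 : (0 : ℝ) < V := by
    have : 0 < V := by omega
    exact_mod_cast this
  have hT0 : (0 : ℝ) < (n : ℝ) + 1 := by positivity
  have hx0 : 0 < 1 / ((t : ℝ) + 2) := by positivity
  have e1 : ((n : ℝ) + 1) * (condExpect V n t fun _ y z => driftSum a a' y z) - mainDrift t =
      condExpect V n t fun _ y z => ((n : ℝ) + 1) * driftSum a a' y z + -mainDrift t := by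
    rw [condExpect_add t fun _ y z => ((n : ℝ) + 1) * driftSum a a' y z, condExpect_const hV,
      condExpect_const_mul, sub_eq_add_neg]
  set c₀ := 1 / ((t : ℝ) + 2) * (14 * K ^ 2 / V + 1 / ((n : ℝ) + 1)) with hc₀
  set c₁ := 1 / ((t : ℝ) + 2) * (6 * K ^ 2 / ((n : ℝ) + 1)) with hc₁
  have e2 : (condExpect V n t fun _ y z => c₀ + (c₁ * ∑ s, hit y z s +
      K * ∑ s, (if s = t.succ then 0 else driftBound t s) * hit y z s)) =
      c₀ + (c₁ * ∑ s, hitProb V t s +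
        K * ∑ s, (if s = t.succ then 0 else driftBound t s) * hitProb V t s) := by
    rw [condExpect_add t fun _ _ _ => c₀, condExpect_const hV,
      condExpect_add t fun _ y z => c₁ * ∑ s, hit y z s, condExpect_const_mul,
      condExpect_const_mul, condExpect_sum Finset.univ t fun s _ y z => hit y z s,
      condExpect_sum Finset.univ t fun s _ y z =>
        (if s = t.succ then 0 else driftBound t s) * hit y z s]
    simp only [condExpect_const_mul, condExpect_hit hV]
  have hbound : |condExpect V n t fun _ y z =>
      ((n : ℝ) + 1) * driftSum a a' y z + -mainDrift t| ≤ c₀ + (c₁ * ∑ s, hitProb V t s +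
        K * ∑ s, (if s = t.succ then 0 else driftBound t s) * hitProb V t s) := by
    rw [← e2]
    refine abs_condExpect_le hV fun q o z hz => ?_
    have huniv : Finset.Iic (Fin.last n) = Finset.univ := by ext; simp [Fin.le_last]
    have hπ (s : Fin (n + 1)) :
        |((n : ℝ) + 1) * trainedAttn V a' z s - 1| ≤ Real.exp |a'| - 1 := by
      have h := abs_card_mul_softmax_sub_one_le (b := |a'|)
        (u := fun s => a' * (triggerFrac z s - 1 / V)) (Finset.mem_Iic.2 (Fin.le_last s))
        (fun j _ => ?_)
      · rw [Fin.card_Iic] at h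
        simpa [trainedAttn, causalSoftmax] using h
      · rw [← mul_sub, sub_sub_sub_cancel_right, abs_mul, hz.triggerFrac_eq, hz.triggerFrac_eq]
        refine mul_le_of_le_one_right (abs_nonneg _) (abs_le.2 ⟨?_, ?_⟩) <;>
          linarith [configFrac_nonneg t s, configFrac_le_one t s, configFrac_nonneg t j,
            configFrac_le_one t j]
    have hπ0 (s : Fin (n + 1)) : 0 ≤ trainedAttn V a' z s :=
      div_nonneg (Real.exp_pos _).le (Finset.sum_nonneg fun _ _ => (Real.exp_pos _).le)
    have hπ1 : ∑ s, trainedAttn V a' z s = 1 := by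
      have h := sum_causalSoftmax (fun s => a' * (triggerFrac z s - 1 / V)) (Fin.last n)
      rwa [huniv] at h
    have hp (k : Fin V) : tokenProb (centeredLogit a (trainedAttn V a' z) z) k ≤ K / V := by
      have h := (abs_le.1 (abs_tokenProb_sub_le hV
        (abs_centeredLogit_sub_le a hπ0 hπ1 z) k)).2
      have h2 : (Real.exp |a| - 1) / V = Real.exp |a| / V - 1 / V := by ring
      have h3 : Real.exp |a| / V ≤ K / V := by gcongr
      linarith
    have h := abs_drift_sum_sub_le t hK hV0 hπ0 hπ1 (fun s => (hπ s).trans ha')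
      (fun s => by linarith [(abs_le.1 (hπ s)).2])
      (fun s => tokenProb_nonneg (centeredLogit a (trainedAttn V a' z) z) (z s))
      (fun s => tokenProb_le_one _ _) (fun s => hp (z s)) (hit_nonneg o z) (hit_le_one o z)
      (by rw [hit, if_pos hz.2])
    rw [← sub_eq_add_neg]
    simpa only [driftSum, hz.triggerDrift_eq] using h
  rw [e1]
  refine hbound.trans ?_
  have h1 : c₁ * ∑ s, hitProb V t s ≤ c₁ * (2 + 2 * ((n : ℝ) + 1) / V) :=
    mul_le_mul_of_nonneg_left (sum_hitProb_le hV t) (by positivity)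
  have h2 : K * ∑ s, (if s = t.succ then 0 else driftBound t s) * hitProb V t s ≤
      K * (1 / ((t : ℝ) + 2) * (10 / V + 4 / ((n : ℝ) + 1))) :=
    mul_le_mul_of_nonneg_left (sum_driftBound_mul_hitProb_le hV t) (by positivity)
  have e3 : c₀ + (c₁ * (2 + 2 * ((n : ℝ) + 1) / V) +
      K * (1 / ((t : ℝ) + 2) * (10 / V + 4 / ((n : ℝ) + 1)))) =
      ((26 * K ^ 2 + 10 * K) * (1 / V) + (1 + 12 * K ^ 2 + 4 * K) * (1 / ((n : ℝ) + 1))) *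
        (1 / ((t : ℝ) + 2)) := by
    rw [hc₀, hc₁]
    field_simp
    ring
  have h3 : (26 * K ^ 2 + 10 * K) * (1 / V) ≤ 36 * K ^ 2 * (1 / (V : ℝ)) := by
    gcongr
    nlinarith
  have h4 : (1 + 12 * K ^ 2 + 4 * K) * (1 / ((n : ℝ) + 1)) ≤
      36 * K ^ 2 * (1 / ((n : ℝ) + 1)) := by
    gcongr
    nlinarith
  calc _ ≤ c₀ + (c₁ * (2 + 2 * ((n : ℝ) + 1) / V) +
        K * (1 / ((t : ℝ) + 2) * (10 / V + 4 / ((n : ℝ) + 1)))) := by linarith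
    _ = _ := e3
    _ ≤ (36 * K ^ 2 * (1 / V) + 36 * K ^ 2 * (1 / ((n : ℝ) + 1))) * (1 / ((t : ℝ) + 2)) := by
      gcongr
    _ = _ := by ring

/-- The term `t = 1` vanishes as `P(t_q = 0) = 0`. The others are indexed by the zero-based position
of the first trigger, whence the shift by `2`. -/
lemma sum_probFirstTrigger (hV : 2 ≤ V) (hn : 1 ≤ n) (g : ℝ → ℝ) :
    ∑ t ∈ Finset.Icc 1 (n + 1), probFirstTrigger V n (t - 1) / t * g t =
      1 / n * ∑ t : Fin n, 1 / ((t : ℝ) + 2) * g ((t : ℝ) + 2) := by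
  have hIcc : Finset.Icc 1 (n + 1) = Finset.Ico 1 (n + 2) := by ext; simp; omega
  rw [hIcc, Finset.sum_Ico_eq_sum_range, show n + 2 - 1 = n + 1 by omega, Finset.sum_range_succ',
    probFirstTrigger_eq hV hn, if_neg (by omega),
    Fin.sum_univ_eq_sum_range fun i => 1 / ((i : ℝ) + 2) * g ((i : ℝ) + 2), Finset.mul_sum]
  simp only [zero_div, zero_mul, add_zero]
  refine Finset.sum_congr rfl fun i hi => ?_
  have hi' := Finset.mem_range.1 hi
  rw [probFirstTrigger_eq hV hn, if_pos (by omega)]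
  have : ((1 + (i + 1) : ℕ) : ℝ) = (i : ℝ) + 2 := by push_cast; ring
  rw [this]
  ring

lemma abs_scaled_scores_le (hV : 2 ≤ V) (hn : 1 ≤ n) {H η : ℝ} (hη : 0 < η) (hηH : η ≤ H) :
    |alphaOf .streams V n η * V / (V - 1)| ≤ 4 * H ∧
      |alphaOf' .streams V n η * V / (V - 1)| ≤ 8 * H ^ 2 / V := by
  have hV2 : (2 : ℝ) ≤ V := by exact_mod_cast hV
  have hV0 : (0 : ℝ) < V := by linarith
  have hV1 : (0 : ℝ) < V - 1 := by linarith
  have hH : 0 < H := hη.trans_le hηH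
  have hα := abs_alphaOf_le hV hn .streams hη
  have hα' := abs_alphaOf'_le hV hn hη
  have hr2 : (V : ℝ) / (V - 1) ≤ 2 := by rw [div_le_iff₀ hV1]; linarith
  have hr0 : 0 < (V : ℝ) / (V - 1) := by positivity
  have hscale (x : ℝ) : |x * V / (V - 1)| ≤ 2 * |x| := by
    rw [mul_div_assoc, abs_mul, abs_of_pos hr0, mul_comm]
    gcongr
  have h1 : |alphaOf .streams V n η * V / (V - 1)| ≤ 4 * H := by
    have h2 : 4 * η / (V : ℝ) ≤ 2 * H := by
      rw [div_le_iff₀ hV0]; nlinarith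
    linarith [hscale (alphaOf .streams V n η)]
  refine ⟨h1, ?_⟩
  have h2 : η / V * |alphaOf .streams V n η * V / (V - 1)| ≤ H / V * (4 * H) := by gcongr
  calc _ ≤ 2 * (H / V * (4 * H)) := by linarith [hscale (alphaOf' .streams V n η)]
    _ = _ := by ring

/-- One constant serves as `K`: the exponent dominates `|a| ≤ 4H` and `|a'| ≤ 4H²`, and the factor
`8H²` absorbs `|a'| V`. -/
lemma exp_bounds_of_abs_le (hV : 2 ≤ V) {H a a' : ℝ} (hH : 0 < H) (ha : |a| ≤ 4 * H)
    (ha' : |a'| ≤ 8 * H ^ 2 / V) :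
    1 ≤ (1 + 8 * H ^ 2) * Real.exp (4 * H + 4 * H ^ 2) ∧
    Real.exp |a| ≤ (1 + 8 * H ^ 2) * Real.exp (4 * H + 4 * H ^ 2) ∧
    Real.exp |a'| ≤ (1 + 8 * H ^ 2) * Real.exp (4 * H + 4 * H ^ 2) ∧
    Real.exp |a'| - 1 ≤ (1 + 8 * H ^ 2) * Real.exp (4 * H + 4 * H ^ 2) / V := by
  have hV2 : (2 : ℝ) ≤ V := by exact_mod_cast hV
  have hV0 : (0 : ℝ) < V := by linarith
  have hH2 : 0 < H ^ 2 := by positivity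
  have ha4 : |a'| ≤ 4 * H ^ 2 := by
    refine ha'.trans ?_
    rw [div_le_iff₀ hV0]
    nlinarith
  have hexp1 : (1 : ℝ) ≤ Real.exp (4 * H + 4 * H ^ 2) := Real.one_le_exp (by positivity)
  have hKexp : Real.exp (4 * H + 4 * H ^ 2) ≤
      (1 + 8 * H ^ 2) * Real.exp (4 * H + 4 * H ^ 2) := by
    nlinarith
  have h1 : Real.exp |a'| ≤ Real.exp (4 * H + 4 * H ^ 2) := Real.exp_le_exp.2 (by linarith)
  refine ⟨hexp1.trans hKexp, (Real.exp_le_exp.2 (by linarith)).trans hKexp, h1.trans hKexp, ?_⟩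
  calc _ ≤ |a'| * Real.exp |a'| := exp_sub_one_le_mul_exp _
    _ ≤ 8 * H ^ 2 / V * Real.exp (4 * H + 4 * H ^ 2) := by gcongr
    _ = (8 * H ^ 2 * Real.exp (4 * H + 4 * H ^ 2)) / V := by ring
    _ ≤ _ := by
      gcongr
      linarith

lemma sq_ratio_bounds (hV : 2 ≤ V) :
    ((V : ℝ) / (V - 1)) ^ 2 ≤ 4 ∧ |((V : ℝ) / (V - 1)) ^ 2 - 1| ≤ 8 * (1 / (V : ℝ)) := by
  have hV2 : (2 : ℝ) ≤ V := by exact_mod_cast hV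
  have hV0 : (0 : ℝ) < V := by linarith
  have hV1 : (0 : ℝ) < V - 1 := by linarith
  constructor
  · rw [div_pow, div_le_iff₀ (by positivity)]
    nlinarith
  · have e : ((V : ℝ) / (V - 1)) ^ 2 - 1 = (2 * V - 1) / (V - 1) ^ 2 := by
      field_simp; ring
    rw [e, abs_of_nonneg (div_nonneg (by linarith) (by positivity)), mul_one_div,
      div_le_div_iff₀ (by positivity) hV0]
    nlinarith

lemma abs_betaOf_sub_le (hV : 2 ≤ V) (hn : 1 ≤ n) {H η : ℝ} (hη : 0 < η) (hηH : η ≤ H)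
    (i : Fin (n + 1)) (hi : (i : ℕ) = 1) :
    |betaOf .streams V n η i - η * alphaOf .streams V n η * alphaOf' .streams V n η /
        (V * ((n : ℝ) + 1)) *
      ∑ t ∈ Finset.Icc 1 (n + 1), probFirstTrigger V n (t - 1) / t * (1 - 1 / (t : ℝ))| ≤
    (144 * ((1 + 8 * H ^ 2) * Real.exp (4 * H + 4 * H ^ 2)) ^ 2 + 8) *
      (|η * alphaOf .streams V n η * alphaOf' .streams V n η| / (V * ((n : ℝ) + 1))) *
      (1 / V + 1 / ((n : ℝ) + 1)) *
        ∑ t ∈ Finset.Icc 1 (n + 1), probFirstTrigger V n (t - 1) / t := by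
  have hV2 : (2 : ℝ) ≤ V := by exact_mod_cast hV
  have hV0 : (0 : ℝ) < V := by linarith
  have hV1 : (0 : ℝ) < V - 1 := by linarith
  have hn0 : (0 : ℝ) < n := by exact_mod_cast hn
  have hT0 : (0 : ℝ) < (n : ℝ) + 1 := by positivity
  have hH : 0 < H := hη.trans_le hηH
  obtain ⟨haH, haH'⟩ := abs_scaled_scores_le hV hn hη hηH
  have hβ := betaOf_eq_expect hV η i hi
  simp only at hβ
  set α := alphaOf .streams V n η with hαdef
  set α' := alphaOf' .streams V n η with hαdef'
  set a := α * V / (V - 1) with ha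
  set a' := α' * V / (V - 1) with ha'
  set K := (1 + 8 * H ^ 2) * Real.exp (4 * H + 4 * H ^ 2) with hKdef
  obtain ⟨hK, h1, h2, h3⟩ := exp_bounds_of_abs_le hV hH haH haH'
  rw [← hKdef] at hK h1 h2 h3
  have hterm (t : Fin n) := condExpect_driftSum hV t hK h1 h2 h3
  have hS1 := sum_probFirstTrigger hV hn fun x => 1 - 1 / x
  have hS0 := sum_probFirstTrigger hV hn fun _ => 1
  simp only [mul_one] at hS0
  rw [hS0, hS1]
  set S₀ := 1 / n * ∑ t : Fin n, 1 / ((t : ℝ) + 2) with hS₀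
  set S₁ := 1 / n * ∑ t : Fin n, 1 / ((t : ℝ) + 2) * (1 - 1 / ((t : ℝ) + 2)) with hS₁
  set E := 1 / n * ∑ t : Fin n, condExpect V n t fun _ y z => driftSum a a' y z with hE
  have hβE : betaOf .streams V n η i = η / V * a * a' * E := by
    rw [hβ, hE, ← expect_eq_average hV hn]
    rfl
  have hS₀0 : 0 ≤ S₀ := by positivity
  have hS₁0 : |S₁| ≤ S₀ := by
    rw [hS₁, hS₀, abs_mul, abs_of_pos (by positivity)]
    gcongr
    refine (Finset.abs_sum_le_sum_abs _ _).trans (Finset.sum_le_sum fun t _ => ?_)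
    have h4 : 1 / ((t : ℝ) + 2) ≤ 1 := by
      rw [div_le_one (by positivity)]
      have : (0 : ℝ) ≤ t := by positivity
      linarith
    have h5 : 0 < 1 / ((t : ℝ) + 2) := by positivity
    rw [abs_mul, abs_of_pos h5]
    refine mul_le_of_le_one_right h5.le (abs_le.2 ⟨?_, ?_⟩) <;> linarith
  have hES : |((n : ℝ) + 1) * E - S₁| ≤
      36 * K ^ 2 * (1 / V + 1 / ((n : ℝ) + 1)) * S₀ := by
    have e : ((n : ℝ) + 1) * E - S₁ = 1 / n * ∑ t : Fin n, (((n : ℝ) + 1) *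
        (condExpect V n t fun _ y z => driftSum a a' y z) - mainDrift t) := by
      rw [Finset.sum_sub_distrib, ← Finset.mul_sum, hE, hS₁]
      simp only [mainDrift]
      ring
    rw [e, abs_mul, abs_of_pos (by positivity), hS₀, mul_left_comm]
    gcongr
    rw [Finset.mul_sum]
    exact (Finset.abs_sum_le_sum_abs _ _).trans (Finset.sum_le_sum fun t _ => hterm t)
  set r := (V : ℝ) / (V - 1) with hr
  set M := η * α * α' / (V * ((n : ℝ) + 1)) with hM
  -- Both scales `a` and `a'` carry the factor `r = V/(V-1)`. The constants `144 = 4 * 36` and `8`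
  -- come from `r² ≤ 4` and `|r² - 1| ≤ 8/V`.
  have hid : betaOf .streams V n η i - M * S₁ =
      M * (r ^ 2 * (((n : ℝ) + 1) * E - S₁) + (r ^ 2 - 1) * S₁) := by
    rw [hβE, hM, ha, ha', hr]
    field_simp
    ring
  obtain ⟨hr4, hr1⟩ := sq_ratio_bounds hV
  rw [← hr] at hr4 hr1
  have hMabs : |M| = |η * α * α'| / (V * ((n : ℝ) + 1)) := by
    rw [hM, abs_div, abs_of_pos (by positivity : (0 : ℝ) < V * ((n : ℝ) + 1))]
  rw [hid, abs_mul, hMabs]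
  have hfin : |r ^ 2 * (((n : ℝ) + 1) * E - S₁) + (r ^ 2 - 1) * S₁| ≤
      (144 * K ^ 2 + 8) * ((1 / V + 1 / ((n : ℝ) + 1)) * S₀) := by
    refine (abs_add_le _ _).trans ?_
    rw [abs_mul, abs_mul, abs_of_nonneg (sq_nonneg r)]
    have h4 : r ^ 2 * |((n : ℝ) + 1) * E - S₁| ≤
        4 * (36 * K ^ 2 * (1 / V + 1 / ((n : ℝ) + 1)) * S₀) := by gcongr
    have h5 : |r ^ 2 - 1| * |S₁| ≤ 8 * (1 / V + 1 / ((n : ℝ) + 1)) * S₀ := by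
      have : 0 < 1 / ((n : ℝ) + 1) := by positivity
      gcongr
      linarith
    calc _ ≤ 4 * (36 * K ^ 2 * (1 / V + 1 / ((n : ℝ) + 1)) * S₀) +
          8 * (1 / V + 1 / ((n : ℝ) + 1)) * S₀ := add_le_add h4 h5
      _ = _ := by ring
  calc _ ≤ |η * α * α'| / (V * ((n : ℝ) + 1)) *
        ((144 * K ^ 2 + 8) * ((1 / V + 1 / ((n : ℝ) + 1)) * S₀)) := by gcongr
    _ = _ := by ring

end RPETransformer

end

theorem mainTheorem1 (H : ℝ) (hH : 0 < H) :
    ∃ C > 0, ∃ c > 0, ∃ V₀ : ℕ, ∀ (V n : ℕ) (η : ℝ), 2 ≤ V → 1 ≤ n → 0 < η → η ≤ H →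
      ∀ A : Arch, ∃ α α' β : ℝ,
        -- the learned score of `W_O²`; the length of the sequences is `T = n + 1`
        |α - η / (V * (n + 1 : ℝ))| ≤
          C * (η / (V * (n + 1 : ℝ))) * (1 / V + 1 / (n + 1 : ℝ) + (n + 1 : ℝ) / V ^ 2) ∧
        -- the learned score of `W_K²`
        (A = Arch.streams → V₀ ≤ V → 2 ≤ n → n + 1 ≤ V →
          c * (α * η / (V * (n + 1 : ℝ))) * (1 / (n + 1 : ℝ)) ≤ α') ∧
        -- the learned score of `W_K¹`
        (A = Arch.streams →
          |β - η * α * α' / (V * (n + 1 : ℝ)) *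
              ∑ t ∈ Finset.Icc 1 (n + 1), probFirstTrigger V n (t - 1) / t * (1 - 1 / (t : ℝ))| ≤
            C * (|η * α * α'| / (V * (n + 1 : ℝ))) * (1 / V + 1 / (n + 1 : ℝ)) *
              ∑ t ∈ Finset.Icc 1 (n + 1), probFirstTrigger V n (t - 1) / t) ∧
        -- the trained matrices, for nearly orthonormal embeddings of any dimension
        ∀ δ > 0, ∃ ε > 0, ∀ (d : ℕ) (P : Frozen V d),
          P.WQ1 = 1 → P.WQ2 = 1 → NearOrthonormal n ε P →
            (∃ ω : Fin V → ℝ, ∃ W' ∈ otherAssociations P (pairsWO2 V n),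
              trainedWO2 n A P η =
                ∑ v, ω v • Matrix.vecMulVec (P.wU v) (P.WV2 *ᵥ P.wE v) + W' ∧
              ∀ v, |ω v - α| ≤ δ) ∧
            (∃ ψ : Fin V → ℝ, ∃ W' ∈ otherAssociations P (pairsWK2 V n),
              trainedWK2 n A P η =
                ∑ k, ψ k • Matrix.vecMulVec (P.wE k) (P.Phi1 *ᵥ P.wE k) + W' ∧
              ∀ k, |ψ k - α'| ≤ δ) ∧
            (∃ χ : Fin V → ℝ, ∃ W' ∈ otherAssociations P (pairsWK1 V n),
              trainedWK1 n A P η = ∑ k, χ k • Matrix.vecMulVec (P.wE k) (P.r 1) + W' ∧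
              ∀ k, |χ k - β| ≤ δ) ∧
            (∀ v, |P.wU v ⬝ᵥ (trainedWO2 n A P η *ᵥ (P.WV2 *ᵥ P.wE v)) - α| ≤ δ) ∧
            (∀ k, |P.wE k ⬝ᵥ (trainedWK2 n A P η *ᵥ (P.Phi1 *ᵥ P.wE k)) - α'| ≤ δ) ∧
            ∀ v, |P.wE v ⬝ᵥ (trainedWK1 n A P η *ᵥ P.r 1) - β| ≤ δ := by
  set K := (1 + 8 * H ^ 2) * Real.exp (4 * H + 4 * H ^ 2)
  -- The first constant is the one needed for `β` and exceeds the `4` needed for `α`. The threshold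
  -- collects `V ≥ 73` and `V ≥ 1512 H` from the lower bound on `α'`.
  refine ⟨144 * K ^ 2 + 8, by positivity, 1 / 36, by norm_num, max 73 ⌈1512 * H⌉₊, ?_⟩
  intro V n η hV hn hη hηH A
  have hi : ((⟨1, by omega⟩ : Fin (n + 1)) : ℕ) = 1 := rfl
  refine ⟨alphaOf A V n η, alphaOf' A V n η, betaOf A V n η ⟨1, by omega⟩, ?_, ?_, ?_,
    fun δ hδ => trained_nearOrthonormal A η _ hi hδ⟩
  · refine (abs_alphaOf_sub_le hV hn A hη).trans ?_
    gcongr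
    nlinarith [sq_nonneg K]
  · rintro rfl hV₀ hn2 hnV
    refine le_alphaOf' ((le_max_left _ _).trans hV₀) ?_ hn2 hnV hη hηH
    exact (Nat.le_ceil _).trans (by exact_mod_cast (le_max_right _ _).trans hV₀)
  · rintro rfl
    exact abs_betaOf_sub_le hV hn hη hηH _ hi
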